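/- **Setting.** Let $b$ be a prime, $m,s\in\mathbb N_0$, $N=b^m$, and let $0\le w_1\le w_2\le\cdots$ be integers (reduction indices), $w_0:=0$. Let $s^*$ be the largest $j\ge1$ with $w_j<m$ ($s^*=0$ if there is none, $s^*=\infty$ if all $w_j<m$). Let POD weights $\gamma_{\mathfrak u}=\Gamma(|\mathfrak u|)\prod_{j\in\mathfrak u}\gamma_j$, $\mathfrak u\subseteq\{1,\dots,s\}$, be given, with $\Gamma(0)=1$, $\Gamma(\ell)>0$, $\gamma_j\ge0$ (product weights: $\Gamma\equiv1$). For $\alpha>1$ put $\omega_\alpha(x)=\sum_{0\ne h\in\mathbb Z}e^{2\pi i hx}/|h|^{\alpha}$; for $n\in\mathbb N$ let $\mathbb Z_n^\times=\{0\le z<n:\gcd(z,n)=1\}$ and $\Omega_n=[\omega_\alpha((kz\bmod n)/n)]_{z\in\mathbb Z_n^\times,\,0\le k<n}$. For $0\le w'\le w''\le m$ let $P_{w'',w'}:\mathbb R^{b^{m-w'}}\to\mathbb R^{b^{m-w''}}$ divide a vector into $b^{w''-w'}$ blocks of length $b^{m-w''}$ and add them up. **Algorithm (fast reduced CBC construction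 for POD weights).** Put $q_{0,0}=\mathbf 1_{b^m}$, $q_{0,1}=\mathbf 0_{b^m}$. For $j=1,\dots,s$, as long as $w_j<m$: 1. $\overline q_j=\sum_{\ell=1}^{j}\frac{\Gamma(\ell)}{\Gamma(\ell-1)}\,P_{w_j,w_{j-1}}q_{j-1,\ell-1}$ and $T_j=\Omega_{b^{m-w_j}}\overline q_j$; 2. $z_j$ is a minimizer of $T_j(z)$ over $z\in\mathbb Z_{b^{m-w_j}}^\times$ (ties are broken arbitrarily); 3. $q_{j,0}=b^{w_j}\,\mathbf 1_{b^{m-w_j}}$, $q_{j,j+1}=\mathbf 0_{b^{m-w_j}}$, and for $1\le\ell\le j$, with $.*$ the element-wise product, $q_{j,\ell}=P_{w_j,w_{j-1}}q_{j-1,\ell}+\frac{\Gamma(\ell)}{\Gamma(\ell-1)}\,\gamma_j\,\Omega_{b^{m-w_j}}(z_j,:)\,.*\,P_{w_j,w_{j-1}}q_{j-1,\ell-1}$. Set $z_j=0$ if $w_j\ge m$. The result is the generating vector $\widetilde z=(b^{w_1}z_1,\dots,b^{w_s}z_s)$ of an $N$-point lattice rule. **Cost model.** A program may load rational constants, values $\omega_\alpha(k/n)$,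 $\cos(2\pi k/n)$, $\sin(2\pi k/n)$ and the weights $\Gamma(\ell)$, $\gamma_j$ into real registers, copy registers, perform $+,-,\cdot,/$ on them, compare two of them and branch, and return integers. Every such operation costs one unit (index arithmetic is not counted, as the program may depend on $b,m,s,(w_j)$, but neither on $\alpha$ nor on the weights). The arithmetic cost is the largest number of operations on a branch; the memory cost is the number of registers used. **Theorem.** (a) The result of the algorithm can be computed, for all $\alpha>1$ and all POD weights as above, with an arithmetic cost of $$\mathcal O\Big(\sum_{j=1}^{\min\{s,s^*\}}(m-w_j+j)\,b^{m-w_j}\Big)\quad\text{and a memory cost of}\quad \mathcal O\Big(\sum_{j=1}^{\min\{s,s^*\}}b^{m-w_j}\Big).$$ (b) For product weights it can be computed with an arithmetic cost of $\mathcal O\big(\sum_{j=1}^{\min\{s,s^*\}}(m-w_j)\,b^{m-w_j}\big)$ and a memory cost of $\mathcal O(b^{\max\{0,m-w_1\}})$. The implied constants in (a) and (b) depend only on $b$. (c) Let $\widetilde z$ be any result of the algorithm with $\alpha=2$ and with $\gamma_j$ replaced by $\gamma_j/(2\pi^2)$, and let $Q_N(F)=\frac1N\sum_{k=1}^NF\big(\{k\widetilde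 z/N+\Delta\}-(\tfrac12,\dots,\tfrac12)\big)$, with $\Delta$ uniformly distributed on $[0,1]^s$. Then for all $\lambda\in(\tfrac12,1]$ and all $F$ in the weighted unanchored Sobolev space $\mathcal W_{s,\gamma}$ of functions on $[-\frac12,\frac12]^s$ with square integrable (weak) mixed first derivatives and finite norm $$\|F\|_{\mathcal W_{s,\gamma}}=\Big(\sum_{\mathfrak u\subseteq\{1,\dots,s\}}\gamma_{\mathfrak u}^{-1}\int_{[-\frac12,\frac12]^{|\mathfrak u|}}\Big(\int_{[-\frac12,\frac12]^{s-|\mathfrak u|}}\frac{\partial^{|\mathfrak u|}F}{\partial y_{\mathfrak u}}\,dy_{-\mathfrak u}\Big)^2dy_{\mathfrak u}\Big)^{1/2}$$ (where $\infty\cdot0=0$ if $\gamma_{\mathfrak u}=0$) one has $$\sqrt{\mathbb E_\Delta\Big[\Big|\int_{[-\frac12,\frac12]^s}F(y)\,dy-Q_N(F)\Big|^2\Big]}\le\Big(\sum_{\emptyset\ne\mathfrak u\subseteq\{1,\dots,s\}}\gamma_{\mathfrak u}^{\lambda}\,\varrho(\lambda)^{|\mathfrak u|}\,b^{\min\{m,\max_{j\in\mathfrak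 u}w_j\}}\Big)^{\frac1{2\lambda}}\Big(\frac2N\Big)^{\frac1{2\lambda}}\|F\|_{\mathcal W_{s,\gamma}},$$ with $\varrho(\lambda)=2\zeta(2\lambda)(2\pi^2)^{-\lambda}$. -/

import Mathlib

open MeasureTheory
open scoped ENNReal

noncomputable section

namespace RedCBC

/-! ### Indices

Sequences `w`, `γ`, `z` are indexed by `j = 1, 2, …` as in the usual notation (the value at `0` is
never used), and the coordinate `i : Fin s` of a point corresponds to the index `j = i + 1`. -/

/-- `s^*`: the largest `j ≥ 1` with `w_j < m` (it is `0` if there is none and `⊤` if `w_j < m` for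
arbitrarily large `j`). -/
def sStar (w : ℕ → ℕ) (m : ℕ) : ℕ∞ :=
  ⨆ j ∈ {j : ℕ | 1 ≤ j ∧ w j < m}, (j : ℕ∞)

/-- `min {s, s^*}`. -/
def lastIndex (w : ℕ → ℕ) (m s : ℕ) : ℕ :=
  (min (s : ℕ∞) (sStar w m)).toNat

/-! ### The algorithm -/

/-- `ω(x) = ∑_{0 ≠ h ∈ ℤ} e^{2 π i h x} / |h|^α`. -/
def korobovOmega (α x : ℝ) : ℝ :=
  (∑' h : {h : ℤ // h ≠ 0},
    Complex.exp (2 * Real.pi * Complex.I * ((h : ℤ) : ℂ) * (x : ℂ)) /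
      ((|((h : ℤ) : ℝ)| ^ α : ℝ) : ℂ)).re

/-- The units of `ℤ / n`, represented by the integers `0 ≤ z < n` with `gcd (z, n) = 1`. -/
def unitsMod (n : ℕ) : Finset ℕ :=
  (Finset.range n).filter fun z => Nat.gcd z n = 1

/-- The entry of the matrix `Ω_n` in row `z` and column `k`. -/
def omegaEntry (om : ℝ → ℝ) (n z k : ℕ) : ℝ :=
  om (((k * z % n : ℕ) : ℝ) / (n : ℝ))

/-- The "fold and sum" operator `P_{w'',w'}^m` (here `w₁ = w'`, `w₂ = w''`): a vector of length
`b^(m - w₁)` is divided into `b^(w₂ - w₁)` blocks of length `b^(m - w₂)`, which are added up.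
A vector of length `n` is a function on `ℕ` of which only the values on `{0, …, n - 1}` matter. -/
def foldSum (b m w₁ w₂ : ℕ) (v : ℕ → ℝ) (k : ℕ) : ℝ :=
  ∑ t ∈ Finset.range (b ^ (w₂ - w₁)), v (k + t * b ^ (m - w₂))

/-- The sequence `w` with `w_0 := 0`. -/
def withZero (w : ℕ → ℕ) (j : ℕ) : ℕ := if j = 0 then 0 else w j

/-- The vectors `q_{j,ℓ}`, as functions of the choices `z_1, …, z_j`. -/
def qVec (b m : ℕ) (w : ℕ → ℕ) (om : ℝ → ℝ) (Γ γ : ℕ → ℝ) (z : ℕ → ℕ) : ℕ → ℕ → ℕ → ℝ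
  | 0, 0, _ => 1
  | 0, _ + 1, _ => 0
  | j + 1, 0, _ => (b : ℝ) ^ w (j + 1)
  | j + 1, ℓ + 1, k =>
      if ℓ ≤ j then
        foldSum b m (withZero w j) (w (j + 1)) (qVec b m w om Γ γ z j (ℓ + 1)) k
          + Γ (ℓ + 1) / Γ ℓ * γ (j + 1) * omegaEntry om (b ^ (m - w (j + 1))) (z (j + 1)) k
            * foldSum b m (withZero w j) (w (j + 1)) (qVec b m w om Γ γ z j ℓ) k
      else 0

/-- The vector `q̄_j = ∑_{ℓ=1}^j Γ(ℓ)/Γ(ℓ-1) [P q_{j-1,ℓ-1}]`. -/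
def qBar (b m : ℕ) (w : ℕ → ℕ) (om : ℝ → ℝ) (Γ γ : ℕ → ℝ) (z : ℕ → ℕ) (j k : ℕ) : ℝ :=
  ∑ ℓ ∈ Finset.Icc 1 j, Γ ℓ / Γ (ℓ - 1) *
    foldSum b m (withZero w (j - 1)) (w j) (qVec b m w om Γ γ z (j - 1) (ℓ - 1)) k

/-- The component of `T_j = Ω_{b^(m - w_j)} q̄_j` that belongs to the unit `x`. -/
def tVec (b m : ℕ) (w : ℕ → ℕ) (om : ℝ → ℝ) (Γ γ : ℕ → ℝ) (z : ℕ → ℕ) (j x : ℕ) : ℝ :=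
  ∑ k ∈ Finset.range (b ^ (m - w j)),
    omegaEntry om (b ^ (m - w j)) x k * qBar b m w om Γ γ z j k

/-- `z_1, …, z_s` are a possible result of the fast reduced CBC construction for POD weights:
as long as `w_j < m`, `z_j` is a minimizer of `T_j` over the units modulo `b^(m - w_j)` (ties may
be broken in any way), and the remaining `z_j` are `0`. -/
def IsFastRedCBC (b m s : ℕ) (w : ℕ → ℕ) (om : ℝ → ℝ) (Γ γ : ℕ → ℝ) (z : ℕ → ℕ) : Prop :=
  ∀ j ∈ Finset.Icc 1 s,
    (w j < m → z j ∈ unitsMod (b ^ (m - w j)) ∧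
      ∀ x ∈ unitsMod (b ^ (m - w j)),
        tVec b m w om Γ γ z j (z j) ≤ tVec b m w om Γ γ z j x) ∧
    (m ≤ w j → z j = 0)

/-! ### The model of computation

Programs over the real numbers (algebraic computation trees with registers). All registers are `0`
at the start. The numbers `Γ(ℓ)` and `γ_j` are input which can be read into a register, and the
values of `ω` at rational points can be computed at unit cost, as well as the cosines and sines
that occur in a Fourier transform. Every instruction and every comparison costs one unit. A program
has no access to the input other than through these instructions. -/

/-- What a program is applied to: the function `ω` and the weights. -/
structure Input where
  /-- the function `ω` -/
  om : ℝ → ℝ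
  /-- the order-dependent part `Γ(ℓ)` of the weights -/
  Γ : ℕ → ℝ
  /-- the product part `γ_j` of the weights -/
  γ : ℕ → ℝ

/-- The instructions; the first argument is the register which receives the result, and the
register arguments of the last five are the operands. -/
inductive Instr where
  | const (dst : ℕ) (c : ℚ)
  | cosine (dst : ℕ) (p : ℤ) (n : ℕ)
  | sine (dst : ℕ) (p : ℤ) (n : ℕ)
  | omegaVal (dst : ℕ) (k n : ℕ)
  | readOrder (dst : ℕ) (ℓ : ℕ)
  | readProd (dst : ℕ) (j : ℕ)
  | copy (dst src : ℕ)
  | add (dst x y : ℕ)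
  | sub (dst x y : ℕ)
  | mul (dst x y : ℕ)
  | div (dst x y : ℕ)

/-- The register that receives the result. -/
def Instr.dst : Instr → ℕ
  | .const d _ | .cosine d _ _ | .sine d _ _ | .omegaVal d _ _ | .readOrder d _ | .readProd d _
  | .copy d _ | .add d _ _ | .sub d _ _ | .mul d _ _ | .div d _ _ => d

/-- The registers that an instruction reads or writes. -/
def Instr.regs : Instr → Finset ℕ
  | .const d _ | .cosine d _ _ | .sine d _ _ | .omegaVal d _ _ | .readOrder d _
  | .readProd d _ => {d}
  | .copy d x => {d, x}
  | .add d x y | .sub d x y | .mul d x y | .div d x y => {d, x, y}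

/-- The number that an instruction computes on the input `I` if the registers hold `r`. -/
def Instr.value (I : Input) (r : ℕ → ℝ) : Instr → ℝ
  | .const _ c => (c : ℝ)
  | .cosine _ p n => Real.cos (2 * Real.pi * (p : ℝ) / (n : ℝ))
  | .sine _ p n => Real.sin (2 * Real.pi * (p : ℝ) / (n : ℝ))
  | .omegaVal _ k n => I.om ((k : ℝ) / (n : ℝ))
  | .readOrder _ ℓ => I.Γ ℓ
  | .readProd _ j => I.γ j
  | .copy _ x => r x
  | .add _ x y => r x + r y
  | .sub _ x y => r x - r y
  | .mul _ x y => r x * r y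
  | .div _ x y => r x / r y

/-- Programs: stop and return the integers `z_1, z_2, …`, perform an instruction and go on, or
compare two registers and branch. -/
inductive Prog where
  | halt (z : ℕ → ℕ)
  | step (i : Instr) (P : Prog)
  | ifLe (x y : ℕ) (P Q : Prog)

open Classical in
/-- The result of a program on the input `I`, started with register contents `r`. -/
def Prog.run (I : Input) : Prog → (ℕ → ℝ) → (ℕ → ℕ)
  | .halt z, _ => z
  | .step i P, r => P.run I (Function.update r i.dst (i.value I r))
  | .ifLe x y P Q, r => if r x ≤ r y then P.run I r else Q.run I r

/-- The result of a program on the input `I`. -/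
def Prog.output (P : Prog) (I : Input) : ℕ → ℕ := P.run I fun _ => 0

/-- The arithmetic cost of a program: the largest number of instructions and comparisons on any
of its branches. -/
def Prog.cost : Prog → ℕ
  | .halt _ => 0
  | .step _ P => P.cost + 1
  | .ifLe _ _ P Q => max P.cost Q.cost + 1

/-- The registers that occur in a program. -/
def Prog.regs : Prog → Finset ℕ
  | .halt _ => ∅
  | .step i P => i.regs ∪ P.regs
  | .ifLe x y P Q => {x, y} ∪ P.regs ∪ Q.regs

/-- The memory cost of a program: the number of registers that it uses. -/
def Prog.memory (P : Prog) : ℕ := P.regs.card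

/-! ### Lattice rules and the unanchored Sobolev space -/

/-- The cube `[-1/2, 1/2]^s`. -/
def cube (s : ℕ) : Set (Fin s → ℝ) := Set.univ.pi fun _ => Set.Icc (-(1 / 2)) (1 / 2)

/-- The open cube `(-1/2, 1/2)^s`. -/
def openCube (s : ℕ) : Set (Fin s → ℝ) := Set.univ.pi fun _ => Set.Ioo (-(1 / 2)) (1 / 2)

/-- The cube `[0, 1]^s` of the shifts. -/
def shiftCube (s : ℕ) : Set (Fin s → ℝ) := Set.univ.pi fun _ => Set.Icc 0 1

/-- The generating vector `(b^{w_1} z_1, …, b^{w_s} z_s)`. -/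
def genVec (b s : ℕ) (w z : ℕ → ℕ) (i : Fin s) : ℕ :=
  b ^ w ((i : ℕ) + 1) * z ((i : ℕ) + 1)

/-- The `N`-point rank-1 lattice rule with generating vector `g` and shift `Δ`, with the points
`{k g / N + Δ} - (1/2, …, 1/2)`, `k = 1, …, N`. -/
def latticeRule {s : ℕ} (N : ℕ) (g : Fin s → ℕ) (Δ : Fin s → ℝ) (F : (Fin s → ℝ) → ℝ) : ℝ :=
  (1 / (N : ℝ)) * ∑ k ∈ Finset.Icc 1 N,
    F fun i => Int.fract ((k : ℝ) * (g i : ℝ) / (N : ℝ) + Δ i) - 1 / 2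

/-- The root mean square error `(E_Δ |I_s(F) - Q_N(F)|²)^{1/2}` of the randomly shifted
lattice rule. -/
def rmsError {s : ℕ} (N : ℕ) (g : Fin s → ℕ) (F : (Fin s → ℝ) → ℝ) : ℝ≥0∞ :=
  (∫⁻ Δ in shiftCube s,
    ENNReal.ofReal (((∫ y in cube s, F y) - latticeRule N g Δ F) ^ 2)) ^ (1 / 2 : ℝ)

/-- `g` is the weak partial derivative of `f` with respect to the coordinate `j` on the cube. -/
def IsWeakPartial {s : ℕ} (j : Fin s) (f g : (Fin s → ℝ) → ℝ) : Prop :=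
  ∀ φ : (Fin s → ℝ) → ℝ, ContDiff ℝ ((⊤ : ℕ∞) : WithTop ℕ∞) φ → HasCompactSupport φ →
    tsupport φ ⊆ openCube s →
    ∫ y in cube s, f y * fderiv ℝ φ y (Pi.single j 1) = -∫ y in cube s, g y * φ y

/-- `F` has square integrable mixed first derivatives on the cube, and `D u` is the (weak)
derivative with respect to the variables `y_j`, `j ∈ u`. -/
structure HasMixedDerivs {s : ℕ} (F : (Fin s → ℝ) → ℝ)
    (D : Finset (Fin s) → (Fin s → ℝ) → ℝ) : Prop where
  zero : D ∅ = F
  memLp : ∀ u, MemLp (D u) 2 (volume.restrict (cube s))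
  succ : ∀ u, ∀ j ∉ u, IsWeakPartial j (D u) (D (insert j u))

/-- The norm of the weighted unanchored Sobolev space of a function with mixed derivatives `D`.
In the inner integral the variables `y_j`, `j ∉ u`, are integrated out; its value depends only on
the variables `y_j`, `j ∈ u`, so that the outer integral can be taken over the whole cube (of
volume 1). If `γ_u = 0` then the factor `γ_u⁻¹` is `∞`, so the norm is finite only if the
integral vanishes (`∞ * 0 = 0`). -/
def sobolevNorm {s : ℕ} (wt : Finset (Fin s) → ℝ)
    (D : Finset (Fin s) → (Fin s → ℝ) → ℝ) : ℝ≥0∞ :=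
  (∑ u : Finset (Fin s), (ENNReal.ofReal (wt u))⁻¹ *
    ∫⁻ y in cube s, ENNReal.ofReal ((∫ t in cube s, D u (u.piecewise y t)) ^ 2)) ^ (1 / 2 : ℝ)

/-- POD weights `γ_u = Γ(|u|) ∏_{j ∈ u} γ_j`. -/
def podWeight {s : ℕ} (Γ γ : ℕ → ℝ) (u : Finset (Fin s)) : ℝ :=
  Γ u.card * ∏ i ∈ u, γ ((i : ℕ) + 1)

/-- `ϱ(λ) = 2 ζ(2λ) (2π²)^{-λ}`. -/
def rho (lam : ℝ) : ℝ :=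
  2 * (riemannZeta ((2 * lam : ℝ) : ℂ)).re * (2 * Real.pi ^ 2) ^ (-lam)

/-- `(∑_{∅ ≠ u ⊆ {1:s}} γ_u^λ ϱ(λ)^{|u|} b^{min {m, max_{j ∈ u} w_j}})^{1/(2λ)} (2/N)^{1/(2λ)}`
with `N = b^m`. -/
def errorFactor (b m s : ℕ) (w : ℕ → ℕ) (wt : Finset (Fin s) → ℝ) (lam : ℝ) : ℝ :=
  (∑ u ∈ Finset.univ.filter (fun u : Finset (Fin s) => u.Nonempty),
      wt u ^ lam * rho lam ^ u.card
        * (b : ℝ) ^ min m (u.sup fun i => w ((i : ℕ) + 1))) ^ (1 / (2 * lam))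
    * (2 / (b : ℝ) ^ m) ^ (1 / (2 * lam))

end RedCBC

end

open RedCBC

/-! Cost. A column index k < b^M is k = b^(M-i) u with a unit u modulo b^i, for exactly one pair (i,
u). For a unit z the fractional part of kz/b^M is that of uz/b^i, so the block of Ω belonging to i
is a correlation on the commutative group of units modulo b^i. The convolution theorem
(`sum_dft_mul_dft`) reduces it to Fourier transforms on finite groups. Peeling off subgroups of
prime index factors such a transform into sparse layers (`isFast_dft`). The primes that occur divide
b^(i-1)(b-1), hence are at most b, so a layer has at most b entries per row and O(M) layers suffice.
This gives `exists_isCode_matVec` with O(M b^M) operations.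

The remaining work of step j is folding and updating vectors of length b^(m-w_j): about j of them
for POD weights. For product weights only the sum of the q_{j,ℓ} over ℓ matters, and it satisfies a
recursion of its own, so one vector is enough. `exists_prog_of_invariant` turns code that maintains
such data into a program for the whole search.

Error. By Parseval's identity on the torus of shifts, the mean square error is a sum of squared
Fourier coefficients over the nonzero dual lattice vectors (`lintegral_sq_error_le`). A coefficient
whose frequency h has support u is integrated by parts once in each direction of u, using the
primitive of the exponential that vanishes on both faces of the cube. Since this primitive has
squared norm 1/(2π²h²), Cauchy–Schwarz bounds the squared coefficient by ∏ 1/(2π²h_k²) times the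
part of the squared norm belonging to u (`HasMixedDerivs.sq_enorm_integral_mul_wave_le`). Hence the
mean square error is at most the squared norm times the sum over nonempty u of γ_u (2π²)^(-|u|)
times the dual lattice sum of ∏ |h_k|^(-2).

The vectors of the algorithm have a closed form (`qVec_eq_sum`, `tVec_eq_sum`). By orthogonality of
characters (`sum_prod_korobovOmega`), γ_d T_d(x)/N, with the rescaled weights, is exactly the part
of that last sum belonging to the sets u with largest element d when z_d = x. So z_d does at least
as well as the average unit. Raising to the power λ ≤ 1 is subadditive and changes the exponent 2
into 2λ > 1. The average over the units then costs a factor 2/b^(m-w_d) (`sum_units_tsum_le`), or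
the trivial bound is used if w_d ≥ m. Summing over d gives `rpow_sum_nonempty_le`, and `rmsError_le`
combines the two halves. -/

namespace RedCBC

/-! ### Straight-line code -/

/-- The register contents after the execution of a list of instructions. -/
noncomputable def exec (I : Input) : List Instr → (ℕ → ℝ) → (ℕ → ℝ)
  | [], r => r
  | i :: l, r => exec I l (Function.update r i.dst (i.value I r))

/-- Straight-line code followed by a program. -/
def Prog.after : List Instr → Prog → Prog
  | [], P => P
  | i :: l, P => .step i (Prog.after l P)

theorem exec_append (I : Input) (l₁ l₂ : List Instr) (r : ℕ → ℝ) :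
    exec I (l₁ ++ l₂) r = exec I l₂ (exec I l₁ r) := by
  induction l₁ generalizing r with
  | nil => rfl
  | cons i l ih => exact ih _

theorem Prog.run_after (I : Input) (l : List Instr) (P : Prog) (r : ℕ → ℝ) :
    (Prog.after l P).run I r = P.run I (exec I l r) := by
  induction l generalizing r with
  | nil => rfl
  | cons i l ih => exact ih _

theorem Prog.cost_after (l : List Instr) (P : Prog) :
    (Prog.after l P).cost = l.length + P.cost := by
  induction l with
  | nil => simp [Prog.after]
  | cons i l ih => simp [Prog.after, Prog.cost, ih]; ring

theorem Prog.regs_after_subset {l : List Instr} {P : Prog} {R : Finset ℕ}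
    (hl : ∀ i ∈ l, i.regs ⊆ R) (hP : P.regs ⊆ R) : (Prog.after l P).regs ⊆ R := by
  induction l with
  | nil => exact hP
  | cons i l ih =>
    exact Finset.union_subset (hl i (by simp)) (ih fun j hj => hl j (by simp [hj]))

/-! ### Arithmetic expressions -/

/-- The register with number `k` in the region `t`. Region `0` is used for intermediate results. -/
def slot (t k : ℕ) : ℕ := Nat.pair t k

theorem slot_inj {t k t' k' : ℕ} : slot t k = slot t' k' ↔ t = t' ∧ k = k' := Nat.pair_eq_pair

/-- Arithmetic expressions in the registers and the data. -/
inductive Expr where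
  | const (c : ℚ)
  | cosine (p : ℤ) (n : ℕ)
  | sine (p : ℤ) (n : ℕ)
  | omegaVal (k n : ℕ)
  | readOrder (ℓ : ℕ)
  | readProd (j : ℕ)
  | reg (x : ℕ)
  | add (a b : Expr)
  | mul (a b : Expr)
  | div (a b : Expr)

namespace Expr

/-- The value of an expression. -/
noncomputable def eval (I : Input) (r : ℕ → ℝ) : Expr → ℝ
  | const c => (c : ℝ)
  | cosine p n => Real.cos (2 * Real.pi * (p : ℝ) / (n : ℝ))
  | sine p n => Real.sin (2 * Real.pi * (p : ℝ) / (n : ℝ))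
  | omegaVal k n => I.om ((k : ℝ) / (n : ℝ))
  | readOrder ℓ => I.Γ ℓ
  | readProd j => I.γ j
  | reg x => r x
  | add a b => a.eval I r + b.eval I r
  | mul a b => a.eval I r * b.eval I r
  | div a b => a.eval I r / b.eval I r

/-- The registers that an expression reads. -/
def reads : Expr → Finset ℕ
  | const _ | cosine _ _ | sine _ _ | omegaVal _ _ | readOrder _ | readProd _ => ∅
  | reg x => {x}
  | add a b | mul a b | div a b => a.reads ∪ b.reads

/-- The number of instructions needed for the evaluation of an expression. -/
def size : Expr → ℕ
  | const _ | cosine _ _ | sine _ _ | omegaVal _ _ | readOrder _ | readProd _ | reg _ => 1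
  | add a b | mul a b | div a b => a.size + b.size + 1

/-- The number of registers for intermediate results. -/
def depth : Expr → ℕ
  | const _ | cosine _ _ | sine _ _ | omegaVal _ _ | readOrder _ | readProd _ | reg _ => 1
  | add a b | mul a b | div a b => max a.depth (b.depth + 1)

/-- Straight-line code that computes the value of an expression in the register `slot 0 d`. -/
def compile : Expr → ℕ → List Instr
  | const c, d => [.const (slot 0 d) c]
  | cosine p n, d => [.cosine (slot 0 d) p n]
  | sine p n, d => [.sine (slot 0 d) p n]
  | omegaVal k n, d => [.omegaVal (slot 0 d) k n]
  | readOrder ℓ, d => [.readOrder (slot 0 d) ℓ]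
  | readProd j, d => [.readProd (slot 0 d) j]
  | reg x, d => [.copy (slot 0 d) x]
  | add a b, d => a.compile d ++ (b.compile (d + 1) ++ [.add (slot 0 d) (slot 0 d) (slot 0 (d + 1))])
  | mul a b, d => a.compile d ++ (b.compile (d + 1) ++ [.mul (slot 0 d) (slot 0 d) (slot 0 (d + 1))])
  | div a b, d => a.compile d ++ (b.compile (d + 1) ++ [.div (slot 0 d) (slot 0 d) (slot 0 (d + 1))])

theorem length_compile (e : Expr) (d : ℕ) : (e.compile d).length = e.size := by
  induction e generalizing d <;> simp_all [compile, size] <;> ring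

theorem depth_pos (e : Expr) : 0 < e.depth := by
  cases e <;> simp [depth]

theorem eval_congr {I : Input} {e : Expr} {r r' : ℕ → ℝ} (h : ∀ y ∈ e.reads, r y = r' y) :
    e.eval I r = e.eval I r' := by
  induction e with
  | reg x => exact h x (by simp [reads])
  | add a b iha ihb | mul a b iha ihb | div a b iha ihb =>
    simp only [eval]
    rw [iha fun y hy => h y (by simp [reads, hy]), ihb fun y hy => h y (by simp [reads, hy])]
  | _ => rfl

/-- Stack discipline: the right operand is evaluated one level higher, so the left value in `slot 0
d` survives. Because the expression never reads region 0, intermediate results cannot spoil its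
operands. -/
theorem exec_compile (I : Input) (e : Expr) (he : ∀ d, slot 0 d ∉ e.reads) (d : ℕ) (r : ℕ → ℝ) :
    exec I (e.compile d) r (slot 0 d) = e.eval I r ∧
      ∀ y, (∀ d', d ≤ d' → y ≠ slot 0 d') → exec I (e.compile d) r y = r y := by
  induction e generalizing d r with
  | add a b iha ihb | mul a b iha ihb | div a b iha ihb =>
    have ha := iha (fun d' hd' => he d' (by simp [reads, hd'])) d r
    have hb := ihb (fun d' hd' => he d' (by simp [reads, hd'])) (d + 1)
      (exec I (a.compile d) r)
    have hab : exec I (b.compile (d + 1)) (exec I (a.compile d) r) (slot 0 d) = a.eval I r := by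
      rw [hb.2 _ fun d' hd' h => by have := (slot_inj.1 h).2; omega, ha.1]
    have hb' : b.eval I (exec I (a.compile d) r) = b.eval I r :=
      eval_congr fun y hy => ha.2 y fun d' _ h => he d' (by simp [reads, ← h, hy])
    refine ⟨?_, fun y hy => ?_⟩
    · simp only [compile, exec_append]
      simp [exec, Instr.dst, Instr.value, hab, hb.1, hb', eval]
    · simp only [compile, exec_append]
      simp only [exec, Instr.dst]
      rw [Function.update_of_ne (hy d le_rfl), hb.2 y fun d' hd' => hy d' (by omega), ha.2 y hy]
  | _ =>
    refine ⟨by simp [compile, exec, Instr.dst, Instr.value, eval], fun y hy => ?_⟩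
    simp [compile, exec, Instr.dst, Function.update_of_ne (hy d le_rfl)]

theorem regs_compile_subset {e : Expr} {d D : ℕ} {R : Finset ℕ} (hD : d + e.depth ≤ D)
    (he : e.reads ⊆ R) (hR : ∀ d' < D, slot 0 d' ∈ R) : ∀ i ∈ e.compile d, i.regs ⊆ R := by
  induction e generalizing d with
  | add a b iha ihb | mul a b iha ihb | div a b iha ihb =>
    simp only [depth, reads] at hD he
    have h₁ := iha (d := d) (by omega) (Finset.union_subset_left he)
    have h₂ := ihb (d := d + 1) (by omega) (Finset.union_subset_right he)
    have := b.depth_pos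
    intro i hi
    simp only [compile, List.mem_append, List.mem_singleton] at hi
    rcases hi with hi | hi | rfl
    · exact h₁ i hi
    · exact h₂ i hi
    · simp only [Instr.regs, Finset.insert_subset_iff, Finset.singleton_subset_iff]
      exact ⟨hR _ (by omega), hR _ (by omega), hR _ (by omega)⟩
  | _ =>
    simp only [depth] at hD
    have := hR d (by omega)
    simp_all [compile, Instr.regs, Finset.insert_subset_iff, reads]

/-- The sum of a list of expressions. -/
def sum : List Expr → Expr
  | [] => const 0
  | e :: l => add (sum l) e

theorem eval_sum (I : Input) (r : ℕ → ℝ) (l : List Expr) :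
    (sum l).eval I r = (l.map (eval I r)).sum := by
  induction l with
  | nil => simp [sum, eval]
  | cons e l ih => simp [sum, eval, ih, add_comm]

theorem mem_reads_sum {l : List Expr} {y : ℕ} : y ∈ (sum l).reads ↔ ∃ e ∈ l, y ∈ e.reads := by
  induction l with
  | nil => simp [sum, reads]
  | cons e l ih => simp [sum, reads, ih, or_comm]

/-- The partial sum is the left operand and stays in one register while each summand is evaluated
above it. So the scratch space does not grow with the length of the list. -/
theorem depth_sum_le {l : List Expr} {D : ℕ} (h : ∀ e ∈ l, e.depth ≤ D) :
    (sum l).depth ≤ D + 1 := by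
  induction l with
  | nil => simp [sum, depth]
  | cons e l ih =>
    simp only [sum, depth]
    have := h e (by simp)
    have := ih fun e he => h e (by simp [he])
    omega

theorem size_sum_le {l : List Expr} {c : ℕ} (h : ∀ e ∈ l, e.size ≤ c) :
    (sum l).size ≤ 1 + l.length * (c + 1) := by
  induction l with
  | nil => simp [sum, size]
  | cons e l ih =>
    simp only [sum, size, List.length_cons]
    have := h e (by simp)
    have := ih fun e he => h e (by simp [he])
    linarith

end Expr

/-! ### Simultaneous assignments -/

/-- Code that computes the expressions `e a` in the registers `x a`, for `a` in a list. -/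
def assign {ι : Type*} (l : List ι) (x : ι → ℕ) (e : ι → Expr) : List Instr :=
  l.flatMap fun a => (e a).compile 0 ++ [.copy (x a) (slot 0 0)]

theorem length_assign_le {ι : Type*} {l : List ι} {x : ι → ℕ} {e : ι → Expr} {c : ℕ}
    (h : ∀ a ∈ l, (e a).size ≤ c) : (assign l x e).length ≤ l.length * (c + 1) := by
  induction l with
  | nil => simp [assign]
  | cons a l ih =>
    have h₁ := ih fun a ha => h a (by simp [ha])
    have h₂ := h a (by simp)
    simp only [assign, List.flatMap_cons, List.length_append, Expr.length_compile,
      List.length_nil, List.length_cons] at h₁ ⊢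
    linarith

/-- No target is read by any of the expressions, so executing the assignments one after another has
the same effect as executing them simultaneously. -/
theorem exec_assign (I : Input) {ι : Type*} (l : List ι) (x : ι → ℕ) (e : ι → Expr)
    (hx : ∀ a ∈ l, ∀ d, x a ≠ slot 0 d) (he : ∀ a ∈ l, ∀ d, slot 0 d ∉ (e a).reads)
    (hinj : ∀ a ∈ l, ∀ a' ∈ l, x a = x a' → a = a')
    (hxe : ∀ a ∈ l, ∀ a' ∈ l, x a ∉ (e a').reads) (r : ℕ → ℝ) :
    (∀ a ∈ l, exec I (assign l x e) r (x a) = (e a).eval I r) ∧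
      ∀ y, (∀ d, y ≠ slot 0 d) → (∀ a ∈ l, y ≠ x a) → exec I (assign l x e) r y = r y := by
  induction l generalizing r with
  | nil => simp [assign, exec]
  | cons a l ih =>
    obtain ⟨h₁, h₂⟩ := (e a).exec_compile I (he a (by simp)) 0 r
    have ih := ih (fun a ha => hx a (by simp [ha])) (fun a ha => he a (by simp [ha]))
      (fun a ha a' ha' => hinj a (by simp [ha]) a' (by simp [ha']))
      (fun a ha a' ha' => hxe a (by simp [ha]) a' (by simp [ha']))
      (Function.update (exec I ((e a).compile 0) r) (x a)
        (exec I ((e a).compile 0) r (slot 0 0)))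
    have hstep : exec I (assign (a :: l) x e) r = exec I (assign l x e)
        (Function.update (exec I ((e a).compile 0) r) (x a)
        (exec I ((e a).compile 0) r (slot 0 0))) := by
      simp only [assign, List.flatMap_cons, exec_append]
      rfl
    rw [hstep]
    have hout : ∀ y, (∀ d, y ≠ slot 0 d) → y ≠ x a →
        Function.update (exec I ((e a).compile 0) r) (x a)
        (exec I ((e a).compile 0) r (slot 0 0)) y = r y := fun y hy hya => by
      rw [Function.update_of_ne hya, h₂ y fun d _ => hy d]
    refine ⟨fun c hc => ?_, fun y hy hyl => ?_⟩
    · by_cases hcl : c ∈ l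
      · rw [ih.1 c hcl]
        refine Expr.eval_congr fun y hy => hout y (fun d h => he c hc d (h ▸ hy)) ?_
        rintro rfl
        exact hxe a (by simp) c hc hy
      · obtain rfl : c = a := by simpa [hcl] using hc
        rw [ih.2 (x c) (hx c hc) fun a' ha' h => hcl (by
          rw [hinj c hc a' (by simp [ha']) h]; exact ha'), Function.update_self, h₁]
    · rw [ih.2 y hy fun a ha => hyl a (by simp [ha]), hout y hy (hyl a (by simp))]

theorem regs_assign_subset {ι : Type*} {l : List ι} {x : ι → ℕ} {e : ι → Expr} {D : ℕ}
    {R : Finset ℕ} (hx : ∀ a ∈ l, x a ∈ R) (hD : ∀ a ∈ l, (e a).depth ≤ D)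
    (he : ∀ a ∈ l, (e a).reads ⊆ R) (hR : ∀ d < D, slot 0 d ∈ R) :
    ∀ i ∈ assign l x e, i.regs ⊆ R := by
  intro i hi
  simp only [assign, List.mem_flatMap, List.mem_append, List.mem_singleton] at hi
  obtain ⟨a, ha, hi | rfl⟩ := hi
  · exact Expr.regs_compile_subset (by simpa using hD a ha) (he a ha) hR i hi
  · have := (e a).depth_pos
    have := hD a ha
    simp only [Instr.regs, Finset.insert_subset_iff, Finset.singleton_subset_iff]
    exact ⟨hx a ha, hR 0 (by omega)⟩

/-! ### The search for a minimum -/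

/-- Compare the registers `t x`, where `x` is `best` or in the list, and go on with a minimizer. -/
def argmin (t : ℕ → ℕ) (K : ℕ → Prog) : ℕ → List ℕ → Prog
  | best, [] => K best
  | best, x :: l => .ifLe (t best) (t x) (argmin t K best l) (argmin t K x l)

theorem cost_argmin_le {t : ℕ → ℕ} {K : ℕ → Prog} {best : ℕ} {l : List ℕ} {c : ℕ}
    (h : ∀ x ∈ best :: l, (K x).cost ≤ c) : (argmin t K best l).cost ≤ l.length + c := by
  induction l generalizing best with
  | nil => simpa [argmin] using h
  | cons x l ih =>
    simp only [argmin, Prog.cost, List.length_cons]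
    have h₁ := ih (best := best) fun y hy => h y (by simp at hy ⊢; tauto)
    have h₂ := ih (best := x) fun y hy => h y (by simp at hy ⊢; tauto)
    omega

theorem regs_argmin_subset {t : ℕ → ℕ} {K : ℕ → Prog} {best : ℕ} {l : List ℕ} {R : Finset ℕ}
    (ht : ∀ x ∈ best :: l, t x ∈ R) (h : ∀ x ∈ best :: l, (K x).regs ⊆ R) :
    (argmin t K best l).regs ⊆ R := by
  induction l generalizing best with
  | nil => simpa [argmin] using h
  | cons x l ih =>
    simp only [argmin, Prog.regs]
    refine Finset.union_subset (Finset.union_subset ?_ ?_) ?_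
    · simp only [Finset.insert_subset_iff, Finset.singleton_subset_iff]
      exact ⟨ht _ (by simp), ht _ (by simp)⟩
    · exact ih (fun y hy => ht y (by simp at hy ⊢; tauto))
        fun y hy => h y (by simp at hy ⊢; tauto)
    · exact ih (fun y hy => ht y (by simp at hy ⊢; tauto))
        fun y hy => h y (by simp at hy ⊢; tauto)

theorem exists_run_argmin (I : Input) (t : ℕ → ℕ) (K : ℕ → Prog) (best : ℕ) (l : List ℕ)
    (r : ℕ → ℝ) : ∃ x ∈ best :: l, (∀ y ∈ best :: l, r (t x) ≤ r (t y)) ∧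
      (argmin t K best l).run I r = (K x).run I r := by
  induction l generalizing best with
  | nil => exact ⟨best, by simp, by simp, rfl⟩
  | cons x l ih =>
    simp only [argmin, Prog.run]
    split_ifs with hle
    · obtain ⟨y, hy, hmin, hrun⟩ := ih best
      refine ⟨y, by simp at hy ⊢; tauto, fun c hc => ?_, hrun⟩
      simp only [List.mem_cons] at hc
      rcases hc with rfl | rfl | hc
      · exact hmin _ (by simp)
      · exact (hmin best (by simp)).trans hle
      · exact hmin c (by simp [hc])
    · obtain ⟨y, hy, hmin, hrun⟩ := ih x
      refine ⟨y, by simp at hy ⊢; tauto, fun c hc => ?_, hrun⟩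
      simp only [List.mem_cons] at hc
      rcases hc with rfl | rfl | hc
      · exact (hmin x (by simp)).trans (le_of_not_ge hle)
      · exact hmin _ (by simp)
      · exact hmin c (by simp [hc])

/-! ### Fast linear transforms -/

/-- The root of unity `e^{2 π i p / n}`. -/
noncomputable def unitRoot (p : ℤ) (n : ℕ) : ℂ :=
  Complex.exp ((2 * Real.pi * (p : ℝ) / (n : ℝ) : ℝ) * Complex.I)

/-- A sparse matrix whose nonzero entries are roots of unity: each row is a list of triples
`(p, n, a)`, which stand for the entry `e^{2 π i p / n}` in column `a`. -/
abbrev Layer (ι : Type*) := ι → List (ℤ × ℕ × ι)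

/-- The product of a sparse matrix and a vector. -/
noncomputable def Layer.apply {ι : Type*} (l : Layer ι) (X : ι → ℂ) (a : ι) : ℂ :=
  ((l a).map fun e => unitRoot e.1 e.2.1 * X e.2.2).sum

/-- A transform is a product of `L` sparse matrices with at most `c` entries per row. -/
def IsFast (c : ℕ) {ι : Type*} : ℕ → ((ι → ℂ) → ι → ℂ) → Prop
  | 0, A => ∀ X, A X = X
  | L + 1, A => ∃ (B : (ι → ℂ) → ι → ℂ) (l : Layer ι), IsFast c L B ∧ (∀ a, (l a).length ≤ c) ∧
      ∀ X, A X = l.apply (B X)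

theorem unitRoot_zero_one : unitRoot 0 1 = 1 := by simp [unitRoot]

/-- An identity layer can be inserted. This padding gives the transforms on groups of different
orders a common number of layers, as block diagonal sums require. -/
theorem IsFast.succ {c : ℕ} (hc : 1 ≤ c) {ι : Type*} {L : ℕ} {A : (ι → ℂ) → ι → ℂ}
    (h : IsFast c L A) : IsFast c (L + 1) A :=
  ⟨A, fun a => [(0, 1, a)], h, by simpa using fun _ => hc, fun X => by
    ext a; simp [Layer.apply, unitRoot_zero_one]⟩

theorem IsFast.mono {c : ℕ} (hc : 1 ≤ c) {ι : Type*} {L L' : ℕ} (hL : L ≤ L')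
    {A : (ι → ℂ) → ι → ℂ} (h : IsFast c L A) : IsFast c L' A := by
  induction L', hL using Nat.le_induction with
  | base => exact h
  | succ n _ ih => exact ih.succ hc

/-- A transform in other coordinates. -/
theorem IsFast.reindex {c : ℕ} {ι κ : Type*} {L : ℕ} {A : (ι → ℂ) → ι → ℂ} (h : IsFast c L A)
    (e : κ ≃ ι) : IsFast c L fun X : κ → ℂ => A (X ∘ e.symm) ∘ e := by
  induction L generalizing A with
  | zero => exact fun X => by ext; simp [h _]
  | succ L ih =>
    obtain ⟨B, l, hB, hl, hA⟩ := h
    refine ⟨_, fun a => (l (e a)).map fun t => (t.1, t.2.1, e.symm t.2.2), ih hB, fun a => by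
      simpa using hl (e a), fun X => ?_⟩
    ext a
    simp [hA, Layer.apply, Function.comp_def]

/-- A block diagonal transform. -/
theorem IsFast.sigma {c L : ℕ} {ι : Type*} {κ : ι → Type*} {A : ∀ i, (κ i → ℂ) → κ i → ℂ}
    (h : ∀ i, IsFast c L (A i)) :
    IsFast c L fun (X : (Σ i, κ i) → ℂ) a => A a.1 (fun k => X ⟨a.1, k⟩) a.2 := by
  induction L generalizing A with
  | zero => exact fun X => by ext a; simp [h a.1 _]
  | succ L ih =>
    choose B l hB hl hA using h
    refine ⟨_, fun a => (l a.1 a.2).map fun t => (t.1, t.2.1, ⟨a.1, t.2.2⟩), ih hB, fun a => by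
      simpa using hl a.1 a.2, fun X => ?_⟩
    ext a
    simp [hA, Layer.apply, Function.comp_def]

/-- The order of the group annihilates every element, so the character values are roots of unity.
This makes them available to a program as a cosine and a sine. -/
theorem exists_unitRoot_eq {G : Type*} [AddCommGroup G] [Finite G] (ψ : AddChar G ℂ) (x : G) :
    ∃ (p : ℤ) (n : ℕ), ψ x = unitRoot p n := by
  have hn : Nat.card G ≠ 0 := Nat.card_pos.ne'
  have h : ψ x ^ Nat.card G = 1 := by
    rw [← AddChar.map_nsmul_eq_pow, card_nsmul_eq_zero', AddChar.map_zero_eq_one]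
  obtain ⟨i, _, hi⟩ := (Complex.isPrimitiveRoot_exp _ hn).eq_pow_of_pow_eq_one h
  refine ⟨i, Nat.card G, ?_⟩
  rw [← hi, unitRoot, ← Complex.exp_nat_mul]
  congr 1
  push_cast
  ring

/-- A nontrivial finite commutative group has a subgroup of prime index. -/
theorem exists_addSubgroup_prime_index (G : Type*) [AddCommGroup G] [Finite G] [Nontrivial G] :
    ∃ H : AddSubgroup G, H.index.Prime := by
  -- Take a maximal proper subgroup. By Cauchy's theorem its quotient has an element x of prime
  -- order p, and maximality forces x to generate the quotient.
  obtain ⟨H, hH, -⟩ := (IsCoatomic.eq_top_or_exists_le_coatom (⊥ : AddSubgroup G)).resolve_left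
    bot_ne_top
  refine ⟨H, ?_⟩
  have hindex : H.index ≠ 1 := fun h => hH.1 (AddSubgroup.index_eq_one.1 h)
  obtain ⟨p, hp, hpd⟩ := Nat.exists_prime_and_dvd hindex
  have := Fact.mk hp
  obtain ⟨x, hx⟩ := exists_prime_addOrderOf_dvd_card' (G := G ⧸ H) p hpd
  have hlt : H < (AddSubgroup.zmultiples x).comap (QuotientAddGroup.mk' H) := by
    refine lt_of_le_of_ne (fun y hy => ?_) fun heq => ?_
    · simp [(QuotientAddGroup.eq_zero_iff y).2 hy]
    · obtain ⟨y, rfl⟩ := QuotientAddGroup.mk'_surjective H x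
      have hy : y ∈ H := by rw [heq]; simp
      have h0 : QuotientAddGroup.mk' H y = 0 := (QuotientAddGroup.eq_zero_iff y).2 hy
      rw [h0, addOrderOf_zero] at hx
      exact hp.one_lt.ne hx
  have htop := hH.2 _ hlt
  have hz : AddSubgroup.zmultiples x = ⊤ := by
    refine eq_top_iff.2 fun y _ => ?_
    obtain ⟨y, rfl⟩ := QuotientAddGroup.mk'_surjective H y
    have : y ∈ (AddSubgroup.zmultiples x).comap (QuotientAddGroup.mk' H) := htop ▸ trivial
    simpa using this
  have : H.index = p := by
    rw [AddSubgroup.index, ← hx, ← Nat.card_zmultiples, hz, Nat.card_congr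
      AddSubgroup.topEquiv.toEquiv]
  rwa [this]

/-- Fixed coset representatives split a sum over the group into sums over cosets, where a character
factors into its value at the representative and its restriction to the subgroup. -/
theorem exists_quotient_prod_equiv {G : Type*} [AddCommGroup G] (H : AddSubgroup G) :
    ∃ φ : (G ⧸ H) × H ≃ G, ∀ t h, φ (t, h) = φ (t, 0) + h := by
  refine ⟨Equiv.ofBijective (fun th => th.1.out + th.2) ⟨fun ⟨t, h⟩ ⟨t', h'⟩ heq => ?_,
    fun g => ⟨(g, ⟨-(g : G ⧸ H).out + g, ?_⟩), by simp⟩⟩, fun t h => by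
      change _ = _ + ((0 : H) : G) + _; rw [ZeroMemClass.coe_zero, add_zero]; rfl⟩
  · have heq' : t.out + (h : G) = t'.out + h' := heq
    have ht : t = t' := by
      have := congrArg (QuotientAddGroup.mk (s := H)) heq'
      rw [QuotientAddGroup.mk_add_of_mem _ h.2, QuotientAddGroup.mk_add_of_mem _ h'.2] at this
      simpa using this
    subst ht
    simpa using heq'
  · rw [← QuotientAddGroup.eq]
    simp

/-- The fast Fourier transform on a finite commutative group. -/
theorem isFast_dft {c : ℕ} (hc : 1 ≤ c) (L : ℕ) (G : Type) [AddCommGroup G] [Fintype G]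
    (hL : Fintype.card G ≤ 2 ^ L) (hp : ∀ p : ℕ, p.Prime → p ∣ Fintype.card G → p ≤ c)
    (e : G ≃ AddChar G ℂ) : IsFast c L fun (X : G → ℂ) g => ∑ x, e g x * X x := by
  induction L generalizing G with
  | zero =>
    have hsub : Subsingleton G := Fintype.card_le_one_iff_subsingleton.1 (by simpa using hL)
    intro X
    ext g
    beta_reduce
    rw [Fintype.sum_subsingleton _ g, Subsingleton.elim g 0]
    simp
  | succ L ih =>
    rcases subsingleton_or_nontrivial G with hG | hG
    · refine IsFast.mono hc (Nat.zero_le _) fun X => ?_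
      ext g
      rw [Fintype.sum_subsingleton _ g, Subsingleton.elim g 0]
      simp
    obtain ⟨H, hH⟩ := exists_addSubgroup_prime_index G
    obtain ⟨φ, hφ⟩ := exists_quotient_prod_equiv H
    classical
    have : Fintype (G ⧸ H) := Fintype.ofFinite _
    have : Fintype H := Fintype.ofFinite _
    have hmul := H.card_mul_index
    rw [Nat.card_eq_fintype_card, Nat.card_eq_fintype_card] at hmul
    -- The index is at least 2, so one layer at least halves the order.
    have hcard : Fintype.card H ≤ 2 ^ L := by
      have h2 := Nat.mul_le_mul_left (Fintype.card H) hH.two_le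
      rw [hmul] at h2
      rw [pow_succ] at hL
      omega
    obtain ⟨f⟩ : Nonempty (H ≃ AddChar H ℂ) :=
      Fintype.card_eq.1 AddChar.card_eq.symm
    have ihH := ih H hcard (fun p hpp hpd => hp p hpp (hpd.trans ⟨_, hmul.symm⟩)) f
    -- The transforms on all cosets are carried out at once, as one block diagonal transform.
    have hE := (IsFast.sigma (ι := G ⧸ H) (κ := fun _ => H) fun _ => ihH).reindex
      (φ.symm.trans (Equiv.sigmaEquivProd _ _).symm)
    have hroot : ∀ (g : G) (t : G ⧸ H), ∃ pn : ℤ × ℕ,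
        e g (φ (t, (0 : H))) =
          unitRoot pn.1 pn.2 := fun g t => by
      obtain ⟨p, n, h⟩ := exists_unitRoot_eq (e g)
        (φ (t, (0 : H)))
      exact ⟨(p, n), h⟩
    choose pn hpn using hroot
    -- The last layer combines the cosets: in row g, coset t contributes the value of the character
    -- at its representative times the transform on t, read at the number that `f` gives to the
    -- restricted character. A row has as many entries as the index of H, a prime divisor of the
    -- group order.
    refine ⟨_, fun g => (Finset.univ : Finset (G ⧸ H)).toList.map fun t => ((pn g t).1, (pn g t).2,
      φ
        (t, f.symm ((e g).compAddMonoidHom H.subtype))), hE, fun g => ?_, fun X => ?_⟩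
    · simp only [List.length_map, Finset.length_toList, Finset.card_univ]
      rw [← Nat.card_eq_fintype_card]
      exact hp _ hH (Nat.card_eq_fintype_card (α := G) ▸ H.index_dvd_card)
    · ext g
      simp only [Layer.apply, List.map_map, Function.comp_def, Finset.sum_map_toList]
      rw [← φ.sum_comp,
        Fintype.sum_prod_type]
      refine Finset.sum_congr rfl fun t _ => ?_
      simp only [← hpn, Equiv.trans_apply, Equiv.symm_trans_apply,
        Equiv.symm_symm, Equiv.sigmaEquivProd_apply, Equiv.sigmaEquivProd_symm_apply]
      rw [Finset.mul_sum]
      refine Finset.sum_congr rfl fun h _ => ?_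
      rw [← mul_assoc]
      congr 1
      · rw [hφ t h, AddChar.map_add_eq_mul]
        simp
      · simp

/-- The convolution theorem, where the characters are numbered by the elements of the group. -/
theorem sum_dft_mul_dft {G : Type*} [AddCommGroup G] [Fintype G] (e : G ≃ AddChar G ℂ)
    (a q : G → ℂ) (z : G) :
    ∑ g, e g (-z) * ((∑ x, e g x * a x) * ∑ y, e g (-y) * q y) =
      Fintype.card G * ∑ y, a (z + y) * q y := by
  classical
  have : ∀ g, e g (-z) * ((∑ x, e g x * a x) * ∑ y, e g (-y) * q y) =
      ∑ x, ∑ y, e g (x - (z + y)) * (a x * q y) := fun g => by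
    rw [Finset.sum_mul_sum, Finset.mul_sum]
    refine Finset.sum_congr rfl fun x _ => ?_
    rw [Finset.mul_sum]
    refine Finset.sum_congr rfl fun y _ => ?_
    rw [show x - (z + y) = -z + (x + -y) by abel, AddChar.map_add_eq_mul, AddChar.map_add_eq_mul]
    ring
  simp only [this]
  rw [Finset.sum_comm, Finset.mul_sum, Finset.sum_congr rfl fun x _ => Finset.sum_comm,
    Finset.sum_comm]
  refine Finset.sum_congr rfl fun y _ => ?_
  simp_rw [← Finset.sum_mul]
  have hsum : ∀ x : G, ∑ g, e g x = if x = 0 then (Fintype.card G : ℂ) else 0 := fun x => by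
    rw [e.sum_comp fun ψ : AddChar G ℂ => ψ x, AddChar.sum_apply_eq_ite]
  simp [hsum, sub_eq_zero]

/-! ### Units modulo prime powers -/

theorem mem_unitsMod {n z : ℕ} : z ∈ unitsMod n ↔ z < n ∧ Nat.Coprime z n := by
  simp [unitsMod, Nat.Coprime]

theorem sum_units_eq {n : ℕ} [NeZero n] {E : Type*} [AddCommMonoid E] (f : ℕ → E) :
    ∑ u : (ZMod n)ˣ, f (u : ZMod n).val = ∑ x ∈ unitsMod n, f x := by
  refine Finset.sum_bij (fun u _ => (u : ZMod n).val) (fun u _ => ?_) (fun u _ v _ h => ?_)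
    (fun x hx => ?_) fun _ _ => rfl
  · exact mem_unitsMod.2 ⟨ZMod.val_lt _, ZMod.val_coe_unit_coprime u⟩
  · exact Units.ext (ZMod.val_injective n h)
  · obtain ⟨h₁, h₂⟩ := mem_unitsMod.1 hx
    exact ⟨ZMod.unitOfCoprime x h₂, Finset.mem_univ _, by simp [ZMod.val_cast_of_lt h₁]⟩

/-- Every k is b^(M-i) x with x a unit modulo b^i for exactly one i. The number k = 0 is covered by
i = 0, because 0 counts as a unit modulo 1. -/
theorem sum_range_pow_eq {b : ℕ} (hb : b.Prime) {E : Type*} [AddCommMonoid E] (M : ℕ)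
    (f : ℕ → E) : ∑ k ∈ Finset.range (b ^ M), f k =
      ∑ i ∈ Finset.range (M + 1), ∑ x ∈ unitsMod (b ^ i), f (b ^ (M - i) * x) := by
  induction M generalizing f with
  | zero => simp [unitsMod]
  | succ M ih =>
    -- Modulo a positive power of b the units are the non-multiples of b. The multiples of b,
    -- divided by b, fill the range of the previous step.
    have hu : unitsMod (b ^ (M + 1)) =
        (Finset.range (b ^ (M + 1))).filter fun k => ¬ b ∣ k := by
      ext k
      rw [mem_unitsMod, Finset.mem_filter, Finset.mem_range, Nat.coprime_pow_right_iff M.succ_pos,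
        Nat.coprime_comm, hb.coprime_iff_not_dvd]
    have hd : (Finset.range (b ^ (M + 1))).filter (fun k => b ∣ k) =
        (Finset.range (b ^ M)).image fun k => b * k := by
      ext k
      simp only [Finset.mem_filter, Finset.mem_range, Finset.mem_image]
      constructor
      · rintro ⟨hk, c, rfl⟩
        refine ⟨c, ?_, rfl⟩
        rw [pow_succ'] at hk
        exact lt_of_mul_lt_mul_left hk (Nat.zero_le _)
      · rintro ⟨c, hc, rfl⟩
        rw [pow_succ']
        exact ⟨Nat.mul_lt_mul_of_pos_left hc hb.pos, dvd_mul_right _ _⟩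
    rw [Finset.sum_range_succ, ← Finset.sum_filter_add_sum_filter_not _ (fun k => b ∣ k), ← hu, hd,
      Finset.sum_image fun x _ y _ h => Nat.eq_of_mul_eq_mul_left hb.pos h, ih]
    congr 1
    · refine Finset.sum_congr rfl fun i hi => Finset.sum_congr rfl fun x _ => ?_
      rw [← mul_assoc, ← pow_succ', Nat.succ_sub (by simpa [Nat.lt_succ_iff] using hi)]
    · simp

/-- The units modulo `b ^ i`, `i = 0, …, M`. -/
abbrev UnitsUpTo (b M : ℕ) : Type := Σ i : Fin (M + 1), Additive (ZMod (b ^ (i : ℕ)))ˣ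

/-- The representative in `{0, …, b ^ i - 1}` of a unit. -/
def unitVal {n : ℕ} (u : Additive (ZMod n)ˣ) : ℕ := ((u.toMul : (ZMod n)ˣ) : ZMod n).val

/-- The integer `b ^ (M - i) x` that belongs to a unit `x` modulo `b ^ i`. -/
def UnitsUpTo.toNat {b M : ℕ} (a : UnitsUpTo b M) : ℕ := b ^ (M - (a.1 : ℕ)) * unitVal a.2

/-- The class of an integer in the units. -/
noncomputable def toUnit (n z : ℕ) : Additive (ZMod n)ˣ :=
  open Classical in if h : Nat.Coprime z n then Additive.ofMul (ZMod.unitOfCoprime z h) else 0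

theorem sum_range_pow_eq_sum_unitsUpTo {b : ℕ} (hb : b.Prime) [NeZero b] {E : Type*}
    [AddCommMonoid E] (M : ℕ) (f : ℕ → E) :
    ∑ k ∈ Finset.range (b ^ M), f k = ∑ a : UnitsUpTo b M, f a.toNat := by
  rw [sum_range_pow_eq hb, Fintype.sum_sigma, Finset.sum_range]
  refine Finset.sum_congr rfl fun i _ => ?_
  rw [← sum_units_eq]
  exact (Equiv.sum_comp Additive.toMul _).symm

theorem card_unitsUpTo {b : ℕ} (hb : b.Prime) [NeZero b] (M : ℕ) :
    Fintype.card (UnitsUpTo b M) = b ^ M := by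
  have := sum_range_pow_eq_sum_unitsUpTo hb M fun _ => 1
  simpa using this.symm

theorem UnitsUpTo.toNat_lt {b M : ℕ} [NeZero b] (a : UnitsUpTo b M) : a.toNat < b ^ M := by
  have hi : (a.1 : ℕ) ≤ M := Nat.lt_succ_iff.1 a.1.2
  calc a.toNat < b ^ (M - (a.1 : ℕ)) * b ^ (a.1 : ℕ) :=
        Nat.mul_lt_mul_of_pos_left (ZMod.val_lt _) (Nat.pos_of_neZero _)
    _ = b ^ M := by rw [← pow_add, Nat.sub_add_cancel hi]

/-- The factor b^(M-i) cancels, and multiplication of units becomes addition in the additive copy of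
the unit group. The entry therefore depends only on a sum of group elements, as a convolution
requires. -/
theorem omegaEntry_toNat {b : ℕ} [NeZero b] (om : ℝ → ℝ) {M z : ℕ}
    (hz : Nat.Coprime z b) (a : UnitsUpTo b M) :
    omegaEntry om (b ^ M) z a.toNat =
      om ((unitVal (toUnit (b ^ (a.1 : ℕ)) z + a.2) : ℝ) / ((b ^ (a.1 : ℕ) : ℕ) : ℝ)) := by
  have hi : (a.1 : ℕ) ≤ M := Nat.lt_succ_iff.1 a.1.2
  have hb0 : (b : ℝ) ≠ 0 := NeZero.ne _
  have h₁ : unitVal (toUnit (b ^ (a.1 : ℕ)) z + a.2) = unitVal a.2 * z % b ^ (a.1 : ℕ) := by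
    rw [toUnit, dif_pos (hz.pow_right _)]
    simp only [unitVal, toMul_add, toMul_ofMul, Units.val_mul, ZMod.coe_unitOfCoprime]
    rw [ZMod.val_mul, ZMod.val_natCast, Nat.mod_mul_mod, mul_comm]
  have h₂ : a.toNat * z % b ^ M = b ^ (M - (a.1 : ℕ)) * (unitVal a.2 * z % b ^ (a.1 : ℕ)) := by
    rw [UnitsUpTo.toNat, mul_assoc, ← Nat.mul_mod_mul_left, ← pow_add, Nat.sub_add_cancel hi]
  rw [omegaEntry, h₁, h₂]
  congr 1
  push_cast
  have hpow : (b : ℝ) ^ M = b ^ (M - (a.1 : ℕ)) * b ^ (a.1 : ℕ) := by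
    rw [← pow_add, Nat.sub_add_cancel hi]
  rw [hpow, mul_div_mul_left _ _ (pow_ne_zero _ hb0)]

/-- The matrix-vector product as a sum over multiplicative convolutions. -/
theorem sum_omegaEntry_mul {b : ℕ} (hb : b.Prime) [NeZero b] (om : ℝ → ℝ) {M z : ℕ}
    (hz : Nat.Coprime z b) (q : ℕ → ℝ) :
    ∑ k ∈ Finset.range (b ^ M), omegaEntry om (b ^ M) z k * q k =
      ∑ i : Fin (M + 1), ∑ u : Additive (ZMod (b ^ (i : ℕ)))ˣ,
        om ((unitVal (toUnit (b ^ (i : ℕ)) z + u) : ℝ) / ((b ^ (i : ℕ) : ℕ) : ℝ)) *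
          q (UnitsUpTo.toNat (⟨i, u⟩ : UnitsUpTo b M)) := by
  rw [sum_range_pow_eq_sum_unitsUpTo hb, Fintype.sum_sigma]
  simp_rw [omegaEntry_toNat om hz]

/-- The three Fourier transforms of a fast convolution on all the unit groups. -/
theorem exists_isFast_convolution {b : ℕ} (hb : b.Prime) [NeZero b] (M : ℕ) :
    ∃ F₁ F₂ F₃ : (UnitsUpTo b M → ℂ) → UnitsUpTo b M → ℂ,
      IsFast b (b * M) F₁ ∧ IsFast b (b * M) F₂ ∧ IsFast b (b * M) F₃ ∧
      ∀ a q z, F₃ (fun g => F₁ a g * F₂ q g) z =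
        Fintype.card (Additive (ZMod (b ^ (z.1 : ℕ)))ˣ) * ∑ y, a ⟨z.1, z.2 + y⟩ * q ⟨z.1, y⟩ := by
  have he : ∀ i : Fin (M + 1), Nonempty (Additive (ZMod (b ^ (i : ℕ)))ˣ ≃
      AddChar (Additive (ZMod (b ^ (i : ℕ)))ˣ) ℂ) := fun i =>
    Fintype.card_eq.1 AddChar.card_eq.symm
  have e := fun i => (he i).some
  -- The crude estimate b ≤ 2^b suffices: the number of layers is bM, and the factor b goes into the
  -- implied constant.
  have hlt : ∀ i : Fin (M + 1), Fintype.card (Additive (ZMod (b ^ (i : ℕ)))ˣ) ≤ 2 ^ (b * M) :=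
    fun i => by
      rw [Fintype.card_additive, ZMod.card_units_eq_totient, pow_mul]
      calc (b ^ (i : ℕ)).totient ≤ b ^ (i : ℕ) := Nat.totient_le _
        _ ≤ b ^ M := Nat.pow_le_pow_right hb.pos (Nat.lt_succ_iff.1 i.2)
        _ ≤ (2 ^ b) ^ M := Nat.pow_le_pow_left Nat.lt_two_pow_self.le _
  have hprime : ∀ (i : Fin (M + 1)) (p : ℕ), p.Prime →
      p ∣ Fintype.card (Additive (ZMod (b ^ (i : ℕ)))ˣ) → p ≤ b := fun i p hp hd => by
    rw [Fintype.card_additive, ZMod.card_units_eq_totient] at hd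
    rcases Nat.eq_zero_or_pos (i : ℕ) with h0 | h0
    · rw [h0, pow_zero, Nat.totient_one] at hd
      exact absurd (Nat.dvd_one.1 hd) hp.ne_one
    · rw [Nat.totient_prime_pow hb h0] at hd
      rcases hp.dvd_mul.1 hd with hd | hd
      · exact Nat.le_of_dvd hb.pos (hp.dvd_of_dvd_pow hd)
      · exact (Nat.le_of_dvd (Nat.sub_pos_of_lt hb.one_lt) hd).trans (Nat.sub_le _ _)
  -- The correlation needs the characters at -y for the second vector. The inverse transform is a
  -- transform on the dual group, whose characters are evaluations at group elements. With this
  -- choice the bijection `e` need not be a homomorphism.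
  let e₂ := fun i => (e i).trans (Equiv.neg (AddChar (Additive (ZMod (b ^ (i : ℕ)))ˣ) ℂ))
  let e₃ := fun i => (e i).symm.trans ((Equiv.neg _).trans
    (AddChar.doubleDualEquiv (α := Additive (ZMod (b ^ (i : ℕ)))ˣ)).toEquiv)
  refine ⟨_, _, _, IsFast.sigma fun i => isFast_dft hb.pos (b * M) _ (hlt i) (hprime i) (e i),
    IsFast.sigma fun i => isFast_dft hb.pos (b * M) _ (hlt i) (hprime i) (e₂ i),
    IsFast.sigma fun i => (isFast_dft hb.pos (b * M) _ (by rw [AddChar.card_eq]; exact hlt i)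
      (by rw [AddChar.card_eq]; exact hprime i) (e₃ i)).reindex (e i), fun a q z => ?_⟩
  rw [← sum_dft_mul_dft (e z.1) (fun y => a ⟨z.1, y⟩) (fun y => q ⟨z.1, y⟩) z.2]
  simp only [Function.comp_apply]
  rw [← (e z.1).sum_comp]
  simp [e₂, e₃, -map_neg]

/-! ### Code for fast transforms -/

/-- Straight-line code of length at most `N` that uses the registers `R`, writes only to the
regions `W`, and relates the register contents before and after its execution by `Φ`. -/
structure IsCode (l : List Instr) (R : Finset ℕ) (N : ℕ) (W : Finset ℕ)
    (Φ : Input → (ℕ → ℝ) → (ℕ → ℝ) → Prop) : Prop where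
  regs : ∀ i ∈ l, i.regs ⊆ R
  length_le : l.length ≤ N
  frame : ∀ I r t k, t ∉ W → exec I l r (slot t k) = r (slot t k)
  spec : ∀ I r, Φ I r (exec I l r)

/-- Both frame conditions are kept with the intermediate state, so that values computed by the first
part can be carried past the second. -/
theorem IsCode.append {l₁ l₂ : List Instr} {R : Finset ℕ} {N₁ N₂ : ℕ} {W₁ W₂ : Finset ℕ}
    {Φ₁ Φ₂ : Input → (ℕ → ℝ) → (ℕ → ℝ) → Prop} (h₁ : IsCode l₁ R N₁ W₁ Φ₁)
    (h₂ : IsCode l₂ R N₂ W₂ Φ₂) :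
    IsCode (l₁ ++ l₂) R (N₁ + N₂) (W₁ ∪ W₂) fun I r r'' => ∃ r', Φ₁ I r r' ∧ Φ₂ I r' r'' ∧
      (∀ t k, t ∉ W₁ → r' (slot t k) = r (slot t k)) ∧
      ∀ t k, t ∉ W₂ → r'' (slot t k) = r' (slot t k) where
  regs i hi := (List.mem_append.1 hi).elim (h₁.regs i) (h₂.regs i)
  length_le := by
    have := h₁.length_le
    have := h₂.length_le
    simp only [List.length_append]
    omega
  frame I r t k ht := by
    rw [Finset.mem_union, not_or] at ht
    rw [exec_append, h₂.frame _ _ _ _ ht.2, h₁.frame _ _ _ _ ht.1]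
  spec I r := by
    rw [exec_append]
    exact ⟨_, h₁.spec I r, h₂.spec I _, fun t k => h₁.frame I r t k,
      fun t k => h₂.frame I _ t k⟩

theorem IsCode.imp {l : List Instr} {R : Finset ℕ} {N N' : ℕ} {W W' : Finset ℕ}
    {Φ Ψ : Input → (ℕ → ℝ) → (ℕ → ℝ) → Prop} (h : IsCode l R N W Φ) (hN : N ≤ N') (hW : W ⊆ W')
    (hΦ : ∀ I r r', Φ I r r' → Ψ I r r') : IsCode l R N' W' Ψ where
  regs := h.regs
  length_le := h.length_le.trans hN
  frame I r t k ht := h.frame I r t k fun ht' => ht (hW ht')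
  spec I r := hΦ _ _ _ (h.spec I r)

/-- The number of registers for intermediate results. -/
def scratchSize : ℕ := 10

/-- Assignments of expressions that read only the regions `V` to registers in the regions `W`. -/
theorem isCode_assign {ι : Type*} {l : List ι} {t k : ι → ℕ} {e : ι → Expr} {R : Finset ℕ}
    {c : ℕ} {V W : Finset ℕ} (hR₀ : ∀ d < scratchSize, slot 0 d ∈ R)
    (hR : ∀ a ∈ l, slot (t a) (k a) ∈ R) (he : ∀ a ∈ l, (e a).reads ⊆ R)
    (hV : ∀ a ∈ l, ∀ y ∈ (e a).reads, ∃ t ∈ V, ∃ k, y = slot t k)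
    (hW : ∀ a ∈ l, t a ∈ W) (hVW : Disjoint V W) (h0V : 0 ∉ V) (h0W : 0 ∉ W)
    (hinj : ∀ a ∈ l, ∀ a' ∈ l, t a = t a' → k a = k a' → a = a')
    (hc : ∀ a ∈ l, (e a).size ≤ c) (hd : ∀ a ∈ l, (e a).depth ≤ scratchSize) :
    IsCode (assign l (fun a => slot (t a) (k a)) e) R (l.length * (c + 1)) (insert 0 W)
      fun I r r' => ∀ a ∈ l, r' (slot (t a) (k a)) = (e a).eval I r := by
  have h := fun I => exec_assign I l (fun a => slot (t a) (k a)) e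
    (fun a ha d h => h0W ((slot_inj.1 h).1 ▸ hW a ha))
    (fun a ha d h => by
      obtain ⟨t, ht, k, hk⟩ := hV a ha _ h
      exact h0V ((slot_inj.1 hk).1 ▸ ht))
    (fun a ha a' ha' h => hinj a ha a' ha' (slot_inj.1 h).1 (slot_inj.1 h).2)
    (fun a ha a' ha' h => by
      obtain ⟨t', ht', k, hk⟩ := hV a' ha' _ h
      exact Finset.disjoint_left.1 hVW ht' ((slot_inj.1 hk).1 ▸ hW a ha))
  refine ⟨regs_assign_subset hR hd he hR₀, length_assign_le hc, fun I r t' k' ht' => ?_,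
    fun I r => (h I r).1⟩
  rw [Finset.mem_insert, not_or] at ht'
  exact (h I r).2 _ (fun d hd => ht'.1 (slot_inj.1 hd).1)
    fun a ha hk => ht'.2 ((slot_inj.1 hk).1 ▸ hW a ha)

/-- The regions `t` and `t + 1` hold the real and imaginary parts of a complex vector. -/
def Holds {ι : Type*} (r : ℕ → ℝ) (t : ℕ) (idx : ι → ℕ) (X : ι → ℂ) : Prop :=
  ∀ a, r (slot t (idx a)) = (X a).re ∧ r (slot (t + 1) (idx a)) = (X a).im

theorem Holds.congr {ι : Type*} {r r' : ℕ → ℝ} {t : ℕ} {idx : ι → ℕ} {X : ι → ℂ}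
    (h : Holds r t idx X) (h₁ : ∀ k, r' (slot t k) = r (slot t k))
    (h₂ : ∀ k, r' (slot (t + 1) k) = r (slot (t + 1) k)) : Holds r' t idx X := fun a => by
  rw [h₁, h₂]; exact h a

/-- Code for the assignment of a complex vector that is given by expressions for the real and
imaginary parts. -/
theorem exists_isCode_complex {ι : Type*} [Fintype ι] (e : ι × Bool → Expr) {idx : ι → ℕ}
    (hidx : Function.Injective idx) {t c : ℕ} (ht : t ≠ 0) {R V : Finset ℕ}
    (hR₀ : ∀ d < scratchSize, slot 0 d ∈ R)
    (hR : ∀ a, slot t (idx a) ∈ R ∧ slot (t + 1) (idx a) ∈ R) (he : ∀ a, (e a).reads ⊆ R)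
    (hV : ∀ a, ∀ y ∈ (e a).reads, ∃ t ∈ V, ∃ k, y = slot t k)
    (hVt : 0 ∉ V ∧ t ∉ V ∧ t + 1 ∉ V)
    (hc : ∀ a, (e a).size ≤ c) (hd : ∀ a, (e a).depth ≤ scratchSize) :
    ∃ l, IsCode l R (2 * Fintype.card ι * (c + 1)) {0, t, t + 1} fun I r r' =>
      Holds r' t idx fun a => ⟨(e (a, false)).eval I r, (e (a, true)).eval I r⟩ := by
  have h := isCode_assign (l := (Finset.univ : Finset (ι × Bool)).toList)
    (t := fun a => if a.2 then t + 1 else t) (k := fun a => idx a.1) (e := e) (R := R) (c := c)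
    (V := V) (W := {t, t + 1}) hR₀
    (fun a _ => by split_ifs; exacts [(hR a.1).2, (hR a.1).1])
    (fun a _ => he a) (fun a _ => hV a) (fun a _ => by split_ifs <;> simp)
    (by simpa using ⟨hVt.2.1, hVt.2.2⟩) hVt.1 (by simpa using ht.symm)
    (fun a _ a' _ h₁ h₂ => Prod.ext (hidx h₂) (by
      cases h : a.2 <;> cases h' : a'.2 <;> simp_all))
    (fun a _ => hc a) (fun a _ => hd a)
  refine ⟨_, h.imp (by simp [mul_comm]) (by simp) fun I r r' h' a => ⟨?_, ?_⟩⟩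
  · simpa using h' (a, false) (by simp)
  · simpa using h' (a, true) (by simp)

theorem unitRoot_re (p : ℤ) (n : ℕ) :
    (unitRoot p n).re = Real.cos (2 * Real.pi * (p : ℝ) / (n : ℝ)) :=
  Complex.exp_ofReal_mul_I_re _

theorem unitRoot_im (p : ℤ) (n : ℕ) :
    (unitRoot p n).im = Real.sin (2 * Real.pi * (p : ℝ) / (n : ℝ)) :=
  Complex.exp_ofReal_mul_I_im _

/-- Code for the product of a sparse matrix and a vector. -/
theorem exists_isCode_layer {ι : Type*} [Fintype ι] {c : ℕ} (L : Layer ι)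
    (hL : ∀ a, (L a).length ≤ c) {idx : ι → ℕ} (hidx : Function.Injective idx) {t t' : ℕ}
    (ht : t ≠ 0) (ht' : t' ≠ 0) (htt : t ≠ t' ∧ t ≠ t' + 1 ∧ t + 1 ≠ t') {R : Finset ℕ}
    (hR₀ : ∀ d < scratchSize, slot 0 d ∈ R)
    (hR : ∀ a, slot t (idx a) ∈ R ∧ slot (t + 1) (idx a) ∈ R)
    (hR' : ∀ a, slot t' (idx a) ∈ R ∧ slot (t' + 1) (idx a) ∈ R) :
    ∃ l, IsCode l R (Fintype.card ι * (16 * c + 8)) {0, t, t + 1, t', t' + 1} fun _ r r' =>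
      ∀ X, Holds r t idx X → Holds r' t idx (L.apply X) := by
  -- Real and imaginary parts of a root of unity times a vector entry. Expressions have no
  -- subtraction, so the minus sign of the real part comes from the sine of the opposite angle.
  let term : Bool → ℤ × ℕ × ι → Expr := fun s x => cond s
    (.add (.mul (.cosine x.1 x.2.1) (.reg (slot (t + 1) (idx x.2.2))))
      (.mul (.sine x.1 x.2.1) (.reg (slot t (idx x.2.2)))))
    (.add (.mul (.cosine x.1 x.2.1) (.reg (slot t (idx x.2.2))))
      (.mul (.sine (-x.1) x.2.1) (.reg (slot (t + 1) (idx x.2.2)))))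
  have hreads : ∀ s x, (term s x).reads ⊆
      {slot t (idx x.2.2), slot (t + 1) (idx x.2.2)} := fun s x => by
    cases s <;> simp only [term, cond, Expr.reads] <;> intro y <;> (simp; try tauto)
  obtain ⟨l₁, h₁⟩ := exists_isCode_complex (c := 1 + c * 8) (R := R) (V := {t, t + 1})
    (fun a : ι × Bool => Expr.sum ((L a.1).map (term a.2))) hidx ht' hR₀ hR'
    (fun a y hy => by
      rw [Expr.mem_reads_sum] at hy
      obtain ⟨e, he, hy⟩ := hy
      obtain ⟨x, hx, rfl⟩ := List.mem_map.1 he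
      have := hreads _ _ hy
      simp only [Finset.mem_insert, Finset.mem_singleton] at this
      rcases this with rfl | rfl
      exacts [(hR _).1, (hR _).2])
    (fun a y hy => by
      rw [Expr.mem_reads_sum] at hy
      obtain ⟨e, he, hy⟩ := hy
      obtain ⟨x, hx, rfl⟩ := List.mem_map.1 he
      have := hreads _ _ hy
      simp only [Finset.mem_insert, Finset.mem_singleton] at this
      rcases this with rfl | rfl
      exacts [⟨t, by simp, _, rfl⟩, ⟨t + 1, by simp, _, rfl⟩])
    (by simp; omega)
    (fun a => (Expr.size_sum_le (c := 7) fun e he => by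
      obtain ⟨x, hx, rfl⟩ := List.mem_map.1 he
      cases a.2 <;> simp [term, Expr.size]).trans (by
        rw [List.length_map]
        have := hL a.1
        omega))
    (fun a => (Expr.depth_sum_le (D := 3) fun e he => by
      obtain ⟨x, hx, rfl⟩ := List.mem_map.1 he
      cases a.2 <;> simp [term, Expr.depth]).trans (by simp [scratchSize]))
  -- The product has to be formed in other regions, since all old entries are still read; it is then
  -- copied back. The same two pairs of regions serve all layers.
  obtain ⟨l₂, h₂⟩ := exists_isCode_complex (c := 1) (R := R) (V := {t', t' + 1})
    (fun a : ι × Bool => Expr.reg (slot (cond a.2 (t' + 1) t') (idx a.1))) hidx ht hR₀ hR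
    (fun a => by rcases a with ⟨a, _ | _⟩ <;> simp [Expr.reads, hR' a])
    (fun a y hy => by
      simp only [Expr.reads, Finset.mem_singleton] at hy
      rcases a with ⟨a, _ | _⟩
      exacts [⟨t', by simp, _, hy⟩, ⟨t' + 1, by simp, _, hy⟩])
    (by simp; omega) (fun a => by simp [Expr.size]) (fun a => by simp [Expr.depth, scratchSize])
  refine ⟨_, (h₁.append h₂).imp (le_of_eq (by ring)) ?_ ?_⟩
  · intro y; simp only [Finset.mem_union, Finset.mem_insert, Finset.mem_singleton]; tauto
  · rintro I r r'' ⟨r', hr', hr'', -, -⟩ X hX a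
    have h' := hr' a
    have h'' := hr'' a
    simp only [Expr.eval, cond] at h''
    rw [h''.1, h''.2, h'.1, h'.2]
    simp only [Expr.eval_sum, List.map_map, Layer.apply]
    constructor
    · rw [← Complex.coe_reAddGroupHom, map_list_sum, List.map_map]
      congr 1
      refine List.map_congr_left fun x _ => ?_
      simp only [Function.comp_apply, term, cond, Expr.eval, (hX _).1, (hX _).2,
        Complex.coe_reAddGroupHom, Complex.mul_re, unitRoot_re, unitRoot_im]
      push_cast
      rw [mul_neg, neg_div, Real.sin_neg]
      ring
    · rw [← Complex.coe_imAddGroupHom, map_list_sum, List.map_map]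
      congr 1
      refine List.map_congr_left fun x _ => ?_
      simp only [Function.comp_apply, term, cond, Expr.eval, (hX _).1, (hX _).2,
        Complex.coe_imAddGroupHom, Complex.mul_im, unitRoot_re, unitRoot_im]

/-- Code for a fast transform. -/
theorem exists_isCode_fast {ι : Type*} [Fintype ι] {c L : ℕ} {A : (ι → ℂ) → ι → ℂ}
    (hA : IsFast c L A) {idx : ι → ℕ} (hidx : Function.Injective idx) {t t' : ℕ}
    (ht : t ≠ 0) (ht' : t' ≠ 0) (htt : t ≠ t' ∧ t ≠ t' + 1 ∧ t + 1 ≠ t') {R : Finset ℕ}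
    (hR₀ : ∀ d < scratchSize, slot 0 d ∈ R)
    (hR : ∀ a, slot t (idx a) ∈ R ∧ slot (t + 1) (idx a) ∈ R)
    (hR' : ∀ a, slot t' (idx a) ∈ R ∧ slot (t' + 1) (idx a) ∈ R) :
    ∃ l, IsCode l R (L * (Fintype.card ι * (16 * c + 8))) {0, t, t + 1, t', t' + 1}
      fun _ r r' => ∀ X, Holds r t idx X → Holds r' t idx (A X) := by
  induction L generalizing A with
  | zero =>
    exact ⟨[], by simp, by simp, fun _ _ _ _ _ => rfl, fun I r X hX => by rw [hA]; exact hX⟩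
  | succ L ih =>
    obtain ⟨B, l, hB, hl, hA⟩ := hA
    obtain ⟨l₁, h₁⟩ := ih hB
    obtain ⟨l₂, h₂⟩ := exists_isCode_layer l hl hidx ht ht' htt hR₀ hR hR'
    refine ⟨_, (h₁.append h₂).imp (le_of_eq (by ring)) (by simp) ?_⟩
    rintro I r r'' ⟨r', hr', hr'', -, -⟩ X hX
    rw [hA]
    exact hr'' _ (hr' X hX)

/-- Code for the fast matrix-vector product: the vector is in the region `7`, and the result is
in the region `8`. -/
theorem exists_isCode_matVec {b : ℕ} (hb : b.Prime) {M : ℕ} (hM : 1 ≤ M) {R : Finset ℕ}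
    (hR₀ : ∀ d < scratchSize, slot 0 d ∈ R)
    (hR : ∀ t, 1 ≤ t → t ≤ 8 → ∀ k < b ^ M, slot t k ∈ R) :
    ∃ l, IsCode l R ((48 * b ^ 2 + 24 * b + 38) * (M * b ^ M)) {0, 1, 2, 3, 4, 5, 6, 8}
      fun I r r' => ∀ z ∈ unitsMod (b ^ M), r' (slot 8 z) =
        ∑ k ∈ Finset.range (b ^ M), omegaEntry I.om (b ^ M) z k * r (slot 7 k) := by
  have : NeZero b := ⟨hb.ne_zero⟩
  obtain ⟨F₁, F₂, F₃, hF₁, hF₂, hF₃, hF⟩ := exists_isFast_convolution hb M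
  have hcard := card_unitsUpTo hb M
  let idx : UnitsUpTo b M → ℕ := fun a => (Fintype.equivFin _ a : ℕ)
  have hidx : Function.Injective idx := Fin.val_injective.comp (Equiv.injective _)
  have hlt : ∀ a, idx a < b ^ M := fun a => hcard ▸ (Fintype.equivFin _ a).2
  have hRt : ∀ t, 1 ≤ t → t + 1 ≤ 8 → ∀ a, slot t (idx a) ∈ R ∧ slot (t + 1) (idx a) ∈ R :=
    fun t h₁ h₂ a => ⟨hR _ (by omega) (by omega) _ (hlt a), hR _ (by omega) (by omega) _ (hlt a)⟩
  -- Regions 1, 2 hold the values of ω and regions 3, 4 the input vector, both sorted by units and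
  -- with imaginary part 0. Regions 5, 6 first serve as workspace and then receive the product of
  -- the transforms.
  obtain ⟨l₁, h₁⟩ := exists_isCode_complex (ι := UnitsUpTo b M) (c := 1) (R := R) (V := ∅) (t := 1)
    (fun a => cond a.2 (.const 0) (.omegaVal (unitVal a.1.2) (b ^ (a.1.1 : ℕ)))) hidx one_ne_zero
    hR₀ (hRt 1 le_rfl (by norm_num)) (fun a => by rcases a with ⟨a, _ | _⟩ <;> simp [Expr.reads])
    (fun a => by rcases a with ⟨a, _ | _⟩ <;> simp [Expr.reads]) (by simp)
    (fun a => by rcases a with ⟨a, _ | _⟩ <;> simp [Expr.size])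
    (fun a => by rcases a with ⟨a, _ | _⟩ <;> simp [Expr.depth, scratchSize])
  obtain ⟨l₂, h₂⟩ := exists_isCode_complex (ι := UnitsUpTo b M) (c := 1) (R := R) (V := {7}) (t := 3)
    (fun a => cond a.2 (.const 0) (.reg (slot 7 a.1.toNat))) hidx (by norm_num)
    hR₀ (hRt 3 (by norm_num) (by norm_num))
    (fun a => by
      rcases a with ⟨a, _ | _⟩ <;> simp [Expr.reads, hR 7 (by norm_num) (by norm_num) _ a.toNat_lt])
    (fun a => by rcases a with ⟨a, _ | _⟩ <;> simp [Expr.reads]) (by simp)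
    (fun a => by rcases a with ⟨a, _ | _⟩ <;> simp [Expr.size])
    (fun a => by rcases a with ⟨a, _ | _⟩ <;> simp [Expr.depth, scratchSize])
  obtain ⟨l₃, h₃⟩ := exists_isCode_fast hF₁ hidx (t := 1) (t' := 5) (by norm_num) (by norm_num)
    (by norm_num) hR₀ (hRt 1 (by norm_num) (by norm_num)) (hRt 5 (by norm_num) (by norm_num))
  obtain ⟨l₄, h₄⟩ := exists_isCode_fast hF₂ hidx (t := 3) (t' := 5) (by norm_num) (by norm_num)
    (by norm_num) hR₀ (hRt 3 (by norm_num) (by norm_num)) (hRt 5 (by norm_num) (by norm_num))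
  obtain ⟨l₅, h₅⟩ := exists_isCode_complex (ι := UnitsUpTo b M) (c := 9) (R := R)
    (V := {1, 2, 3, 4}) (t := 5)
    (fun a => cond a.2
      (.add (.mul (.reg (slot 1 (idx a.1))) (.reg (slot 4 (idx a.1))))
        (.mul (.reg (slot 2 (idx a.1))) (.reg (slot 3 (idx a.1)))))
      (.add (.mul (.reg (slot 1 (idx a.1))) (.reg (slot 3 (idx a.1))))
        (.mul (.const (-1)) (.mul (.reg (slot 2 (idx a.1))) (.reg (slot 4 (idx a.1)))))))
    hidx (by norm_num) hR₀ (hRt 5 (by norm_num) (by norm_num))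
    (fun a => by
      have h₁ := hRt 1 (by norm_num) (by norm_num) a.1
      have h₂ := hRt 3 (by norm_num) (by norm_num) a.1
      rcases a with ⟨a, _ | _⟩ <;>
        simp_all [Expr.reads, Finset.insert_subset_iff])
    (fun a y hy => by
      have : y = slot 1 (idx a.1) ∨ y = slot 2 (idx a.1) ∨ y = slot 3 (idx a.1) ∨
          y = slot 4 (idx a.1) := by
        rcases a with ⟨a, _ | _⟩ <;> simp [Expr.reads] at hy <;> tauto
      rcases this with h | h | h | h
      exacts [⟨1, by simp, _, h⟩, ⟨2, by simp, _, h⟩, ⟨3, by simp, _, h⟩, ⟨4, by simp, _, h⟩])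
    (by simp)
    (fun a => by rcases a with ⟨a, _ | _⟩ <;> simp [Expr.size])
    (fun a => by rcases a with ⟨a, _ | _⟩ <;> simp [Expr.depth, scratchSize])
  obtain ⟨l₆, h₆⟩ := exists_isCode_fast hF₃ hidx (t := 5) (t' := 1) (by norm_num) (by norm_num)
    (by norm_num) hR₀ (hRt 5 (by norm_num) (by norm_num)) (hRt 1 (by norm_num) (by norm_num))
  let u : ℕ → Fin (M + 1) → UnitsUpTo b M := fun z i => ⟨i, toUnit _ z⟩
  have hmem : ∀ {z : ℕ} {e : Expr}, e ∈ ((Finset.univ : Finset (Fin (M + 1))).toList.map fun i : Fin (M + 1) =>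
        Expr.mul (.const (1 / (Fintype.card (Additive (ZMod (b ^ (i : ℕ)))ˣ) : ℚ)))
          (.reg (slot 5 (idx (u z i))))) →
      e.size = 3 ∧ e.depth = 2 ∧ ∃ i, e.reads = {slot 5 (idx (u z i))} := fun {z e} he => by
    obtain ⟨i, _, rfl⟩ := List.mem_map.1 he
    exact ⟨rfl, rfl, i, by simp [Expr.reads]⟩
  -- For each unit z, add up the convolutions on the M + 1 unit groups, each divided by the order of
  -- its group. The result is real, so only region 5 is read.
  have h₇ := isCode_assign (R := R) (l := (unitsMod (b ^ M)).toList) (t := fun _ => 8)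
    (k := fun z => z) (c := 1 + (M + 1) * 4) (V := {5}) (W := {8})
    (e := fun z => Expr.sum ((Finset.univ : Finset (Fin (M + 1))).toList.map fun i : Fin (M + 1) =>
      .mul (.const (1 / (Fintype.card (Additive (ZMod (b ^ (i : ℕ)))ˣ) : ℚ)))
        (.reg (slot 5 (idx (u z i)))))) hR₀
    (fun z hz => hR 8 (by norm_num) (by norm_num) _ (mem_unitsMod.1 (Finset.mem_toList.1 hz)).1)
    (fun z _ y hy => by
      obtain ⟨e, he, hy⟩ := Expr.mem_reads_sum.1 hy
      obtain ⟨i, hi⟩ := (hmem he).2.2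
      rw [hi, Finset.mem_singleton] at hy
      exact hy ▸ hR 5 (by norm_num) (by norm_num) _ (hlt _))
    (fun z _ y hy => by
      obtain ⟨e, he, hy⟩ := Expr.mem_reads_sum.1 hy
      obtain ⟨i, hi⟩ := (hmem he).2.2
      rw [hi, Finset.mem_singleton] at hy
      exact ⟨5, by simp, _, hy⟩)
    (fun _ _ => by simp) (by simp) (by simp) (by simp) (fun _ _ _ _ _ h => h)
    (fun z _ => (Expr.size_sum_le fun e he => (hmem he).1.le).trans (by simp))
    (fun z _ => (Expr.depth_sum_le fun e he => (hmem he).2.1.le).trans (by simp [scratchSize]))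
  refine ⟨_, ((((((h₁.append h₂).append h₃).append h₄).append h₅).append h₆).append h₇).imp ?_ ?_ ?_⟩
  · have hu : (unitsMod (b ^ M)).toList.length ≤ b ^ M := by
      rw [Finset.length_toList]
      exact (Finset.card_filter_le _ _).trans (by simp)
    rw [hcard]
    calc _ ≤ 2 * b ^ M * (1 + 1) + 2 * b ^ M * (1 + 1) + b * M * (b ^ M * (16 * b + 8)) +
        b * M * (b ^ M * (16 * b + 8)) + 2 * b ^ M * (9 + 1) + b * M * (b ^ M * (16 * b + 8)) +
        b ^ M * (1 + (M + 1) * 4 + 1) := by gcongr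
      _ = b ^ M * 34 + b ^ M * M * (48 * b ^ 2 + 24 * b + 4) := by ring
      _ ≤ b ^ M * M * 34 + b ^ M * M * (48 * b ^ 2 + 24 * b + 4) := by
        gcongr
        exact Nat.le_mul_of_pos_right _ hM
      _ = _ := by ring
  · intro y
    simp only [Finset.mem_union, Finset.mem_insert, Finset.mem_singleton]
    omega
  · rintro I r r₇ ⟨r₆, ⟨r₅, ⟨r₄, ⟨r₃, ⟨r₂, ⟨r₁, hr₁, hr₂, f₁, f₂⟩, hr₃, -, f₃⟩, hr₄, -, f₄⟩,
      hr₅, -, f₅⟩, hr₆, -, f₆⟩, hr₇, -, f₇⟩ z hz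
    set a : UnitsUpTo b M → ℂ := fun a => I.om ((unitVal a.2 : ℝ) / ((b ^ (a.1 : ℕ) : ℕ) : ℝ))
      with ha
    set q : UnitsUpTo b M → ℂ := fun a => r (slot 7 a.toNat) with hq
    have ha₁ : Holds r₂ 1 idx a := by
      refine Holds.congr (r := r₁) (fun c => ?_) (fun k => f₂ _ _ (by simp))
        fun k => f₂ _ _ (by simp)
      have := hr₁ c
      simpa [Expr.eval, ha] using this
    have hq₁ : Holds r₂ 3 idx q := fun c => by
      have := hr₂ c
      simpa [Expr.eval, hq, f₁] using this
    have ha₃ : Holds r₄ 1 idx (F₁ a) := (hr₃ a ha₁).congr (fun k => f₄ _ _ (by simp))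
        fun k => f₄ _ _ (by simp)
    have hq₃ : Holds r₄ 3 idx (F₂ q) := hr₄ q <| hq₁.congr (fun k => f₃ _ _ (by simp))
        fun k => f₃ _ _ (by simp)
    have hp : Holds r₅ 5 idx fun g => F₁ a g * F₂ q g := fun c => by
      have := hr₅ c
      simp only [cond, Expr.eval] at this
      rw [this.1, this.2, (ha₃ c).1, (hq₃ c).1]
      have h₁ := (ha₃ c).2
      have h₂ := (hq₃ c).2
      norm_num at h₁ h₂
      rw [h₁, h₂, Complex.mul_re, Complex.mul_im]
      refine ⟨?_, rfl⟩
      push_cast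
      ring
    have hfin := hr₆ _ hp
    -- Since M ≥ 1, a unit modulo b^M is coprime to b and hence a unit modulo all b^i.
    have hcop : Nat.Coprime z b := by
      have := (mem_unitsMod.1 hz).2
      rwa [Nat.coprime_pow_right_iff (by omega)] at this
    rw [hr₇ z (Finset.mem_toList.2 hz), Expr.eval_sum, List.map_map, Finset.sum_map_toList,
      sum_omegaEntry_mul hb I.om hcop fun k => r (slot 7 k)]
    refine Finset.sum_congr rfl fun i _ => ?_
    simp only [Function.comp_apply, Expr.eval]
    rw [(hfin _).1, hF]
    have hne : (Fintype.card (Additive (ZMod (b ^ (i : ℕ)))ˣ) : ℝ) ≠ 0 :=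
      Nat.cast_ne_zero.2 Fintype.card_ne_zero
    have hre : (((Fintype.card (Additive (ZMod (b ^ (i : ℕ)))ˣ) : ℕ) : ℂ) *
        ∑ y, a ⟨i, toUnit _ z + y⟩ * q ⟨i, y⟩).re =
        (Fintype.card (Additive (ZMod (b ^ (i : ℕ)))ˣ) : ℝ) *
        ∑ y, I.om ((unitVal (toUnit (b ^ (i : ℕ)) z + y) : ℝ) / ((b ^ (i : ℕ) : ℕ) : ℝ)) *
          r (slot 7 (UnitsUpTo.toNat (⟨i, y⟩ : UnitsUpTo b M))) := by
      rw [← Complex.ofReal_re (_ * _)]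
      congr 1
      simp only [Complex.ofReal_mul, Complex.ofReal_sum, Complex.ofReal_natCast]
      rfl
    change _ * (((Fintype.card (Additive (ZMod (b ^ (i : ℕ)))ˣ) : ℕ) : ℂ) *
        ∑ y, a ⟨i, toUnit _ z + y⟩ * q ⟨i, y⟩).re = _
    rw [hre]
    push_cast
    field_simp

/-! ### Elementary facts on the algorithm -/

theorem lastIndex_le (w : ℕ → ℕ) (m s : ℕ) : lastIndex w m s ≤ s :=
  ENat.toNat_le_of_le_natCast (min_le_left _ _)

/-- By monotonicity the indices with w_j < m form an initial segment, which makes the supremum a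
threshold. -/
theorem le_lastIndex_iff {w : ℕ → ℕ} (hw : MonotoneOn w (Set.Ici 1)) {m s j : ℕ} (hj : 1 ≤ j)
    (hjs : j ≤ s) : j ≤ lastIndex w m s ↔ w j < m := by
  have hfin : min (s : ℕ∞) (sStar w m) ≠ ⊤ := ne_top_of_le_ne_top (ENat.natCast_ne_top s)
    (min_le_left _ _)
  rw [lastIndex, ← ENat.natCast_le_natCast, ENat.natCast_toNat hfin]
  constructor
  · intro h
    by_contra hle
    have h₁ : (j : ℕ∞) ≤ sStar w m := h.trans (min_le_right _ _)
    have h₂ : sStar w m ≤ ((j - 1 : ℕ) : ℕ∞) := by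
      refine iSup₂_le fun i hi => ?_
      rw [ENat.natCast_le_natCast]
      by_contra hij
      exact hle ((hw (Set.mem_Ici.2 hj) (Set.mem_Ici.2 hi.1) (by omega)).trans_lt hi.2)
    have := ENat.natCast_le_natCast.1 (h₁.trans h₂)
    omega
  · intro h
    exact le_min (ENat.natCast_le_natCast.2 hjs) (le_iSup₂_of_le j ⟨hj, h⟩ le_rfl)

theorem foldSum_congr {b m w₁ w₂ : ℕ} {v v' : ℕ → ℝ} (h : ∀ k, v k = v' k) (k : ℕ) :
    foldSum b m w₁ w₂ v k = foldSum b m w₁ w₂ v' k := by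
  simp only [foldSum, h]

theorem qVec_congr {b m : ℕ} {w : ℕ → ℕ} {om : ℝ → ℝ} {Γ γ : ℕ → ℝ} {z z' : ℕ → ℕ} (j ℓ : ℕ)
    (h : ∀ i, 1 ≤ i → i ≤ j → z i = z' i) (k : ℕ) :
    qVec b m w om Γ γ z j ℓ k = qVec b m w om Γ γ z' j ℓ k := by
  induction j generalizing ℓ k with
  | zero => cases ℓ <;> rfl
  | succ j ih =>
    cases ℓ with
    | zero => rfl
    | succ ℓ =>
      have ih' := fun ℓ k => ih ℓ (fun i h₁ h₂ => h i h₁ (by omega)) k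
      simp only [qVec, h (j + 1) (by omega) le_rfl, foldSum_congr (ih' _)]

theorem qBar_congr {b m : ℕ} {w : ℕ → ℕ} {om : ℝ → ℝ} {Γ γ : ℕ → ℝ} {z z' : ℕ → ℕ} (j : ℕ)
    (h : ∀ i, 1 ≤ i → i < j → z i = z' i) (k : ℕ) :
    qBar b m w om Γ γ z j k = qBar b m w om Γ γ z' j k := by
  rw [qBar, qBar]
  refine Finset.sum_congr rfl fun ℓ hℓ => ?_
  have := Finset.mem_Icc.1 hℓ
  rw [foldSum_congr fun k => qVec_congr _ _ (fun i h₁ h₂ => h i h₁ (by omega)) k]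

/-- The vector T_j is determined by the components chosen before step j. Minimality at the time of
the choice is therefore minimality for the final generating vector. -/
theorem tVec_congr {b m : ℕ} {w : ℕ → ℕ} {om : ℝ → ℝ} {Γ γ : ℕ → ℝ} {z z' : ℕ → ℕ} (j : ℕ)
    (h : ∀ i, 1 ≤ i → i < j → z i = z' i) (x : ℕ) :
    tVec b m w om Γ γ z j x = tVec b m w om Γ γ z' j x := by
  simp only [tVec, qBar_congr j h]

theorem withZero_le {w : ℕ → ℕ} (hw : MonotoneOn w (Set.Ici 1)) (j : ℕ) :
    withZero w j ≤ w (j + 1) := by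
  rw [withZero]
  split_ifs with h
  · exact Nat.zero_le _
  · exact hw (Set.mem_Ici.2 (by omega)) (Set.mem_Ici.2 (by omega)) (by omega)

/-- The vector q_{j,0} is constant, and folding multiplies the constant by the number of blocks.
Programs can use this number and need not store the vector. -/
theorem foldSum_qVec_zero (b m : ℕ) {w : ℕ → ℕ} (hw : MonotoneOn w (Set.Ici 1)) (om : ℝ → ℝ)
    (Γ γ : ℕ → ℝ) (z : ℕ → ℕ) (j k : ℕ) :
    foldSum b m (withZero w j) (w (j + 1)) (qVec b m w om Γ γ z j 0) k = (b : ℝ) ^ w (j + 1) := by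
  have h : ∀ k, qVec b m w om Γ γ z j 0 k = (b : ℝ) ^ withZero w j := fun k => by
    cases j <;> simp [qVec, withZero]
  simp only [foldSum, h, Finset.sum_const, Finset.card_range, nsmul_eq_mul]
  push_cast
  rw [← pow_add, Nat.sub_add_cancel (withZero_le hw j)]

theorem qVec_eq_zero {b m : ℕ} {w : ℕ → ℕ} {om : ℝ → ℝ} {Γ γ : ℕ → ℝ} {z : ℕ → ℕ} {j ℓ : ℕ}
    (h : j < ℓ) (k : ℕ) : qVec b m w om Γ γ z j ℓ k = 0 := by
  obtain ⟨ℓ, rfl⟩ : ∃ ℓ', ℓ = ℓ' + 1 := ⟨ℓ - 1, by omega⟩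
  cases j with
  | zero => rfl
  | succ j => simp only [qVec]; rw [if_neg (by omega)]

theorem foldSum_qVec_eq_zero {b m : ℕ} {w : ℕ → ℕ} {om : ℝ → ℝ} {Γ γ : ℕ → ℝ} {z : ℕ → ℕ}
    {w₁ w₂ j ℓ : ℕ} (h : j < ℓ) (k : ℕ) :
    foldSum b m w₁ w₂ (qVec b m w om Γ γ z j ℓ) k = 0 := by
  simp [foldSum, qVec_eq_zero h]

/-! ### The programs -/

/-- Component-by-component search: in each step, some code is executed, the component is chosen
such that the register in the region `8` becomes minimal, and further code is executed. -/
def search (pre : ℕ → List Instr) (upd : ℕ → ℕ → List Instr) (cands : ℕ → List ℕ) :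
    ℕ → ℕ → (ℕ → ℕ) → Prog
  | 0, _, z => .halt z
  | n + 1, j, z => .after (pre j) <| argmin (slot 8)
      (fun x => .after (upd j x) (search pre upd cands n (j + 1) (Function.update z j x)))
      1 (cands j)

theorem cost_search_le {pre : ℕ → List Instr} {upd : ℕ → ℕ → List Instr} {cands : ℕ → List ℕ}
    {c : ℕ → ℕ} {J : ℕ} (hc : ∀ j, 1 ≤ j → j ≤ J → ∀ x ∈ 1 :: cands j,
      (pre j).length + (cands j).length + (upd j x).length ≤ c j) (n j : ℕ) (z : ℕ → ℕ)
    (hj : 1 ≤ j) (hJ : j + n = J + 1) :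
    (search pre upd cands n j z).cost ≤ ∑ i ∈ Finset.Ico j (J + 1), c i := by
  induction n generalizing j z with
  | zero => simp [search, Prog.cost]
  | succ n ih =>
    rw [search, Prog.cost_after, Finset.sum_eq_sum_Ico_succ_bot (by omega)]
    -- The truncated subtractions in the bound are exact, because `hc` for the candidate 1 shows
    -- that `c j` is large enough.
    have h := cost_argmin_le (t := slot 8) (best := 1) (l := cands j)
      (c := c j - (pre j).length - (cands j).length + ∑ i ∈ Finset.Ico (j + 1) (J + 1), c i)
      (K := fun x => .after (upd j x) (search pre upd cands n (j + 1) (Function.update z j x)))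
      fun x hx => by
        rw [Prog.cost_after]
        have h₁ := ih (j + 1) (Function.update z j x) (by omega) (by omega)
        have h₂ := hc j hj (by omega) x hx
        omega
    have := hc j hj (by omega) 1 (by simp)
    omega

theorem regs_search_subset {pre : ℕ → List Instr} {upd : ℕ → ℕ → List Instr}
    {cands : ℕ → List ℕ} {R : Finset ℕ} {J : ℕ}
    (hpre : ∀ j, 1 ≤ j → j ≤ J → ∀ i ∈ pre j, i.regs ⊆ R)
    (hupd : ∀ j, 1 ≤ j → j ≤ J → ∀ x ∈ 1 :: cands j, ∀ i ∈ upd j x, i.regs ⊆ R)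
    (hR : ∀ j, 1 ≤ j → j ≤ J → ∀ x ∈ 1 :: cands j, slot 8 x ∈ R) (n j : ℕ) (z : ℕ → ℕ)
    (hj : 1 ≤ j) (hJ : j + n = J + 1) :
    (search pre upd cands n j z).regs ⊆ R := by
  induction n generalizing j z with
  | zero => simp [search, Prog.regs]
  | succ n ih =>
    exact Prog.regs_after_subset (hpre j hj (by omega)) <|
      regs_argmin_subset (hR j hj (by omega)) fun x hx =>
        Prog.regs_after_subset (hupd j hj (by omega) x hx) <| ih _ _ (by omega) (by omega)

/-- The general form of the programs for the fast reduced CBC construction. The code `pre j`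
computes the vector `q̄_j` in the region `7`, and the code `upd j x` restores the invariant after
the choice `z_j = x`. -/
theorem exists_prog_of_invariant {b m s : ℕ} (hb : b.Prime) {w : ℕ → ℕ}
    (hw : MonotoneOn w (Set.Ici 1)) {R : Finset ℕ} (hR₀ : ∀ d < scratchSize, slot 0 d ∈ R)
    (hR : ∀ t, 1 ≤ t → t ≤ 8 → ∀ k < b ^ (m - w 1), slot t k ∈ R)
    (Inv : Input → ℕ → (ℕ → ℕ) → (ℕ → ℝ) → Prop)
    (hInv : ∀ I j z r r', Inv I j z r → (∀ t k, 9 ≤ t → r' (slot t k) = r (slot t k)) →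
      Inv I j z r')
    {N N' : ℕ → ℕ}
    (hpre : ∀ j, 1 ≤ j → j ≤ lastIndex w m s → ∃ l, IsCode l R (N j) {0, 7} fun I r r' =>
      ∀ z, Inv I j z r → ∀ k < b ^ (m - w j), r' (slot 7 k) = qBar b m w I.om I.Γ I.γ z j k)
    (hupd : ∀ j, 1 ≤ j → j < lastIndex w m s → ∀ x, ∃ l W, IsCode l R (N' j) W
      fun I r r' => ∀ z, z j = x → Inv I j z r → Inv I (j + 1) z r')
    (hInvz : ∀ I j z z' r, (∀ i, 1 ≤ i → i < j → z i = z' i) → Inv I j z r → Inv I j z' r) :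
    ∃ P : Prog, P.cost ≤ ∑ j ∈ Finset.Icc 1 (lastIndex w m s),
        (N j + (48 * b ^ 2 + 24 * b + 39) * ((m - w j) * b ^ (m - w j)) + N' j) ∧ P.regs ⊆ R ∧
      ∀ I, Inv I 1 0 (fun _ => 0) → IsFastRedCBC b m s w I.om I.Γ I.γ (P.output I) := by
  set J := lastIndex w m s with hJ
  have hlt : ∀ j, 1 ≤ j → j ≤ J → w j < m := fun j h₁ h₂ =>
    (le_lastIndex_iff hw h₁ (h₂.trans (lastIndex_le w m s))).1 h₂
  have hn : ∀ j, 1 ≤ j → b ^ (m - w j) ≤ b ^ (m - w 1) := fun j h =>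
    Nat.pow_le_pow_right hb.pos (Nat.sub_le_sub_left
      (hw (Set.mem_Ici.2 le_rfl) (Set.mem_Ici.2 h) h) m)
  have hpre' : ∀ j, ∃ l, 1 ≤ j → j ≤ J →
      IsCode l R (N j + (48 * b ^ 2 + 24 * b + 38) * ((m - w j) * b ^ (m - w j)))
        {0, 1, 2, 3, 4, 5, 6, 7, 8} fun I r r' =>
      ∀ z, Inv I j z r → Inv I j z r' ∧
        ∀ x ∈ unitsMod (b ^ (m - w j)), r' (slot 8 x) = tVec b m w I.om I.Γ I.γ z j x := by
    intro j
    by_cases hj : 1 ≤ j ∧ j ≤ J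
    · obtain ⟨l₁, h₁⟩ := hpre j hj.1 hj.2
      obtain ⟨l₂, h₂⟩ := exists_isCode_matVec hb (M := m - w j)
        (by have := hlt j hj.1 hj.2; omega) hR₀
        (fun t h₁ h₂ k hk => hR t h₁ h₂ k (hk.trans_le (hn j hj.1)))
      have h := h₁.append h₂
      refine ⟨l₁ ++ l₂, fun _ _ => ⟨h.regs, h.length_le, fun I r t k ht => h.frame I r t k ?_,
        fun I r z hz => ⟨hInv I j z r _ hz fun t k ht => h.frame I r t k ?_, fun x hx => ?_⟩⟩⟩
      · simp at ht ⊢; tauto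
      · simp; omega
      · obtain ⟨r', h₁', h₂', -, -⟩ := h.spec I r
        rw [h₂' x hx, tVec]
        exact Finset.sum_congr rfl fun k hk => by rw [h₁' z hz k (Finset.mem_range.1 hk)]
    · exact ⟨[], fun h₁ h₂ => (hj ⟨h₁, h₂⟩).elim⟩
  choose pre hpre' using hpre'
  have hupd' : ∀ j x, ∃ l, (∀ i ∈ l, i.regs ⊆ R) ∧ l.length ≤ N' j ∧ (1 ≤ j → j < J →
      ∀ I r z, z j = x → Inv I j z r → Inv I (j + 1) z (exec I l r)) := by
    intro j x
    by_cases hj : 1 ≤ j ∧ j < J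
    · obtain ⟨l, W, h⟩ := hupd j hj.1 hj.2 x
      exact ⟨l, h.regs, h.length_le, fun _ _ I r z hz hI => h.spec I r z hz hI⟩
    · exact ⟨[], by simp, by simp, fun h₁ h₂ => (hj ⟨h₁, h₂⟩).elim⟩
  choose upd hupd₁ hupd₂ hupd₃ using hupd'
  -- The search for a minimum starts with the candidate 1, which lies below the modulus because w_j
  -- < m.
  have hone : ∀ j, 1 ≤ j → j ≤ J → 1 ∈ unitsMod (b ^ (m - w j)) := fun j h₁ h₂ => by
    have := hlt j h₁ h₂
    exact mem_unitsMod.2 ⟨Nat.one_lt_pow (by omega) hb.one_lt, Nat.coprime_one_left _⟩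
  have hmem : ∀ j, 1 ≤ j → j ≤ J → ∀ x, x ∈ 1 :: (unitsMod (b ^ (m - w j))).toList ↔
      x ∈ unitsMod (b ^ (m - w j)) := fun j h₁ h₂ x => by
    rw [List.mem_cons, Finset.mem_toList, or_iff_right_of_imp]
    rintro rfl
    exact hone j h₁ h₂
  refine ⟨search pre upd (fun j => (unitsMod (b ^ (m - w j))).toList) J 1 0, ?_, ?_, ?_⟩
  · refine cost_search_le (c := fun j => N j + (48 * b ^ 2 + 24 * b + 39) *
      ((m - w j) * b ^ (m - w j)) + N' j) (fun j h₁ h₂ x hx => ?_) J 1 0 le_rfl (add_comm _ _)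
    have hl₁ := (hpre' j h₁ h₂).length_le
    have hl₂ := hupd₂ j x
    have hl₃ : (unitsMod (b ^ (m - w j))).toList.length ≤ (m - w j) * b ^ (m - w j) := by
      rw [Finset.length_toList]
      refine ((Finset.card_filter_le _ _).trans (by simp)).trans
        (Nat.le_mul_of_pos_left (b ^ (m - w j)) ?_)
      have := hlt j h₁ h₂
      omega
    calc _ ≤ N j + (48 * b ^ 2 + 24 * b + 38) * ((m - w j) * b ^ (m - w j)) +
        (m - w j) * b ^ (m - w j) + N' j := by gcongr
      _ = _ := by ring
  · exact regs_search_subset (J := J) (fun j h₁ h₂ => (hpre' j h₁ h₂).regs)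
      (fun j _ _ x _ => hupd₁ j x)
      (fun j h₁ h₂ x hx => hR 8 (by norm_num) le_rfl _
        ((mem_unitsMod.1 ((hmem j h₁ h₂ x).1 hx)).1.trans_le (hn j h₁))) J 1 0 le_rfl (add_comm _ _)
  · intro I hI
    -- The invariant is needed only while components remain (n ≠ 0), since nothing has to be
    -- restored after the last choice. The conclusion also records that earlier components stay
    -- fixed and later ones are 0.
    have key : ∀ n j z r, 1 ≤ j → j + n = J + 1 → (∀ i, j ≤ i → z i = 0) → (n ≠ 0 → Inv I j z r) →
        ∀ z', z' = (search pre upd (fun j => (unitsMod (b ^ (m - w j))).toList) n j z).run I r →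
        (∀ i, i < j → z' i = z i) ∧ (∀ i, J < i → z' i = 0) ∧
        ∀ i, j ≤ i → i ≤ J → z' i ∈ unitsMod (b ^ (m - w i)) ∧
          ∀ x ∈ unitsMod (b ^ (m - w i)),
            tVec b m w I.om I.Γ I.γ z' i (z' i) ≤ tVec b m w I.om I.Γ I.γ z' i x := by
      intro n
      induction n with
      | zero =>
        rintro j z r hj hJn hz - z' rfl
        exact ⟨fun _ _ => rfl, fun i hi => hz i (by omega), fun i h₁ h₂ => by omega⟩
      | succ n ih =>
        rintro j z r hj hJn hz hInv' z' hz'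
        have hjJ : j ≤ J := by omega
        obtain ⟨hI', hT⟩ := (hpre' j hj hjJ).spec I r z (hInv' n.succ_ne_zero)
        rw [search, Prog.run_after] at hz'
        obtain ⟨x, hx, hmin, hrun⟩ := exists_run_argmin I (slot 8)
          (fun x => .after (upd j x) (search pre upd (fun j => (unitsMod (b ^ (m - w j))).toList)
            n (j + 1) (Function.update z j x))) 1 (unitsMod (b ^ (m - w j))).toList
          (exec I (pre j) r)
        rw [hrun, Prog.run_after] at hz'
        have hInv'' : n ≠ 0 → Inv I (j + 1) (Function.update z j x)
            (exec I (upd j x) (exec I (pre j) r)) := fun hn0 => by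
          refine hupd₃ j x hj (by omega) I _ _ (Function.update_self _ _ _) ?_
          exact hInvz I j z _ _ (fun i _ hi => by rw [Function.update_of_ne (by omega)]) hI'
        obtain ⟨h₁, h₂, h₃⟩ := ih (j + 1) (Function.update z j x) _ (by omega) (by omega)
          (fun i hi => by rw [Function.update_of_ne (by omega)]; exact hz i (by omega)) hInv'' z' hz'
        have hzj : z' j = x := by rw [h₁ j (by omega), Function.update_self]
        have hlow : ∀ i, i < j → z' i = z i := fun i hi => by
          rw [h₁ i (by omega), Function.update_of_ne (by omega)]
        refine ⟨hlow, h₂, fun i h₄ h₅ => ?_⟩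
        rcases h₄.eq_or_lt with rfl | hlt'
        · have hxu := (hmem j hj hjJ x).1 hx
          refine ⟨hzj ▸ hxu, fun y hy => ?_⟩
          rw [hzj, tVec_congr j (fun i _ hi => hlow i hi), tVec_congr j (fun i _ hi => hlow i hi),
            ← hT x hxu, ← hT y hy]
          exact hmin y ((hmem j hj hjJ y).2 hy)
        · exact h₃ i hlt' h₅
    obtain ⟨-, h₂, h₃⟩ := key J 1 0 (fun _ => 0) le_rfl (add_comm _ _) (fun _ _ => rfl)
      (fun _ => hI) _ rfl
    intro j hj
    obtain ⟨hj₁, hj₂⟩ := Finset.mem_Icc.1 hj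
    refine ⟨fun hjm => h₃ j hj₁ ((le_lastIndex_iff hw hj₁ hj₂).2 hjm), fun hjm => h₂ j ?_⟩
    by_contra hcon
    have := hlt j hj₁ (not_lt.1 hcon)
    omega

theorem card_image_slot_le (A : Finset ℕ) (n : ℕ) :
    ((A ×ˢ Finset.range n).image fun p => slot p.1 p.2).card ≤ A.card * n :=
  Finset.card_image_le.trans (by simp)

/-- Code that replaces the vectors in the regions `src a` by their folded versions. -/
theorem isCode_fold {b m w₁ w₂ : ℕ} (hb : b.Prime) (h₁₂ : w₁ ≤ w₂) (h₂ : w₂ ≤ m) {A : Finset ℕ}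
    {src dst : ℕ → ℕ} {R : Finset ℕ} (hR₀ : ∀ d < scratchSize, slot 0 d ∈ R)
    (hsrc : ∀ a ∈ A, ∀ k < b ^ (m - w₁), slot (src a) k ∈ R)
    (hdst : ∀ a ∈ A, ∀ k < b ^ (m - w₁), slot (dst a) k ∈ R)
    (h0 : ∀ a ∈ A, src a ≠ 0 ∧ dst a ≠ 0) (hsd : ∀ a ∈ A, ∀ a' ∈ A, src a ≠ dst a')
    (hinj : ∀ a ∈ A, ∀ a' ∈ A, dst a = dst a' → a = a') :
    ∃ l, IsCode l R (4 * (A.card * b ^ (m - w₁))) (insert 0 (A.image dst)) fun _ r r' =>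
      ∀ a ∈ A, ∀ k < b ^ (m - w₂),
        r' (slot (dst a) k) = foldSum b m w₁ w₂ (fun k => r (slot (src a) k)) k := by
  have hlen : b ^ (w₂ - w₁) * b ^ (m - w₂) = b ^ (m - w₁) := by
    rw [← pow_add]; congr 1; omega
  have hidx : ∀ t < b ^ (w₂ - w₁), ∀ k < b ^ (m - w₂), k + t * b ^ (m - w₂) < b ^ (m - w₁) := by
    intro t ht k hk
    rw [← hlen]
    calc k + t * b ^ (m - w₂) < (t + 1) * b ^ (m - w₂) := by linarith
      _ ≤ _ := Nat.mul_le_mul_right _ ht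
  have hreads : ∀ p : ℕ × ℕ, p ∈ (A ×ˢ Finset.range (b ^ (m - w₂))).toList → ∀ y ∈ (Expr.sum
      ((List.range (b ^ (w₂ - w₁))).map fun t =>
        Expr.reg (slot (src p.1) (p.2 + t * b ^ (m - w₂))))).reads, p.1 ∈ A ∧
      ∃ k < b ^ (m - w₁), y = slot (src p.1) k := by
    intro p hp y hy
    obtain ⟨e, he, hy⟩ := Expr.mem_reads_sum.1 hy
    obtain ⟨t, ht, rfl⟩ := List.mem_map.1 he
    simp only [Finset.mem_toList, Finset.mem_product, Finset.mem_range] at hp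
    exact ⟨hp.1, _, hidx t (List.mem_range.1 ht) _ hp.2, by simpa [Expr.reads] using hy⟩
  have h := isCode_assign (R := R) (l := (A ×ˢ Finset.range (b ^ (m - w₂))).toList)
    (t := fun p => dst p.1) (k := fun p => p.2) (c := 1 + b ^ (w₂ - w₁) * 2)
    (V := A.image src) (W := A.image dst)
    (e := fun p => Expr.sum ((List.range (b ^ (w₂ - w₁))).map fun t =>
      Expr.reg (slot (src p.1) (p.2 + t * b ^ (m - w₂))))) hR₀
    (fun p hp => by
      simp only [Finset.mem_toList, Finset.mem_product, Finset.mem_range] at hp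
      exact hdst _ hp.1 _ (hp.2.trans_le (Nat.pow_le_pow_right hb.pos (by omega))))
    (fun p hp y hy => by
      obtain ⟨hA, k, hk, rfl⟩ := hreads p hp y hy
      exact hsrc _ hA _ hk)
    (fun p hp y hy => by
      obtain ⟨hA, k, hk, rfl⟩ := hreads p hp y hy
      exact ⟨_, Finset.mem_image_of_mem _ hA, k, rfl⟩)
    (fun p hp => Finset.mem_image_of_mem _ (Finset.mem_product.1 (Finset.mem_toList.1 hp)).1)
    (by
      rw [Finset.disjoint_left]
      intro t ht ht'
      obtain ⟨a, ha, rfl⟩ := Finset.mem_image.1 ht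
      obtain ⟨a', ha', h⟩ := Finset.mem_image.1 ht'
      exact hsd a ha a' ha' h.symm)
    (fun h => by obtain ⟨a, ha, h⟩ := Finset.mem_image.1 h; exact (h0 a ha).1 h)
    (fun h => by obtain ⟨a, ha, h⟩ := Finset.mem_image.1 h; exact (h0 a ha).2 h)
    (fun p hp p' hp' h₁ h₂ => Prod.ext (hinj _ (Finset.mem_product.1 (Finset.mem_toList.1 hp)).1 _
      (Finset.mem_product.1 (Finset.mem_toList.1 hp')).1 h₁) h₂)
    (fun p _ => (Expr.size_sum_le (c := 1) fun e he => by
      obtain ⟨t, ht, rfl⟩ := List.mem_map.1 he; simp [Expr.size]).trans (by simp))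
    (fun p _ => (Expr.depth_sum_le (D := 1) fun e he => by
      obtain ⟨t, ht, rfl⟩ := List.mem_map.1 he; simp [Expr.depth]).trans (by simp [scratchSize]))
  refine ⟨_, h.imp ?_ subset_rfl fun I r r' h a ha k hk => ?_⟩
  · rw [Finset.length_toList, Finset.card_product, Finset.card_range, ← hlen]
    -- At least one block is added, so the constant overhead per entry is absorbed into the factor
    -- 4.
    have : 1 ≤ b ^ (w₂ - w₁) := Nat.one_le_pow _ _ hb.pos
    calc A.card * b ^ (m - w₂) * (1 + b ^ (w₂ - w₁) * 2 + 1)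
        ≤ A.card * b ^ (m - w₂) * (b ^ (w₂ - w₁) * 4) := by gcongr; omega
      _ = _ := by ring
  · rw [h (a, k) (by simp [ha, hk]), Expr.eval_sum, List.map_map, foldSum]
    simp [Finset.sum, Expr.eval, Function.comp_def, Multiset.range]

theorem foldSum_congr_of_lt {b m w₁ w₂ : ℕ} (h₁₂ : w₁ ≤ w₂) (h₂ : w₂ ≤ m)
    {v v' : ℕ → ℝ} (h : ∀ k < b ^ (m - w₁), v k = v' k) {k : ℕ} (hk : k < b ^ (m - w₂)) :
    foldSum b m w₁ w₂ v k = foldSum b m w₁ w₂ v' k := by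
  refine Finset.sum_congr rfl fun t ht => h _ ?_
  have hlen : b ^ (w₂ - w₁) * b ^ (m - w₂) = b ^ (m - w₁) := by
    rw [← pow_add]; congr 1; omega
  rw [← hlen]
  calc k + t * b ^ (m - w₂) < (t + 1) * b ^ (m - w₂) := by linarith
    _ ≤ _ := Nat.mul_le_mul_right _ (Finset.mem_range.1 ht)

theorem monotone_pow_sub {b m : ℕ} (hb : b.Prime) {w : ℕ → ℕ} (hw : MonotoneOn w (Set.Ici 1))
    {i j : ℕ} (hi : 1 ≤ i) (hij : i ≤ j) : b ^ (m - w j) ≤ b ^ (m - w i) :=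
  Nat.pow_le_pow_right hb.pos (Nat.sub_le_sub_left
    (hw (Set.mem_Ici.2 hi) (Set.mem_Ici.2 (hi.trans hij)) hij) m)

/-- The construction for POD weights. -/
theorem exists_prog_pod {b : ℕ} (hb : b.Prime) (m s : ℕ) {w : ℕ → ℕ}
    (hw : MonotoneOn w (Set.Ici 1)) :
    ∃ P : Prog,
      P.cost ≤ (48 * b ^ 2 + 24 * b + 63) *
        ∑ j ∈ Finset.Icc 1 (lastIndex w m s), (m - w j + j) * b ^ (m - w j) ∧
      P.memory ≤ 20 * ∑ j ∈ Finset.Icc 1 (lastIndex w m s), b ^ (m - w j) ∧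
      ∀ I : Input, IsFastRedCBC b m s w I.om I.Γ I.γ (P.output I) := by
  set J := lastIndex w m s with hJ
  -- If J = 0, both bounds are 0 and the program may not use a single register; all components are
  -- then 0.
  rcases Nat.eq_zero_or_pos J with hJ0 | hJ0
  · refine ⟨.halt fun _ => 0, by simp [Prog.cost], by simp [Prog.memory, Prog.regs], fun I j hj =>
      ⟨fun h => ?_, fun _ => rfl⟩⟩
    obtain ⟨h₁, h₂⟩ := Finset.mem_Icc.1 hj
    have := (le_lastIndex_iff hw h₁ h₂).2 h
    omega
  have hlt : ∀ j, 1 ≤ j → j ≤ J → w j < m := fun j h₁ h₂ =>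
    (le_lastIndex_iff hw h₁ (h₂.trans (lastIndex_le w m s))).1 h₂
  -- The vectors with second index ℓ are first needed in step ℓ, when their length is at most
  -- b^(m-w_ℓ). Two regions of this length for each ℓ give the memory bound as a sum, instead of J
  -- vectors of the largest length.
  let R : Finset ℕ := ((({0} : Finset ℕ) ×ˢ Finset.range scratchSize).image fun p => slot p.1 p.2) ∪
    ((Finset.Icc 1 8 ×ˢ Finset.range (b ^ (m - w 1))).image fun p => slot p.1 p.2) ∪
    (Finset.Icc 1 J).biUnion fun ℓ =>
      (({9 + 2 * ℓ, 10 + 2 * ℓ} : Finset ℕ) ×ˢ Finset.range (b ^ (m - w ℓ))).image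
        fun p => slot p.1 p.2
  have hR₀ : ∀ d < scratchSize, slot 0 d ∈ R := fun d hd => Finset.mem_union_left _ <|
    Finset.mem_union_left _ <| Finset.mem_image.2 ⟨(0, d), by simpa using hd, rfl⟩
  have hR : ∀ t, 1 ≤ t → t ≤ 8 → ∀ k < b ^ (m - w 1), slot t k ∈ R := fun t h₁ h₂ k hk =>
    Finset.mem_union_left _ <| Finset.mem_union_right _ <| Finset.mem_image.2
      ⟨(t, k), by simp [h₁, h₂, hk], rfl⟩
  have hRq : ∀ ℓ, 1 ≤ ℓ → ℓ ≤ J → ∀ k < b ^ (m - w ℓ), slot (9 + 2 * ℓ) k ∈ R ∧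
      slot (10 + 2 * ℓ) k ∈ R := fun ℓ h₁ h₂ k hk => by
    constructor <;> refine Finset.mem_union_right _ (Finset.mem_biUnion.2
      ⟨ℓ, Finset.mem_Icc.2 ⟨h₁, h₂⟩, Finset.mem_image.2 ⟨(_, k), ?_, rfl⟩⟩) <;> simp [hk]
  have hcard : R.card ≤ 20 * ∑ j ∈ Finset.Icc 1 J, b ^ (m - w j) := by
    have h₁ : b ^ (m - w 1) ≤ ∑ j ∈ Finset.Icc 1 J, b ^ (m - w j) :=
      Finset.single_le_sum (f := fun j => b ^ (m - w j)) (fun _ _ => Nat.zero_le _)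
        (Finset.mem_Icc.2 ⟨le_rfl, hJ0⟩)
    have h₂ : 1 ≤ b ^ (m - w 1) := Nat.one_le_pow _ _ hb.pos
    have h₃ : ((Finset.Icc 1 J).biUnion fun ℓ =>
        (({9 + 2 * ℓ, 10 + 2 * ℓ} : Finset ℕ) ×ˢ Finset.range (b ^ (m - w ℓ))).image
        fun p => slot p.1 p.2).card ≤ ∑ j ∈ Finset.Icc 1 J, 2 * b ^ (m - w j) :=
      Finset.card_biUnion_le.trans (Finset.sum_le_sum fun ℓ _ =>
        (card_image_slot_le _ _).trans (Nat.mul_le_mul_right _ Finset.card_le_two))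
    rw [← Finset.mul_sum] at h₃
    have h₄ := card_image_slot_le {0} scratchSize
    have h₅ := card_image_slot_le (Finset.Icc 1 8) (b ^ (m - w 1))
    simp only [Finset.card_singleton, scratchSize, Nat.card_Icc] at h₄ h₅
    have h₆ := (Finset.card_union_le _ _).trans (Nat.add_le_add ((Finset.card_union_le _ _).trans
      (Nat.add_le_add h₄ h₅)) h₃)
    refine h₆.trans ?_
    omega
  -- Before step j the regions hold the vectors already folded to the length of step j, for 1 ≤ ℓ <
  -- j only: the vector for ℓ = 0 is a known constant and those for ℓ ≥ j vanish.
  let Inv : Input → ℕ → (ℕ → ℕ) → (ℕ → ℝ) → Prop := fun I j z r =>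
    ∀ ℓ, 1 ≤ ℓ → ℓ < j → ∀ k < b ^ (m - w j), r (slot (9 + 2 * ℓ) k) =
      foldSum b m (withZero w (j - 1)) (w j) (qVec b m w I.om I.Γ I.γ z (j - 1) ℓ) k
  let p : ℕ → ℕ → ℕ → Expr := fun j ℓ k => if ℓ = 0 then .const (b ^ w j) else
    if ℓ < j then .reg (slot (9 + 2 * ℓ) k) else .const 0
  have hp : ∀ I j z r, 1 ≤ j → Inv I j z r → ∀ ℓ, ∀ k < b ^ (m - w j), (p j ℓ k).eval I r =
      foldSum b m (withZero w (j - 1)) (w j) (qVec b m w I.om I.Γ I.γ z (j - 1) ℓ) k := by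
    intro I j z r hj h ℓ k hk
    obtain ⟨j, rfl⟩ : ∃ j', j = j' + 1 := ⟨j - 1, by omega⟩
    simp only [p, Nat.add_sub_cancel]
    split_ifs with h₁ h₂
    · subst h₁
      rw [foldSum_qVec_zero b m hw]
      simp [Expr.eval]
    · exact h ℓ (by omega) h₂ k hk
    · rw [foldSum_qVec_eq_zero (by omega)]
      simp [Expr.eval]
  have hpreads : ∀ j ℓ k y, y ∈ (p j ℓ k).reads → 1 ≤ ℓ ∧ ℓ < j ∧ y = slot (9 + 2 * ℓ) k := by
    intro j ℓ k y hy
    simp only [p] at hy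
    split_ifs at hy with h₁ h₂ <;> simp [Expr.reads] at hy
    exact ⟨by omega, h₂, hy⟩
  have hpsize : ∀ j ℓ k, (p j ℓ k).size = 1 ∧ (p j ℓ k).depth = 1 := by
    intro j ℓ k
    simp only [p]
    split_ifs <;> exact ⟨rfl, rfl⟩
  have hpR : ∀ j ℓ, j ≤ J → ∀ k < b ^ (m - w j), (p j ℓ k).reads ⊆ R := by
    intro j ℓ hjJ k hk y hy
    obtain ⟨h₁, h₂, rfl⟩ := hpreads j ℓ k y hy
    exact (hRq ℓ h₁ (by omega) k (hk.trans_le (monotone_pow_sub hb hw h₁ h₂.le))).1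
  have hmain := exists_prog_of_invariant (s := s) hb hw hR₀ hR Inv
    (fun I j z r r' h hr ℓ h₁ h₂ k hk => by rw [hr _ _ (by omega)]; exact h ℓ h₁ h₂ k hk)
    (N := fun j => 8 * (j * b ^ (m - w j))) (N' := fun j => 16 * (j * b ^ (m - w j))) ?_ ?_ ?_
  · obtain ⟨P, hcost, hregs, hP⟩ := hmain
    refine ⟨P, hcost.trans ?_, (Finset.card_le_card hregs).trans hcard,
      fun I => hP I fun ℓ h₁ h₂ => by omega⟩
    rw [Finset.mul_sum]
    refine Finset.sum_le_sum fun j _ => ?_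
    calc 8 * (j * b ^ (m - w j)) + (48 * b ^ 2 + 24 * b + 39) * ((m - w j) * b ^ (m - w j)) +
        16 * (j * b ^ (m - w j)) ≤ 8 * (j * b ^ (m - w j)) +
        (48 * b ^ 2 + 24 * b + 39) * ((m - w j) * b ^ (m - w j)) +
        16 * (j * b ^ (m - w j)) + ((48 * b ^ 2 + 24 * b + 39) * (j * b ^ (m - w j)) +
          24 * ((m - w j) * b ^ (m - w j))) := Nat.le_add_right _ _
      _ = _ := by ring
  · intro j hj hjJ
    have hmem : ∀ {k : ℕ} {e : Expr}, e ∈ ((Finset.Icc 1 j).toList.map fun ℓ =>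
        Expr.mul (.div (.readOrder ℓ) (.readOrder (ℓ - 1))) (p j (ℓ - 1) k)) →
        e.size = 5 ∧ e.depth = 2 ∧ ∃ ℓ, e.reads = (p j ℓ k).reads := fun {k e} he => by
      obtain ⟨ℓ, _, rfl⟩ := List.mem_map.1 he
      exact ⟨by simp [Expr.size, hpsize], by simp [Expr.depth, hpsize], ℓ - 1, by simp [Expr.reads]⟩
    have h := isCode_assign (R := R) (l := List.range (b ^ (m - w j))) (t := fun _ => 7)
      (k := fun k => k) (c := 1 + j * 6) (V := (Finset.Icc 1 j).image fun ℓ => 9 + 2 * ℓ) (W := {7})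
      (e := fun k => Expr.sum ((Finset.Icc 1 j).toList.map fun ℓ =>
        .mul (.div (.readOrder ℓ) (.readOrder (ℓ - 1))) (p j (ℓ - 1) k))) hR₀
      (fun k hk => hR 7 (by norm_num) (by norm_num) _
        ((List.mem_range.1 hk).trans_le (monotone_pow_sub hb hw le_rfl hj)))
      (fun k hk y hy => by
        obtain ⟨e, he, hy⟩ := Expr.mem_reads_sum.1 hy
        obtain ⟨ℓ, hℓ⟩ := (hmem he).2.2
        exact hpR j ℓ hjJ k (List.mem_range.1 hk) (hℓ ▸ hy))
      (fun k hk y hy => by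
        obtain ⟨e, he, hy⟩ := Expr.mem_reads_sum.1 hy
        obtain ⟨ℓ, hℓ⟩ := (hmem he).2.2
        obtain ⟨h₁, h₂, rfl⟩ := hpreads j ℓ k y (hℓ ▸ hy)
        exact ⟨_, Finset.mem_image_of_mem _ (Finset.mem_Icc.2 ⟨h₁, h₂.le⟩), k, rfl⟩)
      (fun _ _ => by simp) (by simp; omega) (by simp) (by simp) (fun _ _ _ _ _ h => h)
      (fun k _ => (Expr.size_sum_le fun e he => (hmem he).1.le).trans (by simp))
      (fun k _ => (Expr.depth_sum_le fun e he => (hmem he).2.1.le).trans (by simp [scratchSize]))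
    refine ⟨_, h.imp ?_ (by simp) fun I r r' h z hz k hk => ?_⟩
    · rw [List.length_range]
      calc b ^ (m - w j) * (1 + j * 6 + 1) ≤ b ^ (m - w j) * (j * 8) := by gcongr; omega
        _ = _ := by ring
    · rw [h k (List.mem_range.2 hk), Expr.eval_sum, List.map_map, Finset.sum_map_toList, qBar]
      refine Finset.sum_congr rfl fun ℓ hℓ => ?_
      simp only [Function.comp_apply, Expr.eval, hp I j z r hj hz _ k hk]
  · intro j hj hjJ x
    have hnext := hlt (j + 1) (by omega) hjJ
    have hwj : withZero w j = w j := if_neg (by omega)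
    have hmono : w j ≤ w (j + 1) := hwj ▸ withZero_le hw j
    -- The new vectors go to the second region of each pair, because every old vector is read for
    -- two consecutive values of ℓ. Folding to the next length then moves them to the first region.
    have h₁ := isCode_assign (R := R)
      (l := (Finset.Icc 1 j ×ˢ Finset.range (b ^ (m - w j))).toList)
      (t := fun a => 10 + 2 * a.1) (k := fun a => a.2) (c := 11)
      (V := (Finset.Icc 1 j).image fun ℓ => 9 + 2 * ℓ)
      (W := (Finset.Icc 1 j).image fun ℓ => 10 + 2 * ℓ)
      (e := fun a => .add (p j a.1 a.2) (.mul (.mul (.mul (.div (.readOrder a.1)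
        (.readOrder (a.1 - 1))) (.readProd j)) (.omegaVal (a.2 * x % b ^ (m - w j))
          (b ^ (m - w j)))) (p j (a.1 - 1) a.2))) hR₀
      (fun a ha => by
        simp only [Finset.mem_toList, Finset.mem_product, Finset.mem_range, Finset.mem_Icc] at ha
        exact (hRq a.1 ha.1.1 (by omega) a.2
          (ha.2.trans_le (monotone_pow_sub hb hw ha.1.1 ha.1.2))).2)
      (fun a ha => by
        simp only [Finset.mem_toList, Finset.mem_product, Finset.mem_range, Finset.mem_Icc] at ha
        simpa [Expr.reads] using Finset.union_subset (hpR j a.1 hjJ.le a.2 ha.2)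
          (hpR j (a.1 - 1) hjJ.le a.2 ha.2))
      (fun a ha y hy => by
        have : ∃ ℓ, y ∈ (p j ℓ a.2).reads := by
          simp [Expr.reads] at hy
          rcases hy with hy | hy <;> exact ⟨_, hy⟩
        obtain ⟨ℓ, hy⟩ := this
        obtain ⟨h₁, h₂, rfl⟩ := hpreads j _ _ y hy
        exact ⟨_, Finset.mem_image_of_mem _ (Finset.mem_Icc.2 ⟨h₁, h₂.le⟩), _, rfl⟩)
      (fun a ha => Finset.mem_image_of_mem _ (Finset.mem_product.1 (Finset.mem_toList.1 ha)).1)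
      (by
        rw [Finset.disjoint_left]
        intro t ht ht'
        obtain ⟨i, -, rfl⟩ := Finset.mem_image.1 ht
        obtain ⟨i', -, h⟩ := Finset.mem_image.1 ht'
        omega)
      (by simp) (by simp)
      (fun a _ a' _ h₁ h₂ => Prod.ext (by omega) h₂)
      (fun a _ => by simp [Expr.size, hpsize]) (fun a _ => by simp [Expr.depth, hpsize, scratchSize])
    obtain ⟨l₂, h₂⟩ := isCode_fold (A := Finset.Icc 1 j) (src := fun ℓ => 10 + 2 * ℓ)
      (dst := fun ℓ => 9 + 2 * ℓ) hb hmono hnext.le hR₀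
      (fun ℓ hℓ k hk => by
        obtain ⟨h₁, h₂⟩ := Finset.mem_Icc.1 hℓ
        exact (hRq ℓ h₁ (by omega) k (hk.trans_le (monotone_pow_sub hb hw h₁ h₂))).2)
      (fun ℓ hℓ k hk => by
        obtain ⟨h₁, h₂⟩ := Finset.mem_Icc.1 hℓ
        exact (hRq ℓ h₁ (by omega) k (hk.trans_le (monotone_pow_sub hb hw h₁ h₂))).1)
      (fun _ _ => by omega) (fun _ _ _ _ => by omega) (fun _ _ _ _ => by omega)
    refine ⟨_, _, (h₁.append h₂).imp ?_ subset_rfl ?_⟩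
    · rw [Finset.length_toList, Finset.card_product, Finset.card_range, Nat.card_Icc,
        Nat.add_sub_cancel]
      exact le_of_eq (by ring)
    · rintro I r r'' ⟨r', hr', hr'', -, -⟩ z hzx hz ℓ hℓ₁ hℓ₂ k hk
      rw [hr'' ℓ (Finset.mem_Icc.2 ⟨hℓ₁, by omega⟩) k hk, Nat.add_sub_cancel, hwj]
      refine foldSum_congr_of_lt hmono hnext.le (fun k hk => ?_) hk
      rw [hr' (ℓ, k) (by simp; omega)]
      simp only [Expr.eval, hp I j z r hj hz _ k hk]
      obtain ⟨j, rfl⟩ : ∃ j', j = j' + 1 := ⟨j - 1, by omega⟩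
      obtain ⟨ℓ, rfl⟩ : ∃ ℓ', ℓ = ℓ' + 1 := ⟨ℓ - 1, by omega⟩
      simp only [qVec, Nat.add_sub_cancel, omegaEntry, hzx]
      rw [if_pos (by omega)]
  · intro I j z z' r hzz h ℓ h₁ h₂ k hk
    rw [h ℓ h₁ h₂ k hk]
    exact foldSum_congr (fun k => qVec_congr _ _ (fun i h₁ h₂ => hzz i h₁ (by omega)) k) k

/-- The construction for product weights. -/
theorem exists_prog_product {b : ℕ} (hb : b.Prime) (m s : ℕ) {w : ℕ → ℕ}
    (hw : MonotoneOn w (Set.Ici 1)) :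
    ∃ P : Prog,
      P.cost ≤ (48 * b ^ 2 + 24 * b + 63) *
        ∑ j ∈ Finset.Icc 1 (lastIndex w m s), (m - w j) * b ^ (m - w j) ∧
      P.memory ≤ 20 * b ^ (m - w 1) ∧
      ∀ I : Input, (I.Γ = fun _ => 1) → IsFastRedCBC b m s w I.om I.Γ I.γ (P.output I) := by
  set J := lastIndex w m s with hJ
  have hlt : ∀ j, 1 ≤ j → j ≤ J → w j < m := fun j h₁ h₂ =>
    (le_lastIndex_iff hw h₁ (h₂.trans (lastIndex_le w m s))).1 h₂
  let R : Finset ℕ := ((({0} : Finset ℕ) ×ˢ Finset.range scratchSize).image fun p => slot p.1 p.2) ∪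
    ((Finset.Icc 1 10 ×ˢ Finset.range (b ^ (m - w 1))).image fun p => slot p.1 p.2)
  have hR₀ : ∀ d < scratchSize, slot 0 d ∈ R := fun d hd =>
    Finset.mem_union_left _ <| Finset.mem_image.2 ⟨(0, d), by simpa using hd, rfl⟩
  have hR : ∀ t, 1 ≤ t → t ≤ 10 → ∀ k < b ^ (m - w 1), slot t k ∈ R := fun t h₁ h₂ k hk =>
    Finset.mem_union_right _ <| Finset.mem_image.2
      ⟨(t, k), by simp [h₁, h₂, hk], rfl⟩
  have hcard : R.card ≤ 20 * b ^ (m - w 1) := by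
    have h₂ : 1 ≤ b ^ (m - w 1) := Nat.one_le_pow _ _ hb.pos
    have h₄ := card_image_slot_le {0} scratchSize
    have h₅ := card_image_slot_le (Finset.Icc 1 10) (b ^ (m - w 1))
    simp only [Finset.card_singleton, scratchSize, Nat.card_Icc] at h₄ h₅
    refine ((Finset.card_union_le _ _).trans (Nat.add_le_add h₄ h₅)).trans ?_
    omega
  -- For Γ ≡ 1 the vector q̄_j is just the sum of the folded vectors over ℓ. This sum is updated by
  -- multiplication with 1 + γ_j ω, so a single vector replaces the whole family.
  let total : Input → ℕ → (ℕ → ℕ) → ℕ → ℝ := fun I j z k => ∑ ℓ ∈ Finset.range j,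
    foldSum b m (withZero w (j - 1)) (w j) (qVec b m w I.om I.Γ I.γ z (j - 1) ℓ) k
  let Inv : Input → ℕ → (ℕ → ℕ) → (ℕ → ℝ) → Prop := fun I j z r =>
    (I.Γ = fun _ => 1) ∧ (1 < j → ∀ k < b ^ (m - w j), r (slot 9 k) = total I j z k)
  let p : ℕ → ℕ → Expr := fun j k => if j = 1 then .const (b ^ w j) else .reg (slot 9 k)
  have hp : ∀ I j z r, 1 ≤ j → Inv I j z r → ∀ k < b ^ (m - w j),
      (p j k).eval I r = total I j z k := by
    intro I j z r hj h k hk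
    simp only [p]
    split_ifs with h₁
    · subst h₁
      simp only [total, Finset.range_one, Finset.sum_singleton]
      rw [foldSum_qVec_zero b m hw]
      simp [Expr.eval]
    · exact h.2 (by omega) k hk
  have hpreads : ∀ j k y, y ∈ (p j k).reads → y = slot 9 k := by
    intro j k y hy
    simp only [p] at hy
    split_ifs at hy with h₁ <;> simp [Expr.reads] at hy
    exact hy
  have hpsize : ∀ j k, (p j k).size = 1 ∧ (p j k).depth = 1 := by
    intro j k
    simp only [p]
    split_ifs <;> exact ⟨rfl, rfl⟩
  have hpR : ∀ j, 1 ≤ j → ∀ k < b ^ (m - w j), (p j k).reads ⊆ R := by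
    intro j hj k hk y hy
    rw [hpreads j k y hy]
    exact hR 9 (by norm_num) (by norm_num) k (hk.trans_le (monotone_pow_sub hb hw le_rfl hj))
  have hmain := exists_prog_of_invariant (s := s) hb hw hR₀
    (fun t h₁ h₂ => hR t h₁ (by omega)) Inv
    (fun I j z r r' h hr => ⟨h.1, fun h₁ k hk => by rw [hr _ _ le_rfl]; exact h.2 h₁ k hk⟩)
    (N := fun j => 2 * b ^ (m - w j)) (N' := fun j => 14 * b ^ (m - w j)) ?_ ?_ ?_
  · obtain ⟨P, hcost, hregs, hP⟩ := hmain
    refine ⟨P, hcost.trans ?_, (Finset.card_le_card hregs).trans hcard,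
      fun I hI => hP I ⟨hI, fun h => by omega⟩⟩
    rw [Finset.mul_sum]
    refine Finset.sum_le_sum fun j hj => ?_
    obtain ⟨h₁, h₂⟩ := Finset.mem_Icc.1 hj
    have h₃ : b ^ (m - w j) ≤ (m - w j) * b ^ (m - w j) :=
      Nat.le_mul_of_pos_left _ (by have := hlt j h₁ h₂; omega)
    calc 2 * b ^ (m - w j) + (48 * b ^ 2 + 24 * b + 39) * ((m - w j) * b ^ (m - w j)) +
        14 * b ^ (m - w j) ≤ 2 * ((m - w j) * b ^ (m - w j)) +
        (48 * b ^ 2 + 24 * b + 39) * ((m - w j) * b ^ (m - w j)) +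
        22 * ((m - w j) * b ^ (m - w j)) := by gcongr; norm_num
      _ = _ := by ring
  · intro j hj hjJ
    have h := isCode_assign (R := R) (l := List.range (b ^ (m - w j))) (t := fun _ => 7)
      (k := fun k => k) (c := 1) (V := {9}) (W := {7}) (e := fun k => p j k) hR₀
      (fun k hk => hR 7 (by norm_num) (by norm_num) _
        ((List.mem_range.1 hk).trans_le (monotone_pow_sub hb hw le_rfl hj)))
      (fun k hk => hpR j hj k (List.mem_range.1 hk))
      (fun k hk y hy => ⟨9, by simp, k, hpreads j k y hy⟩)
      (fun _ _ => by simp) (by simp) (by simp) (by simp) (fun _ _ _ _ _ h => h)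
      (fun k _ => (hpsize j k).1.le)
      (fun k _ => by simp [hpsize, scratchSize])
    refine ⟨_, h.imp (by simp [mul_comm]) (by simp) fun I r r' h z hz k hk => ?_⟩
    rw [h k (List.mem_range.2 hk), hp I j z r hj hz k hk, qBar, ← Finset.Ico_succ_right_eq_Icc,
      Finset.sum_Ico_eq_sum_range]
    simp [total, hz.1]
  · intro j hj hjJ x
    have hnext := hlt (j + 1) (by omega) hjJ
    have hwj : withZero w j = w j := if_neg (by omega)
    have hmono : w j ≤ w (j + 1) := hwj ▸ withZero_le hw j
    have hle : ∀ k < b ^ (m - w j), k < b ^ (m - w 1) := fun k hk =>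
      hk.trans_le (monotone_pow_sub hb hw le_rfl hj)
    have h₁ := isCode_assign (R := R)
      (l := List.range (b ^ (m - w j))) (t := fun _ => 10) (k := fun k => k) (c := 7)
      (V := {9}) (W := {10})
      (e := fun k => .add (p j k) (.mul (.mul (.readProd j) (.omegaVal (k * x % b ^ (m - w j))
          (b ^ (m - w j)))) (p j k))) hR₀
      (fun k hk => hR 10 (by norm_num) le_rfl k (hle k (List.mem_range.1 hk)))
      (fun k hk => by simpa [Expr.reads] using hpR j hj k (List.mem_range.1 hk))
      (fun k hk y hy => ⟨9, by simp, k, hpreads j k y (by simpa [Expr.reads] using hy)⟩)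
      (fun _ _ => by simp) (by simp) (by simp) (by simp) (fun _ _ _ _ _ h => h)
      (fun a _ => by simp [Expr.size, hpsize]) (fun a _ => by simp [Expr.depth, hpsize, scratchSize])
    obtain ⟨l₂, h₂⟩ := isCode_fold (A := {0}) (src := fun _ => 10) (dst := fun _ => 9)
      hb hmono hnext.le hR₀
      (fun _ _ k hk => hR 10 (by norm_num) le_rfl k (hle k hk))
      (fun _ _ k hk => hR 9 (by norm_num) (by norm_num) k (hle k hk))
      (fun _ _ => by omega) (fun _ _ _ _ => by omega) (fun _ h _ h' _ => by
        rw [Finset.mem_singleton.1 h, Finset.mem_singleton.1 h'])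
    refine ⟨_, _, (h₁.append h₂).imp ?_ subset_rfl ?_⟩
    · rw [List.length_range, Finset.card_singleton]
      omega
    · rintro I r r'' ⟨r', hr', hr'', -, -⟩ z hzx hz
      refine ⟨hz.1, fun _ k hk => ?_⟩
      have hadd : ∀ v : ℕ → ℕ → ℝ, ∑ ℓ ∈ Finset.range (j + 1), foldSum b m (w j) (w (j + 1)) (v ℓ) k
          = foldSum b m (w j) (w (j + 1)) (fun k => ∑ ℓ ∈ Finset.range (j + 1), v ℓ k) k := fun v =>
        Finset.sum_comm
      rw [hr'' 0 (by simp) k hk]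
      simp only [total, Nat.add_sub_cancel, hwj]
      rw [hadd]
      refine foldSum_congr_of_lt hmono hnext.le (fun k hk => ?_) hk
      rw [hr' k (List.mem_range.2 hk)]
      simp only [Expr.eval, hp I j z r hj hz k hk, total]
      obtain ⟨j, rfl⟩ : ∃ j', j = j' + 1 := ⟨j - 1, by omega⟩
      -- The recursion closes: in the shifted sum the top term vanishes, and the missing term ℓ = 0
      -- is supplied by q_{j,0}, which equals the folded constant vector.
      rw [Finset.sum_range_succ' _ (j + 1), Nat.add_sub_cancel]
      have hq : ∀ ℓ ∈ Finset.range (j + 1), qVec b m w I.om I.Γ I.γ z (j + 1) (ℓ + 1) k =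
          foldSum b m (withZero w j) (w (j + 1)) (qVec b m w I.om I.Γ I.γ z j (ℓ + 1)) k +
          I.γ (j + 1) * omegaEntry I.om (b ^ (m - w (j + 1))) x k *
            foldSum b m (withZero w j) (w (j + 1)) (qVec b m w I.om I.Γ I.γ z j ℓ) k :=
        fun ℓ hℓ => by
          rw [qVec, if_pos (by simpa [Nat.lt_succ_iff] using hℓ), hz.1, hzx]
          simp
      rw [Finset.sum_congr rfl hq, Finset.sum_add_distrib, ← Finset.mul_sum,
        Finset.sum_range_succ (fun ℓ => foldSum b m (withZero w j) (w (j + 1))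
          (qVec b m w I.om I.Γ I.γ z j (ℓ + 1)) k), foldSum_qVec_eq_zero (Nat.lt_succ_self j)]
      conv_lhs => rw [Finset.sum_range_succ' _ j, foldSum_qVec_zero b m hw]
      rw [Finset.sum_range_succ' (fun ℓ => foldSum b m (withZero w j) (w (j + 1))
        (qVec b m w I.om I.Γ I.γ z j ℓ) k) j, foldSum_qVec_zero b m hw]
      simp only [qVec, omegaEntry]
      ring
  · intro I j z z' r hzz h
    refine ⟨h.1, fun h₁ k hk => ?_⟩
    rw [h.2 h₁ k hk]
    exact Finset.sum_congr rfl fun ℓ _ => foldSum_congr (fun k =>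
      qVec_congr _ _ (fun i h₁ h₂ => hzz i h₁ (by omega)) k) k

/-! ### The vectors of the algorithm in closed form -/

theorem sum_range_mul_eq {E : Type*} [AddCommMonoid E] (a c : ℕ) (f : ℕ → E) :
    ∑ t ∈ Finset.range (a * c), f t =
      ∑ t' ∈ Finset.range a, ∑ t ∈ Finset.range c, f (t' + t * a) := by
  rw [Finset.sum_comm]
  induction c with
  | zero => simp
  | succ c ih =>
    rw [Nat.mul_succ, Finset.sum_range_add, ih, Finset.sum_range_succ]
    congr 1
    exact Finset.sum_congr rfl fun i _ => by congr 1; ring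

theorem omegaEntry_add_mul (om : ℝ → ℝ) (n z k t : ℕ) :
    omegaEntry om n z (k + t * n) = omegaEntry om n z k := by
  have : (k + t * n) * z % n = k * z % n := by
    rw [add_mul, show t * n * z = n * (t * z) by ring, Nat.add_mul_mod_self_left]
  rw [omegaEntry, omegaEntry, this]

/-- Folding in stages amounts to folding once from the full length b^m. -/
theorem foldSum_sum {b m w₁ w₂ : ℕ} (h₁₂ : w₁ ≤ w₂) (h₂ : w₂ ≤ m) (A : ℕ → ℝ) (k : ℕ) :
    foldSum b m w₁ w₂ (fun k => ∑ t ∈ Finset.range (b ^ w₁), A (k + t * b ^ (m - w₁))) k =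
      ∑ t ∈ Finset.range (b ^ w₂), A (k + t * b ^ (m - w₂)) := by
  have h₃ : b ^ w₂ = b ^ (w₂ - w₁) * b ^ w₁ := by
    rw [← pow_add]; congr 1; omega
  have h₄ : b ^ (m - w₁) = b ^ (w₂ - w₁) * b ^ (m - w₂) := by
    rw [← pow_add]; congr 1; omega
  rw [foldSum, h₃, sum_range_mul_eq]
  refine Finset.sum_congr rfl fun t' _ => Finset.sum_congr rfl fun t _ => ?_
  rw [h₄]
  congr 1
  ring

/-- The product of the values `ω(k z_i / b^(m - w_i))`, `i ∈ v`. -/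
noncomputable def omegaProd (b m : ℕ) (w : ℕ → ℕ) (om : ℝ → ℝ) (z : ℕ → ℕ) (v : Finset ℕ)
    (k : ℕ) : ℝ :=
  ∏ i ∈ v, omegaEntry om (b ^ (m - w i)) (z i) k

/-- Up to folding, q_{j,ℓ} collects the weighted products of ω over the ℓ-element subsets of {1, …,
j}. The recursion distinguishes whether a subset contains the new index; the new factor may be
pulled through the fold because it is periodic with the new length, and the quotients of Γ
telescope. -/
theorem qVec_eq_sum {b m : ℕ} {w : ℕ → ℕ} (hw : MonotoneOn w (Set.Ici 1)) {om : ℝ → ℝ}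
    {Γ γ : ℕ → ℝ} (hΓ₀ : Γ 0 = 1) (hΓ : ∀ ℓ, 0 < Γ ℓ) {z : ℕ → ℕ} (j ℓ : ℕ)
    (hj : withZero w j ≤ m) (k : ℕ) :
    qVec b m w om Γ γ z j ℓ k = ∑ t ∈ Finset.range (b ^ withZero w j),
      ∑ v ∈ Finset.powersetCard ℓ (Finset.Icc 1 j), Γ ℓ * (∏ i ∈ v, γ i) *
        omegaProd b m w om z v (k + t * b ^ (m - withZero w j)) := by
  induction j generalizing ℓ k with
  | zero =>
    cases ℓ with
    | zero => simp [qVec, withZero, omegaProd, hΓ₀]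
    | succ ℓ =>
      rw [Finset.powersetCard_eq_empty.2 (by simp)]
      simp [qVec]
  | succ j ih =>
    have hle := withZero_le hw j
    have hwj : withZero w (j + 1) = w (j + 1) := if_neg (by omega)
    rw [hwj] at hj ⊢
    cases ℓ with
    | zero => simp [qVec, omegaProd, hΓ₀]
    | succ ℓ =>
      simp only [qVec]
      split_ifs with hℓ
      · have hfold : ∀ ℓ k, foldSum b m (withZero w j) (w (j + 1)) (qVec b m w om Γ γ z j ℓ) k =
            ∑ t ∈ Finset.range (b ^ w (j + 1)),
            ∑ v ∈ Finset.powersetCard ℓ (Finset.Icc 1 j), Γ ℓ * (∏ i ∈ v, γ i) *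
            omegaProd b m w om z v (k + t * b ^ (m - w (j + 1))) := fun ℓ k => by
          rw [foldSum_congr (ih ℓ (hle.trans hj)), foldSum_sum hle hj (fun k =>
            ∑ v ∈ Finset.powersetCard ℓ (Finset.Icc 1 j), Γ ℓ * (∏ i ∈ v, γ i) *
              omegaProd b m w om z v k)]
        have hnot : j + 1 ∉ Finset.Icc 1 j := by simp
        rw [hfold, hfold, ← Finset.insert_Icc_right_eq_Icc_add_one (by omega),
          Finset.powersetCard_succ_insert hnot]
        simp_rw [Finset.sum_union (Finset.disjoint_left.2 fun v hv hv' => by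
          obtain ⟨u, -, rfl⟩ := Finset.mem_image.1 hv'
          exact hnot ((Finset.mem_powersetCard.1 hv).1 (Finset.mem_insert_self _ _)) :
            Disjoint (Finset.powersetCard (ℓ + 1) (Finset.Icc 1 j))
              ((Finset.powersetCard ℓ (Finset.Icc 1 j)).image (insert (j + 1))))]
        rw [Finset.sum_add_distrib, Finset.mul_sum]
        congr 1
        refine Finset.sum_congr rfl fun t _ => ?_
        have hv : ∀ v ∈ Finset.powersetCard ℓ (Finset.Icc 1 j), j + 1 ∉ v := fun v hv h =>
          hnot ((Finset.mem_powersetCard.1 hv).1 h)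
        rw [Finset.sum_image fun u hu v hv' h => by
          rw [← Finset.erase_insert (hv u hu), h, Finset.erase_insert (hv v hv')], Finset.mul_sum]
        refine Finset.sum_congr rfl fun v hv' => ?_
        simp only [omegaProd]
        rw [Finset.prod_insert (hv v hv'), Finset.prod_insert (hv v hv'), omegaEntry_add_mul]
        have := (hΓ ℓ).ne'
        field_simp
      · rw [Finset.powersetCard_eq_empty.2 (by simp; omega)]
        simp

/-- The vector `T_d` as a sum over the points of the lattice rule. -/
theorem tVec_eq_sum {b m : ℕ} {w : ℕ → ℕ} (hw : MonotoneOn w (Set.Ici 1))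
    {om : ℝ → ℝ} {Γ γ : ℕ → ℝ} (hΓ₀ : Γ 0 = 1) (hΓ : ∀ ℓ, 0 < Γ ℓ) {z : ℕ → ℕ} {d : ℕ}
    (hd : 1 ≤ d) (hdm : w d ≤ m) (x : ℕ) :
    tVec b m w om Γ γ z d x = ∑ k ∈ Finset.range (b ^ m),
      omegaEntry om (b ^ (m - w d)) x k * ∑ v ∈ (Finset.Icc 1 (d - 1)).powerset,
        Γ (v.card + 1) * (∏ i ∈ v, γ i) * omegaProd b m w om z v k := by
  obtain ⟨d, rfl⟩ : ∃ d', d = d' + 1 := ⟨d - 1, by omega⟩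
  have hle := withZero_le hw d
  -- Write the lattice point index as k + t b^(m-w_d). The factor of the component d does not depend
  -- on t, and the sum over t is the fold.
  have hm : b ^ m = b ^ (m - w (d + 1)) * b ^ w (d + 1) := by
    rw [← pow_add, Nat.sub_add_cancel hdm]
  rw [hm, sum_range_mul_eq, tVec]
  refine Finset.sum_congr rfl fun k _ => ?_
  simp_rw [omegaEntry_add_mul]
  rw [← Finset.mul_sum, Nat.add_sub_cancel]
  congr 1
  rw [qBar, ← Finset.Ico_succ_right_eq_Icc, Finset.sum_Ico_eq_sum_range]
  simp only [Nat.add_sub_cancel, Order.succ_eq_add_one, Nat.add_sub_cancel_left]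
  have hq : ∀ ℓ, foldSum b m (withZero w d) (w (d + 1)) (qVec b m w om Γ γ z d ℓ) k =
      ∑ t ∈ Finset.range (b ^ w (d + 1)), ∑ v ∈ Finset.powersetCard ℓ (Finset.Icc 1 d),
        Γ ℓ * (∏ i ∈ v, γ i) * omegaProd b m w om z v (k + t * b ^ (m - w (d + 1))) := fun ℓ => by
    rw [foldSum_congr (qVec_eq_sum hw hΓ₀ hΓ d ℓ (hle.trans hdm)), foldSum_sum hle hdm (fun k =>
      ∑ v ∈ Finset.powersetCard ℓ (Finset.Icc 1 d), Γ ℓ * (∏ i ∈ v, γ i) *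
        omegaProd b m w om z v k)]
  have hsum : ∀ ℓ, Γ (1 + ℓ) / Γ ℓ * foldSum b m (withZero w d) (w (d + 1))
      (qVec b m w om Γ γ z d ℓ) k =
      ∑ t ∈ Finset.range (b ^ w (d + 1)), ∑ v ∈ Finset.powersetCard ℓ (Finset.Icc 1 d),
        Γ (v.card + 1) * (∏ i ∈ v, γ i) * omegaProd b m w om z v
          (k + t * b ^ (m - w (d + 1))) := fun ℓ => by
    rw [hq, Finset.mul_sum]
    refine Finset.sum_congr rfl fun t _ => ?_
    rw [Finset.mul_sum]
    refine Finset.sum_congr rfl fun v hv => ?_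
    rw [(Finset.mem_powersetCard.1 hv).2, add_comm 1]
    have := (hΓ ℓ).ne'
    field_simp
  rw [Finset.sum_congr rfl fun ℓ _ => hsum ℓ, Finset.sum_comm]
  refine Finset.sum_congr rfl fun t _ => ?_
  rw [Finset.sum_powerset, Nat.card_Icc]
  rfl

/-! ### Sums over dual lattices -/

/-- The sequence `|h|^{-p}`, `h ≠ 0`. -/
noncomputable def absPow (p : ℝ) (h : ℤ) : ℝ≥0∞ :=
  if h = 0 then 0 else ENNReal.ofReal (|(h : ℝ)| ^ (-p))

/-- The sum of `|h|^{-p}` over a residue class. -/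
noncomputable def residueSum {N : ℕ} (p : ℝ) (r : ZMod N) : ℝ≥0∞ :=
  ∑' h : ℤ, if (h : ZMod N) = r then absPow p h else 0

/-- The sum of `∏ |h_i|^{-p}` over the dual lattice of a lattice rule, in terms of residues. -/
noncomputable def latticeSum {N : ℕ} [NeZero N] {ι : Type*} [Fintype ι] [DecidableEq ι] (p : ℝ)
    (g : ι → ZMod N) : ℝ≥0∞ :=
  ∑ r : ι → ZMod N, if ∑ i, r i * g i = 0 then ∏ i, residueSum p (r i) else 0

/-- Subadditivity of x ↦ x^λ for 0 < λ ≤ 1, often called Jensen's inequality in this context. -/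
theorem ENNReal_rpow_sum_le {ι : Type*} (s : Finset ι) (f : ι → ℝ≥0∞) {lam : ℝ} (h₀ : 0 < lam)
    (h₁ : lam ≤ 1) : (∑ i ∈ s, f i) ^ lam ≤ ∑ i ∈ s, f i ^ lam := by
  classical
  induction s using Finset.induction_on with
  | empty => simp [h₀]
  | insert a s ha ih =>
    rw [Finset.sum_insert ha, Finset.sum_insert ha]
    exact (ENNReal.rpow_add_le_add_rpow _ _ h₀.le h₁).trans (by gcongr)

theorem ENNReal_rpow_tsum_le {ι : Type*} (f : ι → ℝ≥0∞) {lam : ℝ} (h₀ : 0 < lam)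
    (h₁ : lam ≤ 1) : (∑' i, f i) ^ lam ≤ ∑' i, f i ^ lam := by
  rw [ENNReal.tsum_eq_iSup_sum (f := f), ← ENNReal.orderIsoRpow_apply lam h₀, OrderIso.map_iSup]
  refine iSup_le fun s => ?_
  rw [ENNReal.orderIsoRpow_apply]
  exact (ENNReal_rpow_sum_le s f h₀ h₁).trans (ENNReal.sum_le_tsum s)

theorem absPow_rpow (p : ℝ) {lam : ℝ} (h₀ : 0 < lam) (h : ℤ) :
    absPow p h ^ lam = absPow (p * lam) h := by
  rw [absPow, absPow]
  split_ifs with hh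
  · simp [h₀]
  · have : 0 < |(h : ℝ)| := by positivity
    rw [ENNReal.ofReal_rpow_of_pos (by positivity), ← Real.rpow_mul this.le]
    congr 2
    ring

theorem residueSum_rpow_le {N : ℕ} (p : ℝ) {lam : ℝ} (h₀ : 0 < lam) (h₁ : lam ≤ 1) (r : ZMod N) :
    residueSum p r ^ lam ≤ residueSum (p * lam) r := by
  refine (ENNReal_rpow_tsum_le _ h₀ h₁).trans (ENNReal.tsum_le_tsum fun h => ?_)
  split_ifs
  · exact (absPow_rpow p h₀ h).le
  · simp [h₀]

/-- Subadditivity, applied to the sum over residue vectors and in each residue class, trades the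
power λ for the decay exponent pλ. -/
theorem latticeSum_rpow_le {N : ℕ} [NeZero N] {ι : Type*} [Fintype ι] [DecidableEq ι] (p : ℝ)
    (g : ι → ZMod N) {lam : ℝ} (h₀ : 0 < lam) (h₁ : lam ≤ 1) :
    latticeSum p g ^ lam ≤ latticeSum (p * lam) g := by
  refine (ENNReal_rpow_sum_le _ _ h₀ h₁).trans (Finset.sum_le_sum fun r _ => ?_)
  split_ifs
  · rw [← ENNReal.prod_rpow_of_nonneg h₀.le]
    exact Finset.prod_le_prod' fun i _ => residueSum_rpow_le p h₀ h₁ _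
  · simp [h₀]

theorem sum_residueSum_mul {N : ℕ} [NeZero N] (p : ℝ) (P : ZMod N → Prop) [DecidablePred P] :
    ∑ r : ZMod N, (if P r then residueSum p r else 0) =
      ∑' h : ℤ, if P (h : ZMod N) then absPow p h else 0 := by
  have : ∀ r : ZMod N, (if P r then residueSum p r else 0) =
      ∑' h : ℤ, if (h : ZMod N) = r then (if P (h : ZMod N) then absPow p h else 0) else 0 :=
    fun r => by
      split_ifs with hr
      · exact tsum_congr fun h => by
          split_ifs with h₁ h₂ <;> first | rfl | exact absurd (h₁ ▸ hr) h₂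
      · symm
        refine ENNReal.tsum_eq_zero.2 fun h => ?_
        split_ifs with h₁ h₂
        · exact absurd (h₁ ▸ h₂) hr
        · rfl
        · rfl
  simp_rw [this]
  rw [← Summable.tsum_finsetSum fun _ _ => ENNReal.summable]
  exact tsum_congr fun h => by simp

theorem sum_residueSum {N : ℕ} [NeZero N] (p : ℝ) :
    ∑ r : ZMod N, residueSum p r = ∑' h : ℤ, absPow p h := by
  simpa using sum_residueSum_mul (N := N) p fun _ => True

theorem sum_prod_residueSum {N : ℕ} [NeZero N] {ι : Type*} [Fintype ι] [DecidableEq ι] (p : ℝ) :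
    ∑ r : ι → ZMod N, ∏ i, residueSum p (r i) = (∑' h : ℤ, absPow p h) ^ Fintype.card ι := by
  rw [← sum_residueSum (N := N), ← Finset.card_univ, ← Finset.prod_const, Finset.prod_univ_sum,
    Fintype.piFinset_univ]

theorem latticeSum_le {N : ℕ} [NeZero N] {ι : Type*} [Fintype ι] [DecidableEq ι] (p : ℝ)
    (g : ι → ZMod N) : latticeSum p g ≤ (∑' h : ℤ, absPow p h) ^ Fintype.card ι := by
  rw [← sum_prod_residueSum (N := N)]
  refine Finset.sum_le_sum fun r _ => ?_
  split_ifs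
  exacts [le_rfl, zero_le]

/-- The dependence of a lattice sum on one component of the generating vector. -/
theorem latticeSum_eq_split {N : ℕ} [NeZero N] {ι : Type*} [Fintype ι] [DecidableEq ι] (p : ℝ)
    (g : ι → ZMod N) (i₀ : ι) :
    latticeSum p g = ∑ r : {i // i ≠ i₀} → ZMod N, (∏ i, residueSum p (r i)) *
      ∑' h : ℤ, if (h : ZMod N) * g i₀ + ∑ i, r i * g i = 0 then absPow p h else 0 := by
  rw [latticeSum, ← (Equiv.funSplitAt i₀ (ZMod N)).symm.sum_comp, Fintype.sum_prod_type,
    Finset.sum_comm]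
  refine Finset.sum_congr rfl fun r _ => ?_
  rw [← sum_residueSum_mul p fun ρ : ZMod N => ρ * g i₀ + ∑ i, r i * g i = 0, Finset.mul_sum]
  refine Finset.sum_congr rfl fun ρ _ => ?_
  have hne : ∀ i : {i // i ≠ i₀}, (Equiv.funSplitAt i₀ (ZMod N)).symm (ρ, r) i = r i := fun i => by
    simp [Equiv.funSplitAt, Equiv.piSplitAt, i.2]
  have heq : (Equiv.funSplitAt i₀ (ZMod N)).symm (ρ, r) i₀ = ρ := by
    simp [Equiv.funSplitAt, Equiv.piSplitAt]
  rw [Fintype.sum_eq_add_sum_subtype_ne _ i₀, Fintype.prod_eq_mul_prod_subtype_ne _ i₀]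
  simp only [hne, heq]
  split_ifs
  · exact mul_comm _ _
  · simp

/-! ### The sum of `|h|^{-p}` -/

theorem summable_absPow {p : ℝ} (hp : 1 < p) :
    Summable fun h : ℤ => if h = 0 then 0 else |(h : ℝ)| ^ (-p) := by
  refine (Real.summable_abs_int_rpow hp).congr_cofinite ?_
  rw [Filter.EventuallyEq, Filter.eventually_cofinite]
  refine (Set.finite_singleton (0 : ℤ)).subset fun h hh => ?_
  by_contra h0
  simp_all

theorem absPow_eq_ofReal (p : ℝ) (h : ℤ) :
    absPow p h = ENNReal.ofReal (if h = 0 then 0 else |(h : ℝ)| ^ (-p)) := by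
  rw [absPow]
  split_ifs <;> simp

/-- Positive and negative integers each contribute ζ(p). This is the source of 2ζ(2λ) in ϱ(λ). -/
theorem tsum_absPow {p : ℝ} (hp : 1 < p) :
    ∑' h : ℤ, absPow p h = ENNReal.ofReal (2 * (riemannZeta (p : ℂ)).re) := by
  simp_rw [absPow_eq_ofReal]
  rw [← ENNReal.ofReal_tsum_of_nonneg (fun h => by split_ifs <;> positivity) (summable_absPow hp)]
  congr 1
  have hz : riemannZeta (p : ℂ) = ((∑' n : ℕ, ((n : ℝ) + 1) ^ (-p) : ℝ) : ℂ) := by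
    rw [zeta_eq_tsum_one_div_nat_add_one_cpow (by simpa using hp), Complex.ofReal_tsum]
    refine tsum_congr fun n => ?_
    rw [Complex.ofReal_cpow (by positivity)]
    push_cast
    rw [Complex.cpow_neg, one_div]
  rw [hz, Complex.ofReal_re]
  have hs : Summable fun n : ℕ => ((n : ℝ) + 1) ^ (-p) := by
    have := (summable_nat_add_iff 1).2 (Real.summable_nat_rpow (p := -p) |>.2 (by linarith))
    simpa using this
  have hpos : ∀ n : ℕ, (if ((n : ℤ) + 1) = 0 then 0 else |(((n : ℤ) + 1 : ℤ) : ℝ)| ^ (-p)) =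
      ((n : ℝ) + 1) ^ (-p) := fun n => by
    rw [if_neg (by omega)]
    push_cast
    rw [abs_of_pos (by positivity)]
  have hneg : ∀ n : ℕ, (if (-((n : ℤ) + 1)) = 0 then 0 else |((-((n : ℤ) + 1) : ℤ) : ℝ)| ^ (-p)) =
      ((n : ℝ) + 1) ^ (-p) := fun n => by
    rw [if_neg (by omega)]
    push_cast
    rw [abs_neg, abs_of_pos (by positivity)]
  rw [tsum_of_add_one_of_neg_add_one (by simpa only [hpos] using hs) (by simpa only [hneg] using hs)]
  simp only [hpos, hneg]
  simp
  ring

theorem tsum_absPow_lt_top {p : ℝ} (hp : 1 < p) : ∑' h : ℤ, absPow p h < ⊤ := by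
  rw [tsum_absPow hp]
  exact ENNReal.ofReal_lt_top

/-- The sum over the multiples of a number. -/
theorem tsum_absPow_dvd_le {p : ℝ} (hp : 1 ≤ p) {n : ℕ} (hn : 0 < n) :
    ∑' h : ℤ, (if (n : ℤ) ∣ h then absPow p h else 0) ≤
      (n : ℝ≥0∞)⁻¹ * ∑' h : ℤ, absPow p h := by
  have hinj : Function.Injective fun h : ℤ => (n : ℤ) * h := fun a b hab =>
    mul_left_cancel₀ (Int.natCast_ne_zero.2 hn.ne') hab
  rw [← hinj.tsum_eq (f := fun h : ℤ => if (n : ℤ) ∣ h then absPow p h else 0), ← ENNReal.tsum_mul_left]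
  · refine ENNReal.tsum_le_tsum fun h => ?_
    rw [if_pos (dvd_mul_right _ _), absPow, absPow]
    have hnz : (n : ℤ) ≠ 0 := Int.natCast_ne_zero.2 hn.ne'
    by_cases h0 : h = 0
    · simp [h0]
    · rw [if_neg (mul_ne_zero hnz h0), if_neg h0]
      have hn' : (0 : ℝ) < n := Nat.cast_pos.2 hn
      rw [← ENNReal.ofReal_natCast, ← ENNReal.ofReal_inv_of_pos hn', ← ENNReal.ofReal_mul (by positivity)]
      refine ENNReal.ofReal_le_ofReal ?_
      push_cast
      rw [abs_mul, Real.mul_rpow (abs_nonneg _) (abs_nonneg _), Nat.abs_cast]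
      refine mul_le_mul_of_nonneg_right ?_ (by positivity)
      rw [← Real.rpow_neg_one]
      exact Real.rpow_le_rpow_of_exponent_le (Nat.one_le_cast.2 hn) (by linarith)
  · intro h hh
    simp only [Function.mem_support, ne_eq, ite_eq_right_iff, Classical.not_imp] at hh
    obtain ⟨c, rfl⟩ := hh.1
    exact ⟨c, rfl⟩

/-! ### The average over the units -/

/-- For a unit `x` chosen at random, the expected sum of `|h|^{-p}` over the solutions of
`h b^w x + c = 0` modulo `b^m` is at most `2 / b^(m - w)` times the whole sum. -/
theorem sum_units_tsum_le {b m w : ℕ} (hb : b.Prime) (hw : w < m) {p : ℝ} (hp : 1 ≤ p)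
    (c : ZMod (b ^ m)) :
    ∑ x ∈ unitsMod (b ^ (m - w)), ∑' h : ℤ,
        (if (h : ZMod (b ^ m)) * ((b ^ w * x : ℕ) : ZMod (b ^ m)) + c = 0 then absPow p h else 0) ≤
      (unitsMod (b ^ (m - w))).card * ((2 : ℝ≥0∞) * ((b ^ (m - w) : ℕ) : ℝ≥0∞)⁻¹ *
        ∑' h : ℤ, absPow p h) := by
  classical
  have : NeZero b := ⟨hb.ne_zero⟩
  set n := b ^ (m - w) with hn
  have hn0 : 0 < n := pow_pos hb.pos _
  set U := unitsMod n with hU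
  -- Without a solution the left side is 0. With one, the inhomogeneous condition becomes hx ≡ h₀x₀
  -- modulo n = b^(m-w).
  by_cases hsol : ∃ (h₀ : ℤ) (x₀ : ℕ), x₀ ∈ U ∧
      (h₀ : ZMod (b ^ m)) * ((b ^ w * x₀ : ℕ) : ZMod (b ^ m)) + c = 0
  swap
  · push Not at hsol
    refine le_of_eq_of_le (Finset.sum_eq_zero fun x hx => ENNReal.tsum_eq_zero.2 fun h => ?_) zero_le
    rw [if_neg (hsol h x hx)]
  obtain ⟨h₀, x₀, hx₀, hsol⟩ := hsol
  have hmul : b ^ m = b ^ w * n := by rw [hn, ← pow_add, Nat.add_sub_cancel' hw.le]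
  have hiff : ∀ (h : ℤ) (x : ℕ), (h : ZMod (b ^ m)) * ((b ^ w * x : ℕ) : ZMod (b ^ m)) + c = 0 ↔
      (n : ℤ) ∣ h * x - h₀ * x₀ := fun h x => by
    rw [← hsol, ← sub_eq_zero, add_sub_add_right_eq_sub]
    have : (h : ZMod (b ^ m)) * ((b ^ w * x : ℕ) : ZMod (b ^ m)) -
        (h₀ : ZMod (b ^ m)) * ((b ^ w * x₀ : ℕ) : ZMod (b ^ m)) =
        (((b : ℤ) ^ w * (h * x - h₀ * x₀) : ℤ) : ZMod (b ^ m)) := by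
      push_cast
      ring
    rw [this, ZMod.intCast_zmod_eq_zero_iff_dvd, hmul]
    push_cast
    exact mul_dvd_mul_iff_left (pow_ne_zero _ (Nat.cast_ne_zero.2 hb.ne_zero))
  set d := Int.gcd h₀ n with hd
  have hdn : d ∣ n := by
    have : (d : ℤ) ∣ (n : ℤ) := Int.gcd_dvd_right _ _
    exact_mod_cast this
  have hd0 : 0 < d := Nat.pos_of_dvd_of_pos hdn hn0
  -- Multiplication by a unit does not change the gcd with n, so all frequencies h that occur have
  -- the same gcd d with n.
  have hgcd : ∀ (h : ℤ), ∀ x ∈ U, (n : ℤ) ∣ h * x - h₀ * x₀ → Int.gcd h n = d := by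
    intro h x hx hdvd
    have hcop : ∀ (a : ℤ), ∀ y ∈ U, Int.gcd (a * y) n = Int.gcd a n := fun a y hy =>
      Int.gcd_mul_left_left_of_gcd_eq_one (by
        rw [Int.gcd_natCast_natCast]; exact (mem_unitsMod.1 hy).2)
    rw [← hcop h x hx, hd, ← hcop h₀ x₀ hx₀]
    obtain ⟨k, hk⟩ := hdvd
    rw [show h * x = h₀ * x₀ + n * k by linarith, Int.gcd_add_mul_left_left]
  -- For such an h the solutions x agree modulo e = n/d, so at most d of them are below n.
  have hcount : ∀ h : ℤ, ((U.filter fun x : ℕ => (n : ℤ) ∣ h * x - h₀ * x₀).card : ℝ≥0∞) ≤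
      if (d : ℤ) ∣ h then (d : ℝ≥0∞) else 0 := by
    intro h
    rcases (U.filter fun x : ℕ => (n : ℤ) ∣ h * x - h₀ * x₀).eq_empty_or_nonempty with hemp | ⟨x₁, hx₁⟩
    · rw [hemp]; simp
    rw [Finset.mem_filter] at hx₁
    have hdh := hgcd h x₁ hx₁.1 hx₁.2
    rw [if_pos (hdh ▸ Int.gcd_dvd_left _ _)]
    obtain ⟨e, he⟩ := hdn
    have he0 : 0 < e := Nat.pos_of_ne_zero fun h0 => by simp [h0] at he; omega
    have hsub : (U.filter fun x : ℕ => (n : ℤ) ∣ h * x - h₀ * x₀) ⊆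
        (Finset.range n).filter fun x => x ≡ x₁ [MOD e] := by
      intro x hx
      rw [Finset.mem_filter] at hx ⊢
      refine ⟨Finset.mem_range.2 (mem_unitsMod.1 hx.1).1, ?_⟩
      have h₁ : (n : ℤ) ∣ h * (x₁ - x) := by
        have := dvd_sub hx₁.2 hx.2
        rwa [show h * x₁ - h₀ * x₀ - (h * x - h₀ * x₀) = h * ((x₁ : ℤ) - x) by ring] at this
      obtain ⟨h', hh'⟩ : (d : ℤ) ∣ h := hdh ▸ Int.gcd_dvd_left _ _
      have hcop : Int.gcd h' e = 1 := by
        have := hdh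
        rw [hh', he, Nat.cast_mul, Int.gcd_mul_left, Int.natAbs_natCast] at this
        exact Nat.eq_of_mul_eq_mul_left hd0 (by linarith)
      rw [hh', he, Nat.cast_mul, mul_assoc] at h₁
      have h₂ := (mul_dvd_mul_iff_left (by exact_mod_cast hd0.ne')).1 h₁
      exact (Int.natCast_modEq_iff).1 ((Int.modEq_iff_dvd).2
        (Int.dvd_of_dvd_mul_right_of_gcd_one h₂ (by rwa [Int.gcd_comm])))
    refine (Nat.cast_le.2 (Finset.card_le_card hsub)).trans (Nat.cast_le.2 ?_)
    rw [← Nat.count_eq_card_filter_range, Nat.count_modEq_card _ he0, he, Nat.mul_div_cancel _ he0,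
      Nat.mul_mod_left, if_neg (by omega)]
    rfl
  simp_rw [hiff]
  rw [← Summable.tsum_finsetSum fun _ _ => ENNReal.summable]
  -- For a power of a prime b ≥ 2 at least half of the residues are units. This is the origin of the
  -- constant 2 in the error bound.
  have hphi : (n : ℝ≥0∞) ≤ 2 * U.card := by
    have hcard : U.card = n.totient := by
      rw [hU, unitsMod, Nat.totient_eq_card_coprime]
      congr 1
      ext x
      simp [Nat.coprime_comm, Nat.Coprime]
    rw [hcard]
    have : n ≤ 2 * n.totient := by
      rw [hn, Nat.totient_prime_pow hb (by omega)]
      have hb2 := hb.two_le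
      obtain ⟨k, hk⟩ : ∃ k, m - w = k + 1 := ⟨m - w - 1, by omega⟩
      rw [hk, Nat.add_sub_cancel, pow_succ]
      calc b ^ k * b ≤ b ^ k * (2 * (b - 1)) := by gcongr; omega
        _ = _ := by ring
    exact_mod_cast this
  have hn0' : (n : ℝ≥0∞) ≠ 0 := by exact_mod_cast hn0.ne'
  -- The d solutions per frequency are compensated by the factor 1/d that is gained from summing
  -- only over multiples of d.
  calc ∑' h : ℤ, ∑ x ∈ U, (if (n : ℤ) ∣ h * x - h₀ * x₀ then absPow p h else 0)
      ≤ ∑' h : ℤ, (d : ℝ≥0∞) * (if (d : ℤ) ∣ h then absPow p h else 0) := by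
        refine ENNReal.tsum_le_tsum fun h => ?_
        rw [← Finset.sum_filter, Finset.sum_const, nsmul_eq_mul]
        refine (mul_le_mul_left (hcount h) _).trans ?_
        split_ifs <;> simp
    _ ≤ d * ((d : ℝ≥0∞)⁻¹ * ∑' h : ℤ, absPow p h) := by
        rw [ENNReal.tsum_mul_left]
        gcongr
        exact tsum_absPow_dvd_le hp hd0
    _ = ∑' h : ℤ, absPow p h := by
        rw [← mul_assoc, ENNReal.mul_inv_cancel (by exact_mod_cast hd0.ne')
          (ENNReal.natCast_ne_top _), one_mul]
    _ = n * (n : ℝ≥0∞)⁻¹ * ∑' h : ℤ, absPow p h := by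
        rw [ENNReal.mul_inv_cancel hn0' (ENNReal.natCast_ne_top _), one_mul]
    _ ≤ (2 * U.card) * (n : ℝ≥0∞)⁻¹ * ∑' h : ℤ, absPow p h := by gcongr
    _ = _ := by ring

/-! ### Finite Fourier expansion of ω on a grid, and lattice rules applied to products of ω. -/

theorem residueSum_lt_top {N : ℕ} {p : ℝ} (hp : 1 < p) (r : ZMod N) : residueSum p r < ⊤ := by
  refine (ENNReal.tsum_le_tsum fun h => ?_).trans_lt (tsum_absPow_lt_top hp)
  split_ifs
  exacts [le_rfl, zero_le]

theorem absPow_ne_top (p : ℝ) (h : ℤ) : absPow p h ≠ ⊤ := by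
  rw [absPow_eq_ofReal]
  exact ENNReal.ofReal_ne_top

theorem toReal_absPow (p : ℝ) (h : ℤ) :
    (absPow p h).toReal = if h = 0 then 0 else |(h : ℝ)| ^ (-p) := by
  rw [absPow_eq_ofReal, ENNReal.toReal_ofReal (by split_ifs <;> positivity)]

theorem latticeSum_lt_top {N : ℕ} [NeZero N] {ι : Type*} [Fintype ι] [DecidableEq ι] {p : ℝ}
    (hp : 1 < p) (g : ι → ZMod N) : latticeSum p g < ⊤ :=
  (latticeSum_le p g).trans_lt (ENNReal.pow_lt_top (tsum_absPow_lt_top hp))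

/-- The values of `ω` at the points of a regular grid, as a finite Fourier sum. -/
theorem korobovOmega_two_eq {N : ℕ} [NeZero N] (a : ZMod N) :
    ((korobovOmega 2 ((a.val : ℝ) / (N : ℝ)) : ℝ) : ℂ) =
      ∑ r : ZMod N, ((residueSum 2 r).toReal : ℂ) * ZMod.stdAddChar (r * a) := by
  set f : ℤ → ℂ := fun h => ((absPow 2 h).toReal : ℂ) * ZMod.stdAddChar ((h : ZMod N) * a) with hf
  have hnorm : ∀ h, ‖f h‖ ≤ (absPow 2 h).toReal := fun h => by
    rw [hf, norm_mul, AddChar.norm_apply, mul_one, Complex.norm_real, Real.norm_eq_abs,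
      abs_of_nonneg ENNReal.toReal_nonneg]
  have hs' : Summable fun h : ℤ => (absPow 2 h).toReal := by
    simp_rw [toReal_absPow]
    exact summable_absPow one_lt_two
  have hs : Summable f := Summable.of_norm_bounded hs' hnorm
  have hsum : (∑' h : {h : ℤ // h ≠ 0},
      Complex.exp (2 * Real.pi * Complex.I * ((h : ℤ) : ℂ) * (((a.val : ℝ) / (N : ℝ) : ℝ) : ℂ)) /
      ((|((h : ℤ) : ℝ)| ^ (2 : ℝ) : ℝ) : ℂ)) = ∑' h, f h := by
    rw [← tsum_subtype_eq_of_support_subset (s := {h : ℤ | h ≠ 0}) (f := f)]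
    · refine tsum_congr fun ⟨h, hh⟩ => ?_
      have hh' : h ≠ 0 := hh
      have hψ : ZMod.stdAddChar ((h : ZMod N) * a) =
          Complex.exp (2 * Real.pi * Complex.I * (h : ℂ) * (((a.val : ℝ) / (N : ℝ) : ℝ) : ℂ)) := by
        have : (h : ZMod N) * a = ((h * a.val : ℤ) : ZMod N) := by simp
        rw [this, ZMod.stdAddChar_coe]
        congr 1
        push_cast
        ring
      simp only [hf, toReal_absPow, if_neg hh', hψ]
      rw [Real.rpow_neg (abs_nonneg _), div_eq_inv_mul]
      push_cast
      rfl
    · intro h hh h0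
      refine hh ?_
      simp [hf, h0, absPow]
  -- Conjugation amounts to replacing h by -h, so the sum is real and taking the real part loses
  -- nothing.
  have hreal : ((∑' h, f h).re : ℂ) = ∑' h, f h := by
    rw [← Complex.conj_eq_iff_re, Complex.conj_tsum, ← (Equiv.neg ℤ).tsum_eq]
    refine tsum_congr fun h => ?_
    simp only [hf, map_mul, Complex.conj_ofReal, Equiv.neg_apply, ← AddChar.map_neg_eq_conj]
    congr 2
    · simp [toReal_absPow]
    · push_cast; ring
  rw [korobovOmega, hsum, hreal]
  have hsplit : ∀ h, f h = ∑ r : ZMod N, if (h : ZMod N) = r then f h else 0 := fun h => by simp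
  rw [tsum_congr hsplit, Summable.tsum_finsetSum fun r _ => Summable.of_norm_bounded hs.norm
    fun h => by split_ifs <;> simp]
  refine Finset.sum_congr rfl fun r _ => ?_
  have hres : (residueSum 2 r).toReal =
      ∑' h : ℤ, (if (h : ZMod N) = r then absPow 2 h else 0).toReal := by
    rw [residueSum, ENNReal.tsum_toReal_eq]
    intro h
    split_ifs
    exacts [absPow_ne_top 2 h, ENNReal.zero_ne_top]
  rw [hres, Complex.ofReal_tsum, ← tsum_mul_right]
  refine tsum_congr fun h => ?_
  split_ifs with hr
  · rw [← hr]
  · simp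

theorem addChar_map_sum {A M ι : Type*} [AddCommMonoid A] [CommMonoid M] (ψ : AddChar A M)
    (s : Finset ι) (f : ι → A) : ψ (∑ i ∈ s, f i) = ∏ i ∈ s, ψ (f i) := by
  classical
  induction s using Finset.induction_on with
  | empty => simp
  | insert a s ha ih => rw [Finset.sum_insert ha, Finset.prod_insert ha, ψ.map_add_eq_mul, ih]

/-- The error of a lattice rule for products of `ω`, as a sum over the dual lattice. -/
theorem sum_prod_korobovOmega {N : ℕ} [NeZero N] {ι : Type*} [Fintype ι] [DecidableEq ι]
    (g : ι → ZMod N) :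
    (1 / (N : ℝ)) * ∑ k ∈ Finset.range N,
        ∏ i, korobovOmega 2 ((((k : ZMod N) * g i).val : ℝ) / (N : ℝ)) =
      (latticeSum 2 g).toReal := by
  have hN : (N : ℂ) ≠ 0 := Nat.cast_ne_zero.2 (NeZero.ne N)
  rw [← Complex.ofReal_inj]
  have hsum : ∀ F : ZMod N → ℂ, ∑ k ∈ Finset.range N, F (k : ZMod N) = ∑ k : ZMod N, F k :=
    fun F => by
      refine Finset.sum_bij (fun k _ => (k : ZMod N)) (fun _ _ => Finset.mem_univ _)
        (fun k hk k' hk' h => ?_) (fun k _ => ⟨k.val, Finset.mem_range.2 (ZMod.val_lt k), by simp⟩)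
        fun _ _ => rfl
      rw [ZMod.natCast_eq_natCast_iff'] at h
      rwa [Nat.mod_eq_of_lt (Finset.mem_range.1 hk), Nat.mod_eq_of_lt (Finset.mem_range.1 hk')] at h
  push_cast
  simp_rw [korobovOmega_two_eq]
  rw [hsum fun k => ∏ i, ∑ r : ZMod N, ((residueSum 2 r).toReal : ℂ) *
    ZMod.stdAddChar (r * (k * g i))]
  simp_rw [Finset.prod_univ_sum, Fintype.piFinset_univ]
  rw [Finset.sum_comm, latticeSum, ENNReal.toReal_sum, Complex.ofReal_sum, Finset.mul_sum]
  · refine Finset.sum_congr rfl fun r _ => ?_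
    have hprod : ∀ k : ZMod N, ∏ i, ((residueSum 2 (r i)).toReal : ℂ) *
        ZMod.stdAddChar (r i * (k * g i)) = (∏ i, ((residueSum 2 (r i)).toReal : ℂ)) *
        ZMod.stdAddChar (k * ∑ i, r i * g i) := fun k => by
      rw [Finset.prod_mul_distrib, Finset.mul_sum, addChar_map_sum]
      congr 1
      exact Finset.prod_congr rfl fun i _ => by congr 1; ring
    simp_rw [hprod]
    rw [← Finset.mul_sum, AddChar.sum_mulShift _ (ZMod.isPrimitive_stdAddChar N), ZMod.card]
    split_ifs
    · rw [ENNReal.toReal_prod]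
      push_cast
      field_simp
    · simp
  · intro r _
    split_ifs
    · exact ENNReal.prod_ne_top fun i _ => (residueSum_lt_top one_lt_two _).ne
    · exact ENNReal.zero_ne_top

/-- A finite set of vectors lies in the product box of its coordinate projections, and a sum over a
box factors. -/
theorem tsum_prod_le {ι : Type*} [Fintype ι] [DecidableEq ι] {κ : Type*} (a : ι → κ → ℝ≥0∞) :
    ∑' h : ι → κ, ∏ i, a i (h i) ≤ ∏ i, ∑' k, a i k := by
  classical
  rw [ENNReal.tsum_eq_iSup_sum]
  refine iSup_le fun S => ?_
  calc ∑ h ∈ S, ∏ i, a i (h i)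
      ≤ ∑ h ∈ Fintype.piFinset fun i => S.image fun h => h i, ∏ i, a i (h i) :=
        Finset.sum_le_sum_of_subset fun h hh => Fintype.mem_piFinset.2 fun i =>
          Finset.mem_image_of_mem _ hh
    _ = ∏ i, ∑ k ∈ S.image fun h => h i, a i k := (Finset.prod_univ_sum _ _).symm
    _ ≤ _ := Finset.prod_le_prod' fun i _ => ENNReal.sum_le_tsum _

theorem tsum_dual_le_latticeSum {N : ℕ} [NeZero N] {ι : Type*} [Fintype ι] [DecidableEq ι] (p : ℝ)
    (g : ι → ZMod N) :
    ∑' h : ι → ℤ, (if ∑ i, (h i : ZMod N) * g i = 0 then ∏ i, absPow p (h i) else 0) ≤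
      latticeSum p g := by
  have hsplit : ∀ h : ι → ℤ,
      (if ∑ i, (h i : ZMod N) * g i = 0 then ∏ i, absPow p (h i) else 0) =
      ∑ r : ι → ZMod N, if ∑ i, r i * g i = 0 then
        ∏ i, (if (h i : ZMod N) = r i then absPow p (h i) else 0) else 0 := fun h => by
    rw [Finset.sum_eq_single fun i => (h i : ZMod N)]
    · simp
    · intro r _ hr
      obtain ⟨i, hi⟩ := Function.ne_iff.1 hr
      split_ifs
      · exact Finset.prod_eq_zero (Finset.mem_univ i) (if_neg fun h => hi h.symm)
      · rfl
    · simp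
  simp_rw [hsplit]
  rw [Summable.tsum_finsetSum fun _ _ => ENNReal.summable]
  refine Finset.sum_le_sum fun r _ => ?_
  split_ifs
  · exact tsum_prod_le fun i (h : ℤ) => if (h : ZMod N) = r i then absPow p h else 0
  · simp

/-! ### The error bound for the construction -/

/-- The lattice sum for the coordinates in `u` and the generating vector `(b^{w_i} z_i)`. -/
noncomputable def dualSum (b m : ℕ) [NeZero b] (w : ℕ → ℕ) (p : ℝ) (z : ℕ → ℕ) (u : Finset ℕ) :
    ℝ≥0∞ :=
  latticeSum p fun i : u => ((b ^ w i * z i : ℕ) : ZMod (b ^ m))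

/-- The POD weight of a set of indices. -/
noncomputable def setWeight (Γ γ : ℕ → ℝ) (u : Finset ℕ) : ℝ≥0∞ :=
  ENNReal.ofReal (Γ u.card * ∏ i ∈ u, γ i)

/-- The points kx/b^(m-w) and k b^w x/b^m agree modulo 1. For w ≥ m both sides are ω(0), which
matches the convention z_j = 0 for such components. -/
theorem omegaEntry_eq {b m : ℕ} [NeZero b] (om : ℝ → ℝ) (w x k : ℕ) :
    omegaEntry om (b ^ (m - w)) x k =
      om ((((k : ZMod (b ^ m)) * ((b ^ w * x : ℕ) : ZMod (b ^ m))).val : ℝ) /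
        ((b ^ m : ℕ) : ℝ)) := by
  have hb0 : (b : ℝ) ≠ 0 := NeZero.ne _
  have hcast : (k : ZMod (b ^ m)) * ((b ^ w * x : ℕ) : ZMod (b ^ m)) =
      ((b ^ w * (k * x) : ℕ) : ZMod (b ^ m)) := by push_cast; ring
  rw [omegaEntry, hcast, ZMod.val_natCast]
  congr 1
  rcases le_total w m with hwm | hwm
  · have hm : b ^ m = b ^ w * b ^ (m - w) := by rw [← pow_add, Nat.add_sub_cancel' hwm]
    rw [hm, Nat.mul_mod_mul_left]
    push_cast
    rw [mul_div_mul_left _ _ (pow_ne_zero _ hb0)]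
  · have h₁ : b ^ w * (k * x) % b ^ m = 0 :=
      Nat.mod_eq_zero_of_dvd ((pow_dvd_pow b hwm).trans (dvd_mul_right _ _))
    rw [h₁, Nat.sub_eq_zero_of_le hwm, pow_zero, Nat.mod_one]
    simp

theorem sum_omegaProd {b m : ℕ} [NeZero b] (w : ℕ → ℕ) (z : ℕ → ℕ) (u : Finset ℕ) :
    (1 / ((b ^ m : ℕ) : ℝ)) * ∑ k ∈ Finset.range (b ^ m),
      omegaProd b m w (korobovOmega 2) z u k = (dualSum b m w 2 z u).toReal := by
  rw [dualSum, ← sum_prod_korobovOmega]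
  congr 1
  refine Finset.sum_congr rfl fun k _ => ?_
  rw [omegaProd, ← Finset.prod_coe_sort]
  exact Finset.prod_congr rfl fun i _ => omegaEntry_eq _ _ _ _

/-- With the residues of the other coordinates fixed, the dual condition is one inhomogeneous
congruence in the new component, so the average over the units applies term by term. -/
theorem sum_units_dualSum_le {b m : ℕ} [NeZero b] (hb : b.Prime) {w : ℕ → ℕ} {p : ℝ} (hp : 1 ≤ p)
    (z : ℕ → ℕ) {d : ℕ} {v : Finset ℕ} (hd : d ∉ v) (hdm : w d < m) :
    ∑ x ∈ unitsMod (b ^ (m - w d)), dualSum b m w p (Function.update z d x) (insert d v) ≤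
      (unitsMod (b ^ (m - w d))).card * ((2 : ℝ≥0∞) * ((b ^ (m - w d) : ℕ) : ℝ≥0∞)⁻¹ *
        (∑' h : ℤ, absPow p h) ^ (insert d v).card) := by
  let i₀ : (insert d v : Finset ℕ) := ⟨d, Finset.mem_insert_self d v⟩
  have hne : ∀ (i : {i : (insert d v : Finset ℕ) // i ≠ i₀}) (x : ℕ),
      Function.update z d x i = z i := fun i x => Function.update_of_ne (fun h => i.2 (Subtype.ext h)) _ _
  have hsplit : ∀ x, dualSum b m w p (Function.update z d x) (insert d v) =
      ∑ r : {i : (insert d v : Finset ℕ) // i ≠ i₀} → ZMod (b ^ m), (∏ i, residueSum p (r i)) *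
      ∑' h : ℤ, if (h : ZMod (b ^ m)) * ((b ^ w d * x : ℕ) : ZMod (b ^ m)) +
        ∑ i, r i * ((b ^ w i * z i : ℕ) : ZMod (b ^ m)) = 0 then absPow p h else 0 := fun x => by
    rw [dualSum, latticeSum_eq_split p _ i₀]
    simp only [hne]
    simp [i₀]
  simp_rw [hsplit]
  rw [Finset.sum_comm]
  simp_rw [← Finset.mul_sum]
  calc _ ≤ ∑ r : {i : (insert d v : Finset ℕ) // i ≠ i₀} → ZMod (b ^ m),
        (∏ i, residueSum p (r i)) * ((unitsMod (b ^ (m - w d))).card * ((2 : ℝ≥0∞) *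
          ((b ^ (m - w d) : ℕ) : ℝ≥0∞)⁻¹ * ∑' h : ℤ, absPow p h)) :=
        Finset.sum_le_sum fun r _ => mul_le_mul_right (sum_units_tsum_le hb hdm hp _) _
    _ = _ := by
        have hcard : (insert d v).card = Fintype.card {i : (insert d v : Finset ℕ) // i ≠ i₀} + 1 := by
          rw [Fintype.card_subtype_compl, Fintype.card_coe, Fintype.card_subtype_eq,
            Finset.card_insert_of_notMem hd, Nat.add_sub_cancel]
        rw [← Finset.sum_mul, sum_prod_residueSum, hcard, pow_succ]
        ring

/-- The contribution of the `d`-th component to the squared error. -/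
theorem rpow_sum_dualSum_le {b m s : ℕ} [NeZero b] (hb : b.Prime) {w : ℕ → ℕ}
    (hw : MonotoneOn w (Set.Ici 1)) {Γ γ : ℕ → ℝ} (hΓ₀ : Γ 0 = 1) (hΓ : ∀ ℓ, 0 < Γ ℓ)
    (hγ : ∀ j, 0 ≤ γ j) {z : ℕ → ℕ} (hz : IsFastRedCBC b m s w (korobovOmega 2) Γ γ z)
    {lam : ℝ} (h₀ : 1 / 2 < lam) (h₁ : lam ≤ 1) {d : ℕ} (hd : 1 ≤ d) (hds : d ≤ s) :
    (∑ v ∈ (Finset.Icc 1 (d - 1)).powerset,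
        setWeight Γ γ (insert d v) * dualSum b m w 2 z (insert d v)) ^ lam ≤
      ∑ v ∈ (Finset.Icc 1 (d - 1)).powerset, setWeight Γ γ (insert d v) ^ lam *
        (((b ^ min m (w d) : ℕ) : ℝ≥0∞) * (2 * ((b ^ m : ℕ) : ℝ≥0∞)⁻¹) *
          (∑' h : ℤ, absPow (2 * lam) h) ^ (insert d v).card) := by
  have hlam : 0 < lam := by linarith
  have hnot : ∀ v ∈ (Finset.Icc 1 (d - 1)).powerset, d ∉ v := fun v hv hdv => by
    have := Finset.mem_Icc.1 (Finset.mem_powerset.1 hv hdv)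
    omega
  have hjensen : ∀ z, (∑ v ∈ (Finset.Icc 1 (d - 1)).powerset,
        setWeight Γ γ (insert d v) * dualSum b m w 2 z (insert d v)) ^ lam ≤
      ∑ v ∈ (Finset.Icc 1 (d - 1)).powerset,
        setWeight Γ γ (insert d v) ^ lam * dualSum b m w (2 * lam) z (insert d v) := fun z => by
    refine (ENNReal_rpow_sum_le _ _ hlam h₁).trans (Finset.sum_le_sum fun v _ => ?_)
    rw [ENNReal.mul_rpow_of_nonneg _ _ hlam.le]
    exact mul_le_mul_right (latticeSum_rpow_le 2 _ hlam h₁) _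
  rcases lt_or_ge (w d) m with hdm | hdm
  swap
  -- For w_d ≥ m there is no choice to exploit. The trivial bound by the full sum suffices, because
  -- the claimed factor is b^m · 2/b^m = 2.
  · refine (hjensen z).trans (Finset.sum_le_sum fun v _ => mul_le_mul_right ?_ _)
    have hbm : ((b ^ m : ℕ) : ℝ≥0∞) ≠ 0 := by exact_mod_cast pow_ne_zero _ hb.ne_zero
    rw [min_eq_left hdm, mul_left_comm, ENNReal.mul_inv_cancel hbm (ENNReal.natCast_ne_top _),
      mul_one]
    refine (latticeSum_le _ _).trans ?_
    rw [Fintype.card_coe]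
    exact le_mul_of_one_le_left zero_le one_le_two
  set U := unitsMod (b ^ (m - w d)) with hU
  set S : (ℕ → ℕ) → ℝ≥0∞ := fun z => ∑ v ∈ (Finset.Icc 1 (d - 1)).powerset,
    setWeight Γ γ (insert d v) * dualSum b m w 2 z (insert d v) with hS
  -- The relevant part of the error criterion is a nonnegative multiple of T_d, so a minimizer of
  -- T_d minimizes it too, even if γ_d = 0.
  have hST : ∀ x, S (Function.update z d x) = ENNReal.ofReal (γ d * (1 / ((b ^ m : ℕ) : ℝ)) *
      tVec b m w (korobovOmega 2) Γ γ z d x) := fun x => by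
    have hT : γ d * (1 / ((b ^ m : ℕ) : ℝ)) * tVec b m w (korobovOmega 2) Γ γ z d x =
        ∑ v ∈ (Finset.Icc 1 (d - 1)).powerset, (Γ (insert d v).card * ∏ i ∈ insert d v, γ i) *
          (dualSum b m w 2 (Function.update z d x) (insert d v)).toReal := by
      simp_rw [← sum_omegaProd]
      rw [tVec_eq_sum hw hΓ₀ hΓ hd hdm.le]
      simp_rw [Finset.mul_sum]
      rw [Finset.sum_comm]
      refine Finset.sum_congr rfl fun v hv => Finset.sum_congr rfl fun k _ => ?_
      have hdv := hnot v hv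
      have hprod : omegaProd b m w (korobovOmega 2) (Function.update z d x) v k =
          omegaProd b m w (korobovOmega 2) z v k :=
        Finset.prod_congr rfl fun i hi => by
          rw [Function.update_of_ne (show i ≠ d from fun h => hdv (h ▸ hi))]
      have hprod' : omegaProd b m w (korobovOmega 2) (Function.update z d x) (insert d v) k =
          omegaEntry (korobovOmega 2) (b ^ (m - w d)) x k *
          omegaProd b m w (korobovOmega 2) z v k := by
        rw [← hprod, omegaProd, Finset.prod_insert hdv, Function.update_self, omegaProd]
      rw [hprod', Finset.prod_insert hdv, Finset.card_insert_of_notMem hdv]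
      ring
    have hpos : ∀ u : Finset ℕ, 0 ≤ Γ u.card * ∏ i ∈ u, γ i := fun u =>
      mul_nonneg (hΓ _).le (Finset.prod_nonneg fun i _ => hγ i)
    rw [hT, ENNReal.ofReal_sum_of_nonneg fun v _ => mul_nonneg (hpos _) ENNReal.toReal_nonneg]
    refine Finset.sum_congr rfl fun v _ => ?_
    rw [ENNReal.ofReal_mul (hpos _), ENNReal.ofReal_toReal
      (show dualSum b m w 2 (Function.update z d x) (insert d v) ≠ ⊤ from
        (latticeSum_lt_top one_lt_two _).ne)]
    rfl
  obtain ⟨hzU, hmin⟩ := (hz d (Finset.mem_Icc.2 ⟨hd, hds⟩)).1 hdm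
  have hle : ∀ x ∈ U, S z ≤ S (Function.update z d x) := fun x hx => by
    have := hST (z d)
    rw [Function.update_eq_self] at this
    rw [this, hST]
    refine ENNReal.ofReal_le_ofReal (mul_le_mul_of_nonneg_left (hmin x hx) ?_)
    exact mul_nonneg (hγ d) (by positivity)
  have hU0 : (U.card : ℝ≥0∞) ≠ 0 := by exact_mod_cast (Finset.card_pos.2 ⟨_, hzU⟩).ne'
  have hUt : (U.card : ℝ≥0∞) ≠ ⊤ := ENNReal.natCast_ne_top _
  have hfac : (2 : ℝ≥0∞) * ((b ^ (m - w d) : ℕ) : ℝ≥0∞)⁻¹ =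
      ((b ^ min m (w d) : ℕ) : ℝ≥0∞) * (2 * ((b ^ m : ℕ) : ℝ≥0∞)⁻¹) := by
    have hm : b ^ m = b ^ w d * b ^ (m - w d) := by rw [← pow_add, Nat.add_sub_cancel' hdm.le]
    have hbw : ((b ^ w d : ℕ) : ℝ≥0∞) ≠ 0 := by exact_mod_cast pow_ne_zero _ hb.ne_zero
    rw [min_eq_right hdm.le, hm, Nat.cast_mul, ENNReal.mul_inv (Or.inl hbw)
      (Or.inl (ENNReal.natCast_ne_top _)), mul_left_comm, ← mul_assoc (((b ^ w d : ℕ)) : ℝ≥0∞),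
      ENNReal.mul_inv_cancel hbw (ENNReal.natCast_ne_top _), one_mul]
  -- The minimum is at most the average over the units. The power λ is taken before averaging, so
  -- that only sums with exponent 2λ have to be averaged.
  have hmain : (U.card : ℝ≥0∞) * S z ^ lam ≤ U.card *
      ∑ v ∈ (Finset.Icc 1 (d - 1)).powerset, setWeight Γ γ (insert d v) ^ lam *
        (((b ^ min m (w d) : ℕ) : ℝ≥0∞) * (2 * ((b ^ m : ℕ) : ℝ≥0∞)⁻¹) *
          (∑' h : ℤ, absPow (2 * lam) h) ^ (insert d v).card) := by
    calc (U.card : ℝ≥0∞) * S z ^ lam = ∑ x ∈ U, S z ^ lam := by simp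
      _ ≤ ∑ x ∈ U, ∑ v ∈ (Finset.Icc 1 (d - 1)).powerset, setWeight Γ γ (insert d v) ^ lam *
          dualSum b m w (2 * lam) (Function.update z d x) (insert d v) :=
        Finset.sum_le_sum fun x hx =>
          (ENNReal.rpow_le_rpow (hle x hx) hlam.le).trans (hjensen _)
      _ = ∑ v ∈ (Finset.Icc 1 (d - 1)).powerset, setWeight Γ γ (insert d v) ^ lam *
          ∑ x ∈ U, dualSum b m w (2 * lam) (Function.update z d x) (insert d v) := by
        rw [Finset.sum_comm]
        simp_rw [Finset.mul_sum]
      _ ≤ ∑ v ∈ (Finset.Icc 1 (d - 1)).powerset, setWeight Γ γ (insert d v) ^ lam *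
          (U.card * ((2 : ℝ≥0∞) * ((b ^ (m - w d) : ℕ) : ℝ≥0∞)⁻¹ *
          (∑' h : ℤ, absPow (2 * lam) h) ^ (insert d v).card)) :=
        Finset.sum_le_sum fun v hv => mul_le_mul_right
          (sum_units_dualSum_le hb (by linarith) z (hnot v hv) hdm) _
      _ = _ := by
        rw [Finset.mul_sum]
        refine Finset.sum_congr rfl fun v _ => ?_
        rw [hfac]
        ring
  exact (ENNReal.mul_le_mul_iff_right hU0 hUt).1 hmain

/-- Sorts the nonempty sets by their largest element d, which is the step of the construction that
controls them. -/
theorem sum_powerset_Icc {E : Type*} [AddCommMonoid E] (F : Finset ℕ → E) (s : ℕ) :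
    ∑ u ∈ (Finset.Icc 1 s).powerset, F u =
      F ∅ + ∑ d ∈ Finset.Icc 1 s, ∑ v ∈ (Finset.Icc 1 (d - 1)).powerset, F (insert d v) := by
  induction s with
  | zero => simp
  | succ s ih =>
    have hnot : s + 1 ∉ Finset.Icc 1 s := by simp
    rw [← Finset.insert_Icc_right_eq_Icc_add_one (by omega), Finset.sum_powerset_insert hnot, ih,
      Finset.sum_insert hnot, Nat.add_sub_cancel, add_assoc, add_comm (∑ v ∈ _, F (insert (s + 1) v))]

/-- The error bound for the reduced component-by-component construction. -/
theorem rpow_sum_nonempty_le {b m s : ℕ} [NeZero b] (hb : b.Prime) {w : ℕ → ℕ}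
    (hw : MonotoneOn w (Set.Ici 1)) {Γ γ : ℕ → ℝ} (hΓ₀ : Γ 0 = 1) (hΓ : ∀ ℓ, 0 < Γ ℓ)
    (hγ : ∀ j, 0 ≤ γ j) {z : ℕ → ℕ} (hz : IsFastRedCBC b m s w (korobovOmega 2) Γ γ z)
    {lam : ℝ} (h₀ : 1 / 2 < lam) (h₁ : lam ≤ 1) :
    (∑ u ∈ (Finset.Icc 1 s).powerset,
        if u.Nonempty then setWeight Γ γ u * dualSum b m w 2 z u else 0) ^ lam ≤
      ∑ u ∈ (Finset.Icc 1 s).powerset, if u.Nonempty then setWeight Γ γ u ^ lam *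
        (((b ^ min m (u.sup w) : ℕ) : ℝ≥0∞) * (2 * ((b ^ m : ℕ) : ℝ≥0∞)⁻¹) *
          (∑' h : ℤ, absPow (2 * lam) h) ^ u.card) else 0 := by
  rw [sum_powerset_Icc, sum_powerset_Icc]
  simp only [Finset.not_nonempty_empty, if_false, zero_add, Finset.insert_nonempty, if_true]
  refine (ENNReal_rpow_sum_le _ _ (by linarith) h₁).trans (Finset.sum_le_sum fun d hd => ?_)
  obtain ⟨hd₁, hds⟩ := Finset.mem_Icc.1 hd
  refine (rpow_sum_dualSum_le hb hw hΓ₀ hΓ hγ hz h₀ h₁ hd₁ hds).trans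
    (le_of_eq (Finset.sum_congr rfl fun v hv => ?_))
  -- Since w is monotone, the maximum over the set is attained at its largest index.
  have hsup : (insert d v).sup w = w d := by
    rw [Finset.sup_insert]
    refine sup_eq_left.2 (Finset.sup_le fun i hi => ?_)
    have := Finset.mem_Icc.1 (Finset.mem_powerset.1 hv hi)
    exact hw (Set.mem_Ici.2 this.1) (Set.mem_Ici.2 hd₁) (by omega)
  rw [hsup]

/-! ### Integration by parts for weak derivatives on the cube -/

open Filter Topology in
theorem exists_abs_deriv_smoothTransition_le :
    ∃ C, ∀ x, |deriv Real.smoothTransition x| ≤ C := by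
  have hc : Continuous (deriv Real.smoothTransition) :=
    (Real.smoothTransition.contDiff (n := 1)).continuous_deriv le_rfl
  obtain ⟨C, hC⟩ := isCompact_Icc.exists_bound_of_continuousOn (s := Set.Icc (0 : ℝ) 1) hc.continuousOn
  refine ⟨max C 0, fun x => ?_⟩
  rcases lt_or_ge x 0 with hx | hx
  · have : Real.smoothTransition =ᶠ[𝓝 x] fun _ => 0 := by
      filter_upwards [Iio_mem_nhds hx] with y hy
      exact Real.smoothTransition.zero_of_nonpos hy.le
    simp [this.deriv_eq]
  rcases le_or_gt x 1 with hx₁ | hx₁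
  · exact (hC x ⟨hx, hx₁⟩).trans (le_max_left _ _)
  · have : Real.smoothTransition =ᶠ[𝓝 x] fun _ => 1 := by
      filter_upwards [Ioi_mem_nhds hx₁] with y hy
      exact Real.smoothTransition.one_of_one_le hy.le
    simp [this.deriv_eq]

open Filter Topology in
theorem deriv_smoothTransition_of_one_lt {x : ℝ} (hx : 1 < x) :
    deriv Real.smoothTransition x = 0 := by
  have : Real.smoothTransition =ᶠ[𝓝 x] fun _ => 1 := by
    filter_upwards [Ioi_mem_nhds hx] with y hy
    exact Real.smoothTransition.one_of_one_le hy.le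
  simp [this.deriv_eq]

/-- A smooth cutoff function with support in `[-1/2 + 1/n, 1/2 - 1/n]`. -/
noncomputable def cutoff (n : ℕ) (x : ℝ) : ℝ :=
  Real.smoothTransition (n * (x + 1 / 2) - 1) * Real.smoothTransition (n * (1 / 2 - x) - 1)

/-- The derivative of `cutoff n`. -/
noncomputable def cutoffDeriv (n : ℕ) (x : ℝ) : ℝ :=
  n * deriv Real.smoothTransition (n * (x + 1 / 2) - 1) *
      Real.smoothTransition (n * (1 / 2 - x) - 1) -
    n * deriv Real.smoothTransition (n * (1 / 2 - x) - 1) *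
      Real.smoothTransition (n * (x + 1 / 2) - 1)

theorem contDiff_cutoff (n : ℕ) : ContDiff ℝ ((⊤ : ℕ∞) : WithTop ℕ∞) (cutoff n) := by
  unfold cutoff
  refine ContDiff.mul (Real.smoothTransition.contDiff.comp ?_)
    (Real.smoothTransition.contDiff.comp ?_) <;> fun_prop

theorem hasDerivAt_cutoff (n : ℕ) (x : ℝ) : HasDerivAt (cutoff n) (cutoffDeriv n x) x := by
  have hd : ∀ y, HasDerivAt Real.smoothTransition (deriv Real.smoothTransition y) y := fun y =>
    ((Real.smoothTransition.contDiff (n := 1)).differentiable one_ne_zero y).hasDerivAt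
  have h₁ : HasDerivAt (fun x : ℝ => (n : ℝ) * (x + 1 / 2) - 1) n x := by
    simpa using (((hasDerivAt_id x).add_const (1 / 2 : ℝ)).const_mul (n : ℝ)).sub_const 1
  have h₂ : HasDerivAt (fun x : ℝ => (n : ℝ) * (1 / 2 - x) - 1) (-n) x := by
    simpa using (((hasDerivAt_id x).const_sub (1 / 2 : ℝ)).const_mul (n : ℝ)).sub_const 1
  refine (((hd _).comp x h₁).mul ((hd _).comp x h₂)).congr_deriv ?_
  simp only [cutoffDeriv, Function.comp]
  ring

theorem cutoff_nonneg (n : ℕ) (x : ℝ) : 0 ≤ cutoff n x :=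
  mul_nonneg (Real.smoothTransition.nonneg _) (Real.smoothTransition.nonneg _)

theorem cutoff_le_one (n : ℕ) (x : ℝ) : cutoff n x ≤ 1 :=
  mul_le_one₀ (Real.smoothTransition.le_one _) (Real.smoothTransition.nonneg _)
    (Real.smoothTransition.le_one _)

theorem mem_Icc_of_cutoff_ne_zero {n : ℕ} (hn : 0 < n) {x : ℝ} (hx : cutoff n x ≠ 0) :
    x ∈ Set.Icc (-(1 / 2) + 1 / (n : ℝ)) (1 / 2 - 1 / n) := by
  have hn' : (0 : ℝ) < n := Nat.cast_pos.2 hn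
  have h₁ : 0 < (n : ℝ) * (x + 1 / 2) - 1 := by
    by_contra! h
    exact hx (by rw [cutoff, Real.smoothTransition.zero_of_nonpos h, zero_mul])
  have h₂ : 0 < (n : ℝ) * (1 / 2 - x) - 1 := by
    by_contra! h
    exact hx (by rw [cutoff, Real.smoothTransition.zero_of_nonpos h, mul_zero])
  have h₃ : 1 / (n : ℝ) < x + 1 / 2 := by rw [div_lt_iff₀ hn']; linarith
  have h₄ : 1 / (n : ℝ) < 1 / 2 - x := by rw [div_lt_iff₀ hn']; linarith
  constructor <;> linarith

open Filter Topology in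
-- At an interior point both transitions are eventually complete, so the cutoff is exactly 1 there
-- and its derivative exactly 0.
theorem eventually_cutoff {x : ℝ} (hx : x ∈ Set.Ioo (-(1 / 2) : ℝ) (1 / 2)) :
    ∀ᶠ n : ℕ in atTop, cutoff n x = 1 ∧ cutoffDeriv n x = 0 := by
  have key : ∀ a : ℝ, 0 < a → ∀ᶠ n : ℕ in atTop, 1 < (n : ℝ) * a - 1 := fun a ha => by
    have := (tendsto_natCast_atTop_atTop (R := ℝ)).atTop_mul_const ha
    filter_upwards [this.eventually_gt_atTop 2] with n hn
    linarith
  filter_upwards [key (x + 1 / 2) (by linarith [hx.1]), key (1 / 2 - x) (by linarith [hx.2])]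
    with n h₁ h₂
  rw [cutoff, cutoffDeriv, Real.smoothTransition.one_of_one_le h₁.le,
    Real.smoothTransition.one_of_one_le h₂.le, deriv_smoothTransition_of_one_lt h₁,
    deriv_smoothTransition_of_one_lt h₂]
  simp

/-- The derivative of the cutoff has size n, but only within distance 2/n of an endpoint, where p is
at most 2M/n. The product stays bounded uniformly in n. -/
theorem abs_mul_cutoffDeriv_le {C M : ℝ} (hC : ∀ x, |deriv Real.smoothTransition x| ≤ C)
    (hM : 0 ≤ M) (n : ℕ) {x p : ℝ} (hx : x ∈ Set.Icc (-(1 / 2) : ℝ) (1 / 2))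
    (h₁ : |p| ≤ M * (x + 1 / 2)) (h₂ : |p| ≤ M * (1 / 2 - x)) :
    |p * cutoffDeriv n x| ≤ 4 * M * C := by
  have hC0 : 0 ≤ C := (abs_nonneg _).trans (hC 0)
  have key : ∀ a y : ℝ, 0 ≤ a → |p| ≤ M * a → 
      |p| * |n * deriv Real.smoothTransition (n * a - 1) * Real.smoothTransition y| ≤
        2 * M * C := fun a y ha hp => by
    rcases lt_or_ge 1 (n * a - 1) with h | h
    · rw [deriv_smoothTransition_of_one_lt h]
      simp
      positivity
    · rw [abs_mul, abs_mul, abs_of_nonneg (Real.smoothTransition.nonneg y), Nat.abs_cast]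
      calc |p| * (n * |deriv Real.smoothTransition (n * a - 1)| * Real.smoothTransition y)
          ≤ (M * a) * (n * C * 1) := by
            gcongr
            · exact mul_nonneg (by positivity) (Real.smoothTransition.nonneg y)
            · exact Real.smoothTransition.nonneg y
            · exact hC _
            · exact Real.smoothTransition.le_one y
        _ = M * C * (n * a) := by ring
        _ ≤ M * C * 2 := by gcongr; linarith
        _ = _ := by ring
  rw [abs_mul, cutoffDeriv]
  have hk₁ := key (x + 1 / 2) (n * (1 / 2 - x) - 1) (by linarith [hx.1]) h₁
  have hk₂ := key (1 / 2 - x) (n * (x + 1 / 2) - 1) (by linarith [hx.2]) h₂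
  refine (mul_le_mul_of_nonneg_left (abs_sub _ _) (abs_nonneg p)).trans ?_
  rw [mul_add]
  linarith

theorem isCompact_cube (s : ℕ) : IsCompact (cube s) := isCompact_univ_pi fun _ => isCompact_Icc

theorem convex_cube (s : ℕ) : Convex ℝ (cube s) := convex_pi fun _ _ => convex_Icc _ _

theorem measurableSet_cube (s : ℕ) : MeasurableSet (cube s) :=
  MeasurableSet.univ_pi fun _ => measurableSet_Icc

theorem cube_ae_eq_openCube (s : ℕ) : openCube s =ᵐ[volume] cube s :=
  Measure.pi_Ioo_ae_eq_pi_Icc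

/-- A function that vanishes on two opposite faces of the cube is bounded by the distances to the
faces. -/
theorem exists_abs_le_of_eq_zero_on_faces {s : ℕ} {j : Fin s} {Ψ : (Fin s → ℝ) → ℝ}
    (hΨ : ContDiff ℝ ((⊤ : ℕ∞) : WithTop ℕ∞) Ψ)
    (h₀ : ∀ y ∈ cube s, y j = 1 / 2 ∨ y j = -(1 / 2) → Ψ y = 0) :
    ∃ M, 0 ≤ M ∧ ∀ y ∈ cube s, |Ψ y| ≤ M * (y j + 1 / 2) ∧ |Ψ y| ≤ M * (1 / 2 - y j) := by
  have hc : Continuous (fderiv ℝ Ψ) := hΨ.continuous_fderiv (by simp)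
  obtain ⟨M, hM⟩ := (isCompact_cube s).exists_bound_of_continuousOn hc.continuousOn
  have key : ∀ y ∈ cube s, ∀ c : ℝ, (c = 1 / 2 ∨ c = -(1 / 2)) → |Ψ y| ≤ max M 0 * |y j - c| :=
      fun y hy c hc => by
    have hy' : Function.update y j c ∈ cube s := fun i _ => by
      rcases eq_or_ne i j with rfl | hij
      · rw [Function.update_self]
        rcases hc with rfl | rfl <;> norm_num
      · rw [Function.update_of_ne hij]
        exact hy i trivial
    -- The mean value inequality on the segment from y to its projection onto the face, where Ψ
    -- vanishes.
    have := (convex_cube s).norm_image_sub_le_of_norm_fderiv_le (𝕜 := ℝ) (f := Ψ) (C := max M 0)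
      (fun x _ => hΨ.differentiable (by simp) x) (fun x hx => (hM x hx).trans (le_max_left _ _))
      hy' hy
    rw [h₀ _ hy' (by rwa [Function.update_self]), sub_zero, Real.norm_eq_abs] at this
    refine this.trans (mul_le_mul_of_nonneg_left ?_ (le_max_right _ _))
    refine (pi_norm_le_iff_of_nonneg (abs_nonneg _)).2 fun i => ?_
    rcases eq_or_ne i j with rfl | hij
    · rw [Pi.sub_apply, Function.update_self, Real.norm_eq_abs]
    · rw [Pi.sub_apply, Function.update_of_ne hij, sub_self, norm_zero]
      exact abs_nonneg _
  refine ⟨max M 0, le_max_right _ _, fun y hy => ?_⟩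
  have hyj := hy j trivial
  have h₁ := key y hy (-(1 / 2)) (Or.inr rfl)
  have h₂ := key y hy (1 / 2) (Or.inl rfl)
  rw [abs_of_nonneg (a := y j - -(1 / 2)) (by linarith [hyj.1]), sub_neg_eq_add] at h₁
  rw [abs_of_nonpos (a := y j - 1 / 2) (by linarith [hyj.2]), neg_sub] at h₂
  exact ⟨h₁, h₂⟩

theorem fderiv_single_eq {s : ℕ} {j : Fin s} {E : Type*}
    [NormedAddCommGroup E] [NormedSpace ℝ E] {φ : (Fin s → ℝ) → E} {y : Fin s → ℝ} {d : E}
    (hφ : DifferentiableAt ℝ φ y) (hd : HasDerivAt (fun x => φ (Function.update y j x)) d (y j)) :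
    fderiv ℝ φ y (Pi.single j 1) = d := by
  have h := hφ.hasFDerivAt
  rw [← Function.update_eq_self j y] at h
  have h₁ := h.comp_hasDerivAt (y j) (hasDerivAt_update y j (y j))
  rw [Function.update_eq_self] at h₁
  exact h₁.unique hd

theorem hasDerivAt_comp_update {s : ℕ} {j : Fin s} {E : Type*}
    [NormedAddCommGroup E] [NormedSpace ℝ E] {φ : (Fin s → ℝ) → E} {y : Fin s → ℝ}
    (hφ : DifferentiableAt ℝ φ y) :
    HasDerivAt (fun x => φ (Function.update y j x)) (fderiv ℝ φ y (Pi.single j 1)) (y j) := by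
  have h := hφ.hasFDerivAt
  rw [← Function.update_eq_self j y] at h
  have h₁ := h.comp_hasDerivAt (y j) (hasDerivAt_update y j (y j))
  rwa [Function.update_eq_self] at h₁

open Filter Topology in
/-- The defining identity of a weak partial derivative extends to smooth functions which vanish
only on the two faces of the cube that are orthogonal to the direction. -/
theorem IsWeakPartial.integral_eq {s : ℕ} {j : Fin s} {f g : (Fin s → ℝ) → ℝ}
    (hw : IsWeakPartial j f g) (hf : IntegrableOn f (cube s)) (hg : IntegrableOn g (cube s))
    {Ψ : (Fin s → ℝ) → ℝ} (hΨ : ContDiff ℝ ((⊤ : ℕ∞) : WithTop ℕ∞) Ψ)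
    (h₀ : ∀ y ∈ cube s, y j = 1 / 2 ∨ y j = -(1 / 2) → Ψ y = 0) :
    ∫ y in cube s, f y * fderiv ℝ Ψ y (Pi.single j 1) = -∫ y in cube s, g y * Ψ y := by
  classical
  obtain ⟨C, hC⟩ := exists_abs_deriv_smoothTransition_le
  obtain ⟨M, hM0, hM⟩ := exists_abs_le_of_eq_zero_on_faces hΨ h₀
  have hcd : Continuous fun y => fderiv ℝ Ψ y (Pi.single j 1) :=
    (hΨ.continuous_fderiv (by simp)).clm_apply continuous_const
  obtain ⟨M₁, hM₁⟩ := (isCompact_cube s).exists_bound_of_continuousOn hcd.continuousOn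
  obtain ⟨M₂, hM₂⟩ := (isCompact_cube s).exists_bound_of_continuousOn hΨ.continuous.continuousOn
  -- The functions η n Ψ are admissible test functions. Differentiating in direction j touches only
  -- the j-th factor of η n, which is why the product without it is needed separately.
  set η : ℕ → (Fin s → ℝ) → ℝ := fun n y => ∏ k, cutoff n (y k) with hη
  set η' : ℕ → (Fin s → ℝ) → ℝ := fun n y => ∏ k ∈ Finset.univ.erase j, cutoff n (y k) with hη'
  have hη_le : ∀ n y, |η n y| ≤ 1 := fun n y => by
    rw [abs_of_nonneg (Finset.prod_nonneg fun _ _ => cutoff_nonneg _ _)]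
    exact Finset.prod_le_one (fun _ _ => cutoff_nonneg _ _) fun _ _ => cutoff_le_one _ _
  have hη'_le : ∀ n y, |η' n y| ≤ 1 := fun n y => by
    rw [abs_of_nonneg (Finset.prod_nonneg fun _ _ => cutoff_nonneg _ _)]
    exact Finset.prod_le_one (fun _ _ => cutoff_nonneg _ _) fun _ _ => cutoff_le_one _ _
  have hηs : ∀ n, ContDiff ℝ ((⊤ : ℕ∞) : WithTop ℕ∞) (η n) := fun n =>
    contDiff_prod fun k _ => (contDiff_cutoff n).comp (contDiff_apply ℝ ℝ k)
  have hφs : ∀ n, ContDiff ℝ ((⊤ : ℕ∞) : WithTop ℕ∞) fun y => η n y * Ψ y := fun n =>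
    (hηs n).mul hΨ
  have hderiv : ∀ n y, fderiv ℝ (fun y => η n y * Ψ y) y (Pi.single j 1) =
      η n y * fderiv ℝ Ψ y (Pi.single j 1) + η' n y * (Ψ y * cutoffDeriv n (y j)) := fun n y => by
    refine fderiv_single_eq ((hφs n).differentiable (by simp) y) ?_
    have hsplit : ∀ x, η n (Function.update y j x) = cutoff n x * η' n y := fun x => by
      rw [hη, hη']
      dsimp only
      rw [← Finset.mul_prod_erase _ _ (Finset.mem_univ j), Function.update_self]
      congr 1
      refine Finset.prod_congr rfl fun k hk => ?_
      rw [Function.update_of_ne (Finset.ne_of_mem_erase hk)]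
    have h := ((hasDerivAt_cutoff n (y j)).mul_const (η' n y)).mul
      (hasDerivAt_comp_update (j := j) (hΨ.differentiable (by simp) y))
    refine (h.congr_of_eventuallyEq (Eventually.of_forall fun x => ?_)).congr_deriv ?_
    · simp only [hsplit, Pi.mul_apply]
    · have hsy := hsplit (y j)
      rw [Function.update_eq_self] at hsy ⊢
      rw [hsy]
      ring
  have hK : ∀ n : ℕ, 0 < n → tsupport (fun y => η n y * Ψ y) ⊆
      Set.univ.pi fun _ => Set.Icc (-(1 / 2) + 1 / (n : ℝ)) (1 / 2 - 1 / n) := fun n hn => by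
    refine closure_minimal (fun y hy k _ => ?_) (isClosed_set_pi fun _ _ => isClosed_Icc)
    refine mem_Icc_of_cutoff_ne_zero hn fun h => hy ?_
    have h' : η n y = 0 := Finset.prod_eq_zero (f := fun k => cutoff n (y k)) (Finset.mem_univ k) h
    simp only [h', zero_mul]
  have hid : ∀ n : ℕ, 0 < n →
      ∫ y in cube s, f y * (η n y * fderiv ℝ Ψ y (Pi.single j 1) +
        η' n y * (Ψ y * cutoffDeriv n (y j))) = -∫ y in cube s, g y * (η n y * Ψ y) :=
      fun n hn => by
    have := hw (fun y => η n y * Ψ y) (hφs n)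
      ((isCompact_univ_pi fun _ => isCompact_Icc).of_isClosed_subset (isClosed_tsupport _) (hK n hn))
      ((hK n hn).trans (Set.pi_mono fun _ _ x hx => by
        have hn' : (0 : ℝ) < 1 / n := by positivity
        exact ⟨by linarith [hx.1], by linarith [hx.2]⟩))
    simpa only [hderiv] using this
  have hmem : ∀ᵐ y ∂volume.restrict (cube s), y ∈ cube s :=
    ae_restrict_mem (measurableSet_cube s)
  have hopen : ∀ᵐ y ∂volume.restrict (cube s), y ∈ openCube s := by
    rw [← Measure.restrict_congr_set (cube_ae_eq_openCube s)]
    exact ae_restrict_mem (MeasurableSet.univ_pi fun _ => measurableSet_Ioo)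
  have hone : ∀ y ∈ openCube s, ∀ᶠ n : ℕ in atTop, η n y = 1 ∧ cutoffDeriv n (y j) = 0 :=
      fun y hy => by
    have : ∀ᶠ n : ℕ in atTop, ∀ k, cutoff n (y k) = 1 ∧ cutoffDeriv n (y k) = 0 :=
      eventually_all.2 fun k => eventually_cutoff (hy k trivial)
    filter_upwards [this] with n hn
    exact ⟨Finset.prod_eq_one fun k _ => (hn k).1, (hn j).2⟩
  have hcη : ∀ n, Continuous (η n) := fun n => (hηs n).continuous
  have hcη' : ∀ n, Continuous (η' n) := fun n =>
    continuous_finsetProd _ fun k _ => (contDiff_cutoff n).continuous.comp (continuous_apply k)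
  have hcd' : ∀ n, Continuous (cutoffDeriv n) := fun n => by
    have : cutoffDeriv n = deriv (cutoff n) := funext fun x => (hasDerivAt_cutoff n x).deriv.symm
    rw [this]
    exact (contDiff_cutoff n).continuous_deriv (by simp)
  -- Dominated convergence: the term with the derivative of the cutoff tends to 0 in the open cube
  -- and is bounded uniformly, because Ψ vanishes on the two faces.
  have hlim₁ : Tendsto (fun n : ℕ => ∫ y in cube s, f y * (η n y * fderiv ℝ Ψ y (Pi.single j 1) +
        η' n y * (Ψ y * cutoffDeriv n (y j)))) atTop
      (𝓝 (∫ y in cube s, f y * fderiv ℝ Ψ y (Pi.single j 1))) := by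
    refine tendsto_integral_of_dominated_convergence (fun y => ‖f y‖ * (M₁ + 4 * M * C))
      (fun n => hf.aestronglyMeasurable.mul (Continuous.aestronglyMeasurable ?_))
      (hf.norm.mul_const _) (fun n => ?_) ?_
    · exact ((hcη n).mul hcd).add ((hcη' n).mul
        (hΨ.continuous.mul ((hcd' n).comp (continuous_apply j))))
    · filter_upwards [hmem] with y hy
      rw [norm_mul]
      refine mul_le_mul_of_nonneg_left ((norm_add_le _ _).trans (add_le_add ?_ ?_)) (norm_nonneg _)
      · rw [norm_mul]
        exact (mul_le_of_le_one_left (norm_nonneg _) (hη_le n y)).trans (hM₁ y hy)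
      · rw [norm_mul]
        exact (mul_le_of_le_one_left (norm_nonneg _) (hη'_le n y)).trans
          (abs_mul_cutoffDeriv_le hC hM0 n (hy j trivial) (hM y hy).1 (hM y hy).2)
    · filter_upwards [hopen] with y hy
      refine tendsto_const_nhds.congr' ?_
      filter_upwards [hone y hy] with n hn
      rw [hn.1, hn.2]
      simp
  have hlim₂ : Tendsto (fun n : ℕ => ∫ y in cube s, g y * (η n y * Ψ y)) atTop
      (𝓝 (∫ y in cube s, g y * Ψ y)) := by
    refine tendsto_integral_of_dominated_convergence (fun y => ‖g y‖ * M₂)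
      (fun n => hg.aestronglyMeasurable.mul
        ((hcη n).mul hΨ.continuous).aestronglyMeasurable)
      (hg.norm.mul_const _) (fun n => ?_) ?_
    · filter_upwards [hmem] with y hy
      rw [norm_mul, norm_mul]
      refine mul_le_mul_of_nonneg_left ?_ (norm_nonneg _)
      exact (mul_le_of_le_one_left (norm_nonneg _) (hη_le n y)).trans (hM₂ y hy)
    · filter_upwards [hopen] with y hy
      refine tendsto_const_nhds.congr' ?_
      filter_upwards [hone y hy] with n hn
      rw [hn.1, one_mul]
  refine tendsto_nhds_unique (hlim₁.congr' ?_) hlim₂.neg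
  filter_upwards [eventually_gt_atTop 0] with n hn
  exact hid n hn

/-! ### Bounds for the Fourier coefficients -/

/-- Real and imaginary parts are treated separately, through the real linear functionals on the
complex numbers. -/
theorem IsWeakPartial.integral_complex_eq {s : ℕ} {j : Fin s} {f g : (Fin s → ℝ) → ℝ}
    (hw : IsWeakPartial j f g) (hf : IntegrableOn f (cube s)) (hg : IntegrableOn g (cube s))
    {Ψ : (Fin s → ℝ) → ℂ} (hΨ : ContDiff ℝ ((⊤ : ℕ∞) : WithTop ℕ∞) Ψ)
    (h₀ : ∀ y ∈ cube s, y j = 1 / 2 ∨ y j = -(1 / 2) → Ψ y = 0) :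
    ∫ y in cube s, (f y : ℂ) * fderiv ℝ Ψ y (Pi.single j 1) = -∫ y in cube s, (g y : ℂ) * Ψ y := by
  have hcd : Continuous fun y => fderiv ℝ Ψ y (Pi.single j 1) :=
    (hΨ.continuous_fderiv (by simp)).clm_apply continuous_const
  have hi₁ : IntegrableOn (fun y => (f y : ℂ) * fderiv ℝ Ψ y (Pi.single j 1)) (cube s) :=
    IntegrableOn.mul_continuousOn hf.ofReal hcd.continuousOn (isCompact_cube s)
  have hi₂ : IntegrableOn (fun y => (g y : ℂ) * Ψ y) (cube s) :=
    IntegrableOn.mul_continuousOn hg.ofReal hΨ.continuous.continuousOn (isCompact_cube s)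
  have key : ∀ L : ℂ →L[ℝ] ℝ, L (∫ y in cube s, (f y : ℂ) * fderiv ℝ Ψ y (Pi.single j 1)) =
      L (-∫ y in cube s, (g y : ℂ) * Ψ y) := fun L => by
    have hL : ∀ (a : ℝ) (c : ℂ), L (a * c) = a * L c := fun a c => by
      rw [← Complex.real_smul, map_smul, smul_eq_mul]
    have hd : ∀ y, fderiv ℝ (fun y => L (Ψ y)) y (Pi.single j 1) =
        L (fderiv ℝ Ψ y (Pi.single j 1)) := fun y => by
      have := (L.hasFDerivAt.comp y (hΨ.differentiable (by simp) y).hasFDerivAt).fderiv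
      exact congrArg (fun A => A (Pi.single j 1)) this
    rw [map_neg, ← L.integral_comp_comm hi₁, ← L.integral_comp_comm hi₂]
    simp only [hL, ← hd]
    exact hw.integral_eq hf hg (L.contDiff.comp hΨ) fun y hy hj => by rw [h₀ y hy hj, map_zero]
  exact Complex.ext (key Complex.reCLM) (key Complex.imCLM)

/-! ### Exponentials and their primitives that vanish at the endpoints. -/

/-- The exponential `x ↦ e^{-2 π i h (x + 1/2)}`. -/
noncomputable def wave (h : ℤ) (x : ℝ) : ℂ :=
  Complex.exp (-(2 * Real.pi * Complex.I * h) * (x + 1 / 2))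

/-- The primitive of `wave h` that vanishes at `±1/2`, for `h ≠ 0`. -/
noncomputable def wavePrimitive (h : ℤ) (x : ℝ) : ℂ :=
  (wave h x - 1) / (-(2 * Real.pi * Complex.I * h))

theorem two_pi_I_mul_ne_zero {h : ℤ} (hh : h ≠ 0) : -(2 * Real.pi * Complex.I * h) ≠ (0 : ℂ) :=
  neg_ne_zero.2 (mul_ne_zero (by simp [Real.pi_ne_zero]) (Int.cast_ne_zero.2 hh))

theorem contDiff_wave (h : ℤ) : ContDiff ℝ ((⊤ : ℕ∞) : WithTop ℕ∞) (wave h) := by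
  unfold wave
  exact (contDiff_const.mul (Complex.ofRealCLM.contDiff.add contDiff_const)).cexp

theorem contDiff_wavePrimitive (h : ℤ) :
    ContDiff ℝ ((⊤ : ℕ∞) : WithTop ℕ∞) (wavePrimitive h) := by
  unfold wavePrimitive
  exact ((contDiff_wave h).sub contDiff_const).div_const _

theorem hasDerivAt_wavePrimitive {h : ℤ} (hh : h ≠ 0) (x : ℝ) :
    HasDerivAt (wavePrimitive h) (wave h x) x := by
  have h₁ : HasDerivAt (fun x : ℝ => -(2 * Real.pi * Complex.I * h) * ((x : ℂ) + 1 / 2))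
      (-(2 * Real.pi * Complex.I * h)) x := by
    simpa using ((Complex.ofRealCLM.hasDerivAt (x := x)).add_const (1 / 2 : ℂ)).const_mul
      (-(2 * Real.pi * Complex.I * h) : ℂ)
  refine ((h₁.cexp.sub_const 1).div_const _).congr_deriv ?_
  rw [mul_div_cancel_right₀ _ (two_pi_I_mul_ne_zero hh), wave]

theorem wavePrimitive_neg_half (h : ℤ) : wavePrimitive h (-(1 / 2)) = 0 := by
  simp [wavePrimitive, wave]

theorem wavePrimitive_half (h : ℤ) : wavePrimitive h (1 / 2) = 0 := by
  have : wave h (1 / 2) = 1 := by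
    rw [wave, Complex.exp_eq_one_iff]
    refine ⟨-h, ?_⟩
    push_cast
    ring
  rw [wavePrimitive, this, sub_self, zero_div]

theorem wave_zero (x : ℝ) : wave 0 x = 1 := by simp [wave]

theorem norm_wavePrimitive_sq {h : ℤ} (x : ℝ) :
    ‖wavePrimitive h x‖ ^ 2 =
      (2 - 2 * Real.cos (2 * Real.pi * h * (x + 1 / 2))) * (1 / (4 * Real.pi ^ 2 * (h : ℝ) ^ 2)) := by
  have h₁ : wave h x = Complex.exp ((-(2 * Real.pi * h * (x + 1 / 2)) : ℝ) * Complex.I) := by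
    rw [wave]
    congr 1
    push_cast
    ring
  have h₂ : ‖wave h x - 1‖ ^ 2 = 2 - 2 * Real.cos (2 * Real.pi * h * (x + 1 / 2)) := by
    rw [h₁, ← Complex.normSq_eq_norm_sq, Complex.normSq_apply, Complex.sub_re, Complex.sub_im,
      Complex.exp_ofReal_mul_I_re, Complex.exp_ofReal_mul_I_im, Real.cos_neg, Real.sin_neg,
      Complex.one_re, Complex.one_im]
    have := Real.sin_sq_add_cos_sq (2 * Real.pi * h * (x + 1 / 2))
    linear_combination this
  have h₃ : ‖-(2 * Real.pi * Complex.I * h : ℂ)‖ ^ 2 = 4 * Real.pi ^ 2 * (h : ℝ) ^ 2 := by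
    rw [norm_neg, norm_mul, norm_mul, norm_mul, Complex.norm_I, Complex.norm_intCast,
      Complex.norm_real, mul_one, mul_pow, mul_pow, Real.norm_eq_abs, sq_abs, sq_abs]
    norm_num
  rw [wavePrimitive, norm_div, div_pow, h₂, h₃, mul_one_div]

/-- In |e^{iθ} - 1|² = 2 - 2 cos θ the cosine has mean 0 over full periods. The mean 2, divided by
4π²h², produces the constant 1/(2π²) of the weights. -/
theorem integral_norm_wavePrimitive_sq {h : ℤ} (hh : h ≠ 0) :
    ∫ x in Set.Icc (-(1 / 2) : ℝ) (1 / 2), ‖wavePrimitive h x‖ ^ 2 =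
      1 / (2 * Real.pi ^ 2) * |(h : ℝ)| ^ (-2 : ℝ) := by
  have hh' : (h : ℝ) ≠ 0 := Int.cast_ne_zero.2 hh
  have hpi := Real.pi_ne_zero
  simp_rw [norm_wavePrimitive_sq]
  rw [integral_mul_const, integral_Icc_eq_integral_Ioc,
    ← intervalIntegral.integral_of_le (by norm_num)]
  have hd : ∀ x : ℝ, HasDerivAt (fun x => 2 * x - 2 * (Real.sin (2 * Real.pi * h * (x + 1 / 2)) /
      (2 * Real.pi * h))) (2 - 2 * Real.cos (2 * Real.pi * h * (x + 1 / 2))) x := fun x => by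
    have h₁ : HasDerivAt (fun x : ℝ => 2 * Real.pi * h * (x + 1 / 2)) (2 * Real.pi * h) x := by
      simpa using ((hasDerivAt_id x).add_const (1 / 2 : ℝ)).const_mul (2 * Real.pi * h)
    refine (((hasDerivAt_id x).const_mul 2).sub
      ((h₁.sin.div_const (2 * Real.pi * h)).const_mul 2)).congr_deriv ?_
    field_simp
  rw [intervalIntegral.integral_eq_sub_of_hasDerivAt (fun x _ => hd x)
    (Continuous.intervalIntegrable (by fun_prop) _ _)]
  have hs : Real.sin (2 * Real.pi * h * (1 / 2 + 1 / 2)) = 0 := by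
    rw [show 2 * Real.pi * h * (1 / 2 + 1 / 2) = ((2 * h : ℤ) : ℝ) * Real.pi by push_cast; ring]
    exact Real.sin_int_mul_pi _
  rw [hs, Real.rpow_neg (abs_nonneg _), Real.rpow_two, sq_abs]
  norm_num
  field_simp
  norm_num

theorem lintegral_norm_wavePrimitive_sq {h : ℤ} (hh : h ≠ 0) :
    ENNReal.ofReal (∫ x in Set.Icc (-(1 / 2) : ℝ) (1 / 2), ‖wavePrimitive h x‖ ^ 2) =
      ENNReal.ofReal (1 / (2 * Real.pi ^ 2)) * absPow 2 h := by
  rw [integral_norm_wavePrimitive_sq hh, ENNReal.ofReal_mul (by positivity), absPow_eq_ofReal,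
    if_neg hh]

/-! ### Integration by parts over several directions, and Cauchy–Schwarz. -/

theorem volume_restrict_cube (s : ℕ) :
    volume.restrict (cube s) =
      Measure.pi fun _ : Fin s => volume.restrict (Set.Icc (-(1 / 2) : ℝ) (1 / 2)) := by
  rw [volume_pi, cube, Measure.restrict_pi_pi]

instance isProbabilityMeasure_restrict_Icc :
    IsProbabilityMeasure (volume.restrict (Set.Icc (-(1 / 2) : ℝ) (1 / 2))) :=
  ⟨by rw [Measure.restrict_apply_univ, Real.volume_Icc]; norm_num⟩

instance isProbabilityMeasure_restrict_cube (s : ℕ) :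
    IsProbabilityMeasure (volume.restrict (cube s)) := by
  rw [volume_restrict_cube]
  infer_instance

theorem contDiff_prod_apply {s : ℕ} {χ : Fin s → ℝ → ℂ}
    (hχ : ∀ k, ContDiff ℝ ((⊤ : ℕ∞) : WithTop ℕ∞) (χ k)) :
    ContDiff ℝ ((⊤ : ℕ∞) : WithTop ℕ∞) fun y : Fin s → ℝ => ∏ k, χ k (y k) :=
  contDiff_prod fun k _ => (hχ k).comp (contDiff_apply ℝ ℝ k)

/-- The product of the functions `wavePrimitive (h k)`, `k ∈ v`, and `wave (h k)`, `k ∉ v`. -/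
noncomputable def waveProd {s : ℕ} (h : Fin s → ℤ) (v : Finset (Fin s)) (y : Fin s → ℝ) : ℂ :=
  ∏ k, (if k ∈ v then wavePrimitive (h k) else wave (h k)) (y k)

theorem contDiff_waveProd {s : ℕ} (h : Fin s → ℤ) (v : Finset (Fin s)) :
    ContDiff ℝ ((⊤ : ℕ∞) : WithTop ℕ∞) (waveProd h v) :=
  contDiff_prod_apply fun k => by
    split_ifs
    exacts [contDiff_wavePrimitive _, contDiff_wave _]

theorem waveProd_update {s : ℕ} (h : Fin s → ℤ) (v : Finset (Fin s)) (j : Fin s) (y : Fin s → ℝ)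
    (x : ℝ) : waveProd h v (Function.update y j x) =
      (if j ∈ v then wavePrimitive (h j) else wave (h j)) x *
        ∏ k ∈ Finset.univ.erase j, (if k ∈ v then wavePrimitive (h k) else wave (h k)) (y k) := by
  rw [waveProd, ← Finset.mul_prod_erase _ _ (Finset.mem_univ j), Function.update_self]
  congr 1
  refine Finset.prod_congr rfl fun k hk => ?_
  rw [Function.update_of_ne (Finset.ne_of_mem_erase hk)]

theorem waveProd_eq_mul {s : ℕ} (h : Fin s → ℤ) (v : Finset (Fin s)) (j : Fin s) (y : Fin s → ℝ) :
    waveProd h v y = (if j ∈ v then wavePrimitive (h j) else wave (h j)) (y j) *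
        ∏ k ∈ Finset.univ.erase j, (if k ∈ v then wavePrimitive (h k) else wave (h k)) (y k) := by
  rw [← waveProd_update, Function.update_eq_self]

theorem fderiv_waveProd_insert {s : ℕ} {h : Fin s → ℤ} {v : Finset (Fin s)} {j : Fin s}
    (hj : h j ≠ 0) (hjv : j ∉ v) (y : Fin s → ℝ) :
    fderiv ℝ (waveProd h (insert j v)) y (Pi.single j 1) = waveProd h v y := by
  refine fderiv_single_eq ((contDiff_waveProd h _).differentiable (by simp) y) ?_
  simp only [waveProd_update, Finset.mem_insert_self, if_true]
  refine ((hasDerivAt_wavePrimitive hj (y j)).mul_const _).congr_deriv ?_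
  rw [waveProd_eq_mul h v j, if_neg hjv]
  congr 1
  refine Finset.prod_congr rfl fun k hk => ?_
  simp only [Finset.mem_insert, Finset.ne_of_mem_erase hk, false_or]

theorem HasMixedDerivs.integrableOn {s : ℕ} {F : (Fin s → ℝ) → ℝ}
    {D : Finset (Fin s) → (Fin s → ℝ) → ℝ} (hF : HasMixedDerivs F D) (u : Finset (Fin s)) :
    IntegrableOn (D u) (cube s) :=
  (hF.memLp u).integrable one_le_two

/-- Each direction in v is integrated by parts once. No boundary terms arise, since the primitives
vanish on the faces, and every step contributes a sign. -/
theorem HasMixedDerivs.integral_mul_wave {s : ℕ} {F : (Fin s → ℝ) → ℝ}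
    {D : Finset (Fin s) → (Fin s → ℝ) → ℝ} (hF : HasMixedDerivs F D) {h : Fin s → ℤ}
    (v : Finset (Fin s)) (hv : ∀ j ∈ v, h j ≠ 0) :
    ∫ y in cube s, (F y : ℂ) * ∏ k, wave (h k) (y k) =
      (-1) ^ v.card * ∫ y in cube s, (D v y : ℂ) * waveProd h v y := by
  induction v using Finset.induction_on with
  | empty => simp [hF.zero, waveProd]
  | insert j v hjv ih =>
    rw [ih fun i hi => hv i (Finset.mem_insert_of_mem hi), Finset.card_insert_of_notMem hjv]
    have hj := hv j (Finset.mem_insert_self j v)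
    simp_rw [← fderiv_waveProd_insert hj hjv]
    rw [(hF.succ v j hjv).integral_complex_eq (hF.integrableOn v) (hF.integrableOn _)
      (contDiff_waveProd h _) ?_]
    · ring
    · intro y _ hy
      rw [waveProd_eq_mul h _ j, if_pos (Finset.mem_insert_self j v)]
      rcases hy with hy | hy
      · rw [hy, wavePrimitive_half, zero_mul]
      · rw [hy, wavePrimitive_neg_half, zero_mul]

/-- Splicing the coordinates in u of one uniform point with the remaining coordinates of another
gives a uniform point. This is how the variables outside u are integrated out without splitting the
cube as a product space. -/
theorem measurePreserving_piecewise {s : ℕ} (u : Finset (Fin s)) :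
    MeasurePreserving (fun p : (Fin s → ℝ) × (Fin s → ℝ) => u.piecewise p.1 p.2)
      ((volume.restrict (cube s)).prod (volume.restrict (cube s))) (volume.restrict (cube s)) := by
  have hm : Measurable fun p : (Fin s → ℝ) × (Fin s → ℝ) => u.piecewise p.1 p.2 := by
    refine measurable_pi_lambda _ fun k => ?_
    by_cases hk : k ∈ u
    · simp only [Finset.piecewise_eq_of_mem _ _ _ hk]
      exact (measurable_pi_apply k).comp measurable_fst
    · simp only [Finset.piecewise_eq_of_notMem _ _ _ hk]
      exact (measurable_pi_apply k).comp measurable_snd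
  refine ⟨hm, ?_⟩
  rw [volume_restrict_cube]
  refine (Measure.pi_eq fun S hS => ?_).symm
  rw [Measure.map_apply hm (MeasurableSet.univ_pi hS)]
  have hpre : (fun p : (Fin s → ℝ) × (Fin s → ℝ) => u.piecewise p.1 p.2) ⁻¹' Set.univ.pi S =
      (Set.univ.pi fun k => if k ∈ u then S k else Set.univ) ×ˢ
        (Set.univ.pi fun k => if k ∈ u then Set.univ else S k) := by
    ext p
    simp only [Set.mem_preimage, Set.mem_univ_pi, Set.mem_prod, ← forall_and]
    refine forall_congr' fun k => ?_
    by_cases hk : k ∈ u <;> simp [hk]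
  rw [hpre, Measure.prod_prod, Measure.pi_pi, Measure.pi_pi, ← Finset.prod_mul_distrib]
  refine Finset.prod_congr rfl fun k _ => ?_
  by_cases hk : k ∈ u <;> simp only [hk, if_true, if_false, measure_univ, mul_one, one_mul]

theorem sq_enorm_integral_mul_le {α : Type*} [MeasurableSpace α] {μ : Measure α} {J : α → ℝ}
    {Φ : α → ℂ} (hJ : AEStronglyMeasurable J μ) (hΦ : AEStronglyMeasurable Φ μ) :
    ‖∫ y, (J y : ℂ) * Φ y ∂μ‖ₑ ^ 2 ≤ (∫⁻ y, ‖Φ y‖ₑ ^ 2 ∂μ) * ∫⁻ y, ENNReal.ofReal (J y ^ 2) ∂μ := by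
  have h₁ : ‖∫ y, (J y : ℂ) * Φ y ∂μ‖ₑ ≤ ∫⁻ y, ‖J y‖ₑ * ‖Φ y‖ₑ ∂μ :=
    (enorm_integral_le_lintegral_enorm _).trans (lintegral_mono fun y => by
      rw [enorm_mul, ← ofReal_norm, Complex.norm_real, ofReal_norm])
  have h₂ := ENNReal.lintegral_mul_le_Lp_mul_Lq μ Real.HolderConjugate.two_two hJ.enorm hΦ.enorm
  have h₃ : ∀ y, ENNReal.ofReal (J y ^ 2) = ‖J y‖ₑ ^ (2 : ℝ) := fun y => by
    rw [← ofReal_norm, ENNReal.rpow_two, ← ENNReal.ofReal_pow (norm_nonneg _), Real.norm_eq_abs,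
      sq_abs]
  have h₄ : ∀ x : ℝ≥0∞, (x ^ (1 / 2 : ℝ)) ^ 2 = x := fun x => by
    rw [← ENNReal.rpow_two, ← ENNReal.rpow_mul]
    norm_num
  simp_rw [h₃, ← ENNReal.rpow_two (‖Φ _‖ₑ)]
  calc _ ≤ ((∫⁻ y, ‖J y‖ₑ ^ (2 : ℝ) ∂μ) ^ (1 / 2 : ℝ) *
        (∫⁻ y, ‖Φ y‖ₑ ^ (2 : ℝ) ∂μ) ^ (1 / 2 : ℝ)) ^ 2 := by
        gcongr
        exact h₁.trans h₂
    _ = _ := by rw [mul_pow, h₄, h₄, mul_comm]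

theorem lintegral_waveProd_sq {s : ℕ} {h : Fin s → ℤ} {u : Finset (Fin s)}
    (hu : ∀ k, k ∈ u ↔ h k ≠ 0) :
    ∫⁻ y in cube s, ‖waveProd h u y‖ₑ ^ 2 =
      ENNReal.ofReal (1 / (2 * Real.pi ^ 2)) ^ u.card * ∏ k ∈ u, absPow 2 (h k) := by
  have hc : Continuous fun y => ‖waveProd h u y‖ ^ 2 := (contDiff_waveProd h u).continuous.norm.pow 2
  have h₁ : ∀ y, ‖waveProd h u y‖ₑ ^ 2 = ENNReal.ofReal (‖waveProd h u y‖ ^ 2) := fun y => by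
    rw [← ofReal_norm, ENNReal.ofReal_pow (norm_nonneg _)]
  simp_rw [h₁]
  rw [← ofReal_integral_eq_lintegral_ofReal
    (hc.continuousOn.integrableOn_compact (isCompact_cube s))
    (Filter.Eventually.of_forall fun y => sq_nonneg _), volume_restrict_cube]
  simp_rw [waveProd, norm_prod, ← Finset.prod_pow]
  rw [integral_fintype_prod_eq_prod
    (fun k x => ‖(if k ∈ u then wavePrimitive (h k) else wave (h k)) x‖ ^ 2),
    ENNReal.ofReal_prod_of_nonneg fun k _ => integral_nonneg fun x => sq_nonneg _,
    ← Finset.prod_const, ← Finset.prod_mul_distrib, ← Finset.prod_subset (Finset.subset_univ u)]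
  · refine Finset.prod_congr rfl fun k hk => ?_
    simp only [hk, if_true]
    exact lintegral_norm_wavePrimitive_sq ((hu k).1 hk)
  · intro k _ hk
    have : h k = 0 := by
      by_contra h0
      exact hk ((hu k).2 h0)
    norm_num [hk, this, wave_zero]

/-- The bound for a Fourier coefficient by the mixed derivative that belongs to the support of
the frequency. -/
theorem HasMixedDerivs.sq_enorm_integral_mul_wave_le {s : ℕ} {F : (Fin s → ℝ) → ℝ}
    {D : Finset (Fin s) → (Fin s → ℝ) → ℝ} (hF : HasMixedDerivs F D) {h : Fin s → ℤ}
    {u : Finset (Fin s)} (hu : ∀ k, k ∈ u ↔ h k ≠ 0) :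
    ‖∫ y in cube s, (F y : ℂ) * ∏ k, wave (h k) (y k)‖ₑ ^ 2 ≤
      ENNReal.ofReal (1 / (2 * Real.pi ^ 2)) ^ u.card * (∏ k ∈ u, absPow 2 (h k)) *
        ∫⁻ y in cube s, ENNReal.ofReal ((∫ t in cube s, D u (u.piecewise y t)) ^ 2) := by
  rw [hF.integral_mul_wave u fun j hj => (hu j).1 hj, enorm_mul]
  have hsign : ‖((-1 : ℂ) ^ u.card)‖ₑ = 1 := by simp [enorm_pow]
  rw [hsign, one_mul, ← lintegral_waveProd_sq hu]
  have hmp := measurePreserving_piecewise u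
  have hcw : Continuous (waveProd h u) := (contDiff_waveProd h u).continuous
  have hpiece : ∀ y t, waveProd h u (u.piecewise y t) = waveProd h u y := fun y t => by
    refine Finset.prod_congr rfl fun k _ => ?_
    by_cases hk : k ∈ u
    · rw [Finset.piecewise_eq_of_mem _ _ _ hk]
    · have : h k = 0 := by
        by_contra h0
        exact hk ((hu k).2 h0)
      simp [hk, this, wave_zero]
  have hint : IntegrableOn (fun y => (D u y : ℂ) * waveProd h u y) (cube s) :=
    IntegrableOn.mul_continuousOn (hF.integrableOn u).ofReal hcw.continuousOn (isCompact_cube s)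
  have hint' : Integrable (fun p : (Fin s → ℝ) × (Fin s → ℝ) =>
      (D u (u.piecewise p.1 p.2) : ℂ) * waveProd h u (u.piecewise p.1 p.2))
      ((volume.restrict (cube s)).prod (volume.restrict (cube s))) :=
    hmp.integrable_comp_of_integrable hint
  -- The kernel depends only on the coordinates in u, because the frequencies outside u are 0. By
  -- Fubini's theorem the derivative may be replaced by its average over the other variables, the
  -- quantity in the norm.
  have heq : ∫ y in cube s, (D u y : ℂ) * waveProd h u y =
      ∫ y in cube s, ((∫ t in cube s, D u (u.piecewise y t) : ℝ) : ℂ) * waveProd h u y := by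
    conv_lhs => rw [← hmp.map_eq]
    rw [integral_map hmp.aemeasurable (by rw [hmp.map_eq]; exact hint.aestronglyMeasurable),
      integral_prod _ hint']
    refine integral_congr_ae (Filter.Eventually.of_forall fun y => ?_)
    simp only [hpiece]
    rw [integral_mul_const, integral_complex_ofReal]
  rw [heq]
  refine sq_enorm_integral_mul_le ?_ hcw.aestronglyMeasurable
  exact (((hF.memLp u).aestronglyMeasurable.comp_measurePreserving hmp)).integral_prod_right'

/-! ### The mean square error as a sum over the dual lattice -/

/-- The Haar probability measure on the torus. -/
noncomputable def torusMeasure (s : ℕ) : Measure (UnitAddTorus (Fin s)) :=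
  Measure.pi fun _ => AddCircle.haarAddCircle

instance isProbabilityMeasure_torusMeasure (s : ℕ) : IsProbabilityMeasure (torusMeasure s) := by
  rw [torusMeasure]; infer_instance

instance isAddRightInvariant_torusMeasure (s : ℕ) :
    (torusMeasure s).IsAddRightInvariant := by
  rw [torusMeasure]; infer_instance

theorem lintegral_torusMeasure {s : ℕ} (f : UnitAddTorus (Fin s) → ℝ≥0∞) :
    ∫⁻ t, f t ∂torusMeasure s = ∫⁻ x in shiftCube s, f fun i => (x i : UnitAddCircle) := by
  have h := UnitAddTorus.lintegral_preimage f 0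
  have hset : {x : Fin s → ℝ | ∀ i, x i ∈ Set.Ioc ((0 : Fin s → ℝ) i) ((0 : Fin s → ℝ) i + 1)} =
      Set.univ.pi fun _ => Set.Ioc (0 : ℝ) 1 := by
    ext x
    simp
  rw [hset] at h
  refine Eq.trans h ?_
  have hae : (Set.univ.pi fun _ : Fin s => Set.Ioc (0 : ℝ) 1) =ᵐ[volume] shiftCube s :=
    Measure.pi_Ioc_ae_eq_pi_Icc
  rw [Measure.restrict_congr_set hae]

open UnitAddTorus in
-- Parseval's identity on the torus, transferred from L² classes to functions.
theorem lintegral_sq_eq_tsum {s : ℕ} {f : UnitAddTorus (Fin s) → ℂ}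
    (hf : MemLp f 2 (torusMeasure s)) :
    ∫⁻ t, ‖f t‖ₑ ^ 2 ∂torusMeasure s =
      ∑' n : Fin s → ℤ, ‖∫ t, mFourier (-n) t • f t ∂torusMeasure s‖ₑ ^ 2 := by
  have hofReal : ∀ c : ℂ, ‖c‖ₑ ^ 2 = ENNReal.ofReal (‖c‖ ^ 2) := fun c => by
    rw [← ofReal_norm, ENNReal.ofReal_pow (norm_nonneg _)]
  have h : HasSum (fun n : Fin s → ℤ => ‖∫ t, mFourier (-n) t • hf.toLp f t ∂torusMeasure s‖ ^ 2)
      (∫ t, ‖hf.toLp f t‖ ^ 2 ∂torusMeasure s) := hasSum_sq_mFourierCoeff (hf.toLp f)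
  have h₁ : ∀ n : Fin s → ℤ, ∫ t, mFourier (-n) t • hf.toLp f t ∂torusMeasure s =
      ∫ t, mFourier (-n) t • f t ∂torusMeasure s := fun n => integral_congr_ae (by
    filter_upwards [hf.coeFn_toLp] with t ht
    rw [ht])
  have h₂ : ∫ t, ‖hf.toLp f t‖ ^ 2 ∂torusMeasure s = ∫ t, ‖f t‖ ^ 2 ∂torusMeasure s :=
    integral_congr_ae (by
      filter_upwards [hf.coeFn_toLp] with t ht
      rw [ht])
  simp only [h₁, h₂] at h
  simp_rw [hofReal]
  rw [← ofReal_integral_eq_lintegral_ofReal ((memLp_two_iff_integrable_sq_norm hf.1).1 hf)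
    (Filter.Eventually.of_forall fun _ => sq_nonneg _),
    ← ENNReal.ofReal_tsum_of_nonneg (fun _ => sq_nonneg _) h.summable, h.tsum_eq]

/-- The point of the cube `[-1/2, 1/2)` that belongs to a point of the circle. -/
noncomputable def circleRep (t : UnitAddCircle) : ℝ := (AddCircle.equivIco 1 0 t : ℝ) - 1 / 2

theorem circleRep_coe (x : ℝ) : circleRep (x : UnitAddCircle) = Int.fract x - 1 / 2 := by
  rw [circleRep]
  have := AddCircle.coe_equivIco_mk_apply (1 : ℝ) x
  rw [div_one, mul_one] at this
  rw [← this]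

theorem coe_circleRep_add (t : UnitAddCircle) :
    ((circleRep t + 1 / 2 : ℝ) : UnitAddCircle) = t := by
  rw [circleRep, sub_add_cancel]
  exact AddCircle.coe_equivIco

/-- Away from a null set the map is a translation by -1/2; only the wrap-around at the endpoint of
the interval differs. -/
theorem measurePreserving_circleRep : MeasurePreserving circleRep AddCircle.haarAddCircle
    (volume.restrict (Set.Icc (-(1 / 2) : ℝ) (1 / 2))) := by
  have hm : Measurable circleRep :=
    (measurable_subtype_coe.comp (AddCircle.measurableEquivIco 1 0).measurable).sub_const _
  have hmk := AddCircle.measurePreserving_mk (1 : ℝ) 0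
  rw [AddCircle.volume_eq_smul_haarAddCircle, ENNReal.ofReal_one, one_smul, zero_add] at hmk
  refine ⟨hm, ?_⟩
  rw [← hmk.map_eq, Measure.map_map hm hmk.measurable]
  have hae : circleRep ∘ ((↑) : ℝ → UnitAddCircle) =ᵐ[volume.restrict (Set.Ioc (0 : ℝ) 1)]
      fun x => x - 1 / 2 := by
    rw [Measure.restrict_congr_set Ioo_ae_eq_Ioc.symm]
    filter_upwards [ae_restrict_mem measurableSet_Ioo] with x hx
    rw [Function.comp, circleRep_coe, Int.fract_eq_self.2 ⟨hx.1.le, hx.2⟩]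
  rw [Measure.map_congr hae]
  have hsub := (measurePreserving_sub_right (volume : Measure ℝ) (1 / 2)).restrict_preimage
    (measurableSet_Ioc (a := (-(1 / 2) : ℝ)) (b := 1 / 2))
  have hpre : (fun x : ℝ => x - 1 / 2) ⁻¹' Set.Ioc (-(1 / 2)) (1 / 2) = Set.Ioc 0 1 := by
    ext x
    simp only [Set.mem_preimage, Set.mem_Ioc]
    constructor <;> rintro ⟨h₁, h₂⟩ <;> constructor <;> linarith
  rw [hpre] at hsub
  rw [hsub.map_eq, Measure.restrict_congr_set Ioc_ae_eq_Icc]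

/-- The point of the cube `[-1/2, 1/2)^s` that belongs to a point of the torus. -/
noncomputable def torusRep {s : ℕ} (t : UnitAddTorus (Fin s)) (i : Fin s) : ℝ := circleRep (t i)

theorem measurePreserving_torusRep (s : ℕ) :
    MeasurePreserving torusRep (torusMeasure s) (volume.restrict (cube s)) := by
  rw [volume_restrict_cube]
  exact measurePreserving_pi _ _ fun _ => measurePreserving_circleRep

open UnitAddTorus in
-- The shift by 1/2 inside `wave` compensates for centring the cube at the origin.
theorem mFourier_neg_eq_prod_wave {s : ℕ} (n : Fin s → ℤ) (t : UnitAddTorus (Fin s)) :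
    mFourier (-n) t = ∏ k, wave (n k) (torusRep t k) := by
  change ∏ k, fourier ((-n) k) (t k) = _
  refine Finset.prod_congr rfl fun k _ => ?_
  rw [← coe_circleRep_add (t k), Pi.neg_apply, fourier_coe_apply, wave, torusRep]
  congr 1
  push_cast
  ring

open UnitAddTorus in
theorem mFourier_neg_sub {s : ℕ} (n : Fin s → ℤ) (t a : UnitAddTorus (Fin s)) :
    mFourier (-n) (t - a) = mFourier n a * mFourier (-n) t := by
  simp only [mFourier, ContinuousMap.coe_mk, ← Finset.prod_mul_distrib]
  refine Finset.prod_congr rfl fun k _ => ?_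
  rw [fourier_apply, fourier_apply, fourier_apply, ← Circle.coe_mul, ← AddCircle.toCircle_add]
  congr 2
  simp only [Pi.neg_apply, Pi.sub_apply, neg_smul, smul_sub]
  abel

open UnitAddTorus in
-- By invariance of Haar measure, translating the function multiplies its Fourier coefficient by a
-- character value at the translation.
theorem integral_mFourier_smul_translate {s : ℕ} {F : (Fin s → ℝ) → ℝ}
    (hF : AEStronglyMeasurable F (volume.restrict (cube s))) (n : Fin s → ℤ)
    (a : UnitAddTorus (Fin s)) :
    ∫ t, mFourier (-n) t • (F (torusRep (t + a)) : ℂ) ∂torusMeasure s =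
      mFourier n a * ∫ y in cube s, (F y : ℂ) * ∏ k, wave (n k) (y k) := by
  have h₁ := integral_add_right_eq_self (μ := torusMeasure s)
    (fun t => mFourier (-n) (t - a) • (F (torusRep t) : ℂ)) a
  simp only [add_sub_cancel_right] at h₁
  have hmp := measurePreserving_torusRep s
  rw [h₁, ← hmp.map_eq, integral_map hmp.aemeasurable, ← integral_const_mul]
  · refine integral_congr_ae (Filter.Eventually.of_forall fun t => ?_)
    simp only [mFourier_neg_sub]
    simp only [mFourier_neg_eq_prod_wave, smul_eq_mul]
    ring
  · rw [hmp.map_eq]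
    exact (Complex.continuous_ofReal.comp_aestronglyMeasurable hF).mul
      (Continuous.aestronglyMeasurable (contDiff_prod_apply fun k => contDiff_wave _).continuous)

theorem integral_prod_wave_eq_zero {s : ℕ} {n : Fin s → ℤ} (hn : n ≠ 0) :
    ∫ y in cube s, ∏ k, wave (n k) (y k) = 0 := by
  obtain ⟨j, hj⟩ := Function.ne_iff.1 hn
  rw [volume_restrict_cube, integral_fintype_prod_eq_prod (fun k => wave (n k))]
  refine Finset.prod_eq_zero (Finset.mem_univ j) ?_
  rw [integral_Icc_eq_integral_Ioc, ← intervalIntegral.integral_of_le (by norm_num),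
    intervalIntegral.integral_eq_sub_of_hasDerivAt (fun x _ => hasDerivAt_wavePrimitive hj x)
      ((contDiff_wave _).continuous.intervalIntegrable _ _), wavePrimitive_half,
    wavePrimitive_neg_half, sub_zero]

open UnitAddTorus in
theorem mFourier_grid {s N : ℕ} [NeZero N] (n : Fin s → ℤ) (g : Fin s → ℕ) (k : ℕ) :
    mFourier n (fun i => (((k : ℝ) * (g i : ℝ) / (N : ℝ) : ℝ) : UnitAddCircle)) =
      (ZMod.stdAddChar (∑ i, (n i : ZMod N) * (g i : ZMod N)) : ℂ) ^ k := by
  rw [addChar_map_sum, ← Finset.prod_pow]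
  change ∏ i, fourier (n i) (((k : ℝ) * (g i : ℝ) / (N : ℝ) : ℝ) : UnitAddCircle) = _
  refine Finset.prod_congr rfl fun i _ => ?_
  rw [← AddChar.map_nsmul_eq_pow, fourier_coe_apply]
  have : k • ((n i : ZMod N) * (g i : ZMod N)) = ((k * (n i * g i) : ℤ) : ZMod N) := by
    push_cast
    rw [nsmul_eq_mul]
  rw [this, ZMod.stdAddChar_coe]
  congr 1
  push_cast
  ring

theorem sum_Icc_stdAddChar_pow {N : ℕ} [NeZero N] (a : ZMod N) :
    ∑ k ∈ Finset.Icc 1 N, (ZMod.stdAddChar a : ℂ) ^ k = if a = 0 then (N : ℂ) else 0 := by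
  split_ifs with ha
  · simp [ha]
  have h₁ : (ZMod.stdAddChar a : ℂ) ≠ 1 := fun h => ha
    (ZMod.injective_stdAddChar (by rw [h, AddChar.map_zero_eq_one]))
  have hN : (ZMod.stdAddChar a : ℂ) ^ N = 1 := by
    rw [← AddChar.map_nsmul_eq_pow, nsmul_eq_mul, ZMod.natCast_self, zero_mul,
      AddChar.map_zero_eq_one]
  have hIcc : Finset.Icc 1 N = Finset.Ico 1 (N + 1) := by
    ext x
    simp only [Finset.mem_Icc, Finset.mem_Ico]
    omega
  rw [hIcc, Finset.sum_Ico_eq_sum_range, Nat.add_sub_cancel]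
  simp_rw [pow_add]
  rw [← Finset.mul_sum, geom_sum_eq h₁, hN, sub_self, zero_div, mul_zero]

/-- The mean square error of a randomly shifted lattice rule is at most the sum of the squares of
the Fourier coefficients over the dual lattice. -/
theorem lintegral_sq_error_le {s : ℕ} {F : (Fin s → ℝ) → ℝ}
    (hF : MemLp F 2 (volume.restrict (cube s))) (N : ℕ) [NeZero N] (g : Fin s → ℕ) :
    ∫⁻ Δ in shiftCube s, ENNReal.ofReal (((∫ y in cube s, F y) - latticeRule N g Δ F) ^ 2) ≤
      ∑' n : Fin s → ℤ, if n ≠ 0 ∧ ∑ i, (n i : ZMod N) * (g i : ZMod N) = 0 then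
        ‖∫ y in cube s, (F y : ℂ) * ∏ k, wave (n k) (y k)‖ₑ ^ 2 else 0 := by
  set I := ∫ y in cube s, F y with hI
  set a : ℕ → UnitAddTorus (Fin s) := fun k i =>
    (((k : ℝ) * (g i : ℝ) / (N : ℝ) : ℝ) : UnitAddCircle) with ha
  set H : UnitAddTorus (Fin s) → ℂ := fun t =>
    (I : ℂ) - (1 / (N : ℂ)) * ∑ k ∈ Finset.Icc 1 N, (F (torusRep (t + a k)) : ℂ) with hH
  have hN : (N : ℂ) ≠ 0 := NeZero.ne _
  have hmem : ∀ k, MemLp (fun t => (F (torusRep (t + a k)) : ℂ)) 2 (torusMeasure s) := fun k =>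
    (hF.comp_measurePreserving ((measurePreserving_torusRep s).comp
      (measurePreserving_add_right (torusMeasure s) (a k)))).ofReal
  have hHmem : MemLp H 2 (torusMeasure s) :=
    (memLp_const _).sub ((memLp_finsetSum _ fun k _ => hmem k).const_mul _)
  have hlhs : ∫⁻ Δ in shiftCube s, ENNReal.ofReal ((I - latticeRule N g Δ F) ^ 2) =
      ∫⁻ t, ‖H t‖ₑ ^ 2 ∂torusMeasure s := by
    rw [lintegral_torusMeasure]
    refine lintegral_congr fun Δ => ?_
    have hpt : ∀ k i, circleRep (((Δ i : ℝ) : UnitAddCircle) + a k i) =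
        Int.fract ((k : ℝ) * (g i : ℝ) / (N : ℝ) + Δ i) - 1 / 2 := fun k i => by
      rw [ha, ← AddCircle.coe_add, circleRep_coe, add_comm]
    have hval : H (fun i => (Δ i : UnitAddCircle)) = ((I - latticeRule N g Δ F : ℝ) : ℂ) := by
      have : ∀ k, torusRep ((fun i => (Δ i : UnitAddCircle)) + a k) =
          fun i => Int.fract ((k : ℝ) * (g i : ℝ) / (N : ℝ) + Δ i) - 1 / 2 := fun k =>
        funext fun i => hpt k i
      simp only [hH, this, latticeRule]
      push_cast
      rfl
    rw [hval, ← ofReal_norm, Complex.norm_real, ← ENNReal.ofReal_pow (norm_nonneg _),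
      Real.norm_eq_abs, sq_abs]
  rw [hlhs, lintegral_sq_eq_tsum hHmem]
  refine ENNReal.tsum_le_tsum fun n => ?_
  set c := ∫ y in cube s, (F y : ℂ) * ∏ k, wave (n k) (y k) with hc
  have hbdd : ∀ {f : UnitAddTorus (Fin s) → ℂ}, Integrable f (torusMeasure s) →
      Integrable (fun t => UnitAddTorus.mFourier (-n) t • f t) (torusMeasure s) := fun hf => by
    refine hf.bdd_mul (c := 1) (ContinuousMap.continuous _).aestronglyMeasurable
      (Filter.Eventually.of_forall fun t => ?_)
    exact (ContinuousMap.norm_coe_le_norm _ t).trans UnitAddTorus.mFourier_norm.le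
  have hk : ∀ k, Integrable (fun t => UnitAddTorus.mFourier (-n) t • (F (torusRep (t + a k)) : ℂ))
      (torusMeasure s) := fun k => hbdd ((hmem k).integrable one_le_two)
  have hone : ∫ t, UnitAddTorus.mFourier (-n) t ∂torusMeasure s =
      ∫ y in cube s, ∏ k, wave (n k) (y k) := by
    have := integral_mFourier_smul_translate (s := s) (F := fun _ => 1)
      aestronglyMeasurable_const n 0
    simpa [UnitAddTorus.mFourier] using this
  -- Averaging the character values over the lattice points leaves the indicator of the dual
  -- lattice. For n = 0 the exact integral cancels this contribution; for n ≠ 0 the constant has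
  -- coefficient 0.
  have hcoef : ∫ t, UnitAddTorus.mFourier (-n) t • H t ∂torusMeasure s =
      I * (∫ y in cube s, ∏ k, wave (n k) (y k)) -
        (if ∑ i, (n i : ZMod N) * (g i : ZMod N) = 0 then c else 0) := by
    have hexp : ∀ t, UnitAddTorus.mFourier (-n) t • H t =
        I * UnitAddTorus.mFourier (-n) t - (1 / (N : ℂ)) * ∑ k ∈ Finset.Icc 1 N,
          UnitAddTorus.mFourier (-n) t • (F (torusRep (t + a k)) : ℂ) := fun t => by
      simp only [hH, smul_eq_mul, ← Finset.mul_sum]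
      ring
    simp_rw [hexp]
    rw [integral_sub, integral_const_mul, integral_const_mul, integral_finsetSum _ fun k _ => hk k,
      hone]
    · congr 1
      simp_rw [integral_mFourier_smul_translate hF.1, ha, mFourier_grid]
      rw [← Finset.sum_mul, sum_Icc_stdAddChar_pow]
      split_ifs
      · field_simp
        rfl
      · simp
    · have := (hbdd (integrable_const (1 : ℂ))).const_mul (I : ℂ)
      simpa using this
    · exact (integrable_finsetSum _ fun k _ => hk k).const_mul _
  rw [hcoef]
  by_cases hn : n = 0
  · have hcI : c = I := by
      simp only [hc, hn, Pi.zero_apply, wave_zero, Finset.prod_const_one, mul_one]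
      exact integral_complex_ofReal
    simp [hn, hcI, wave_zero]
  · rw [integral_prod_wave_eq_zero hn, mul_zero, zero_sub, enorm_neg]
    by_cases h : ∑ i, (n i : ZMod N) * (g i : ZMod N) = 0
    · rw [if_pos h, if_pos ⟨hn, h⟩]
    · rw [if_neg h, if_neg fun h' => h h'.2]
      simp

/-! ### The error bound in the Sobolev space -/

/-- The contribution of the set `u` to the square of the unweighted Sobolev norm. -/
noncomputable def derivEnergy {s : ℕ} (D : Finset (Fin s) → (Fin s → ℝ) → ℝ)
    (u : Finset (Fin s)) : ℝ≥0∞ :=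
  ∫⁻ y in cube s, ENNReal.ofReal ((∫ t in cube s, D u (u.piecewise y t)) ^ 2)

/-- Frequencies with support u are extensions by zero of frequencies on u, and the dual condition
involves only the coordinates in u. -/
theorem tsum_support_le_latticeSum {s N : ℕ} [NeZero N] (p : ℝ) (g : Fin s → ZMod N)
    (u : Finset (Fin s)) :
    ∑' n : Fin s → ℤ, (if (∀ k, k ∈ u ↔ n k ≠ 0) ∧ ∑ i, (n i : ZMod N) * g i = 0 then
        ∏ k ∈ u, absPow p (n k) else 0) ≤ latticeSum p fun i : u => g i := by
  refine le_trans ?_ (tsum_dual_le_latticeSum p fun i : u => g i)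
  set ext : (u → ℤ) → Fin s → ℤ := fun n' k => if hk : k ∈ u then n' ⟨k, hk⟩ else 0 with hext
  have hval : ∀ n' (i : u), ext n' i = n' i := fun n' i => by simp [hext]
  have hinj : Function.Injective ext := fun n₁ n₂ h => funext fun i => by
    rw [← hval n₁, ← hval n₂, h]
  rw [← hinj.tsum_eq]
  · refine ENNReal.tsum_le_tsum fun n' => ?_
    have hsum : ∑ i, ((ext n' i : ℤ) : ZMod N) * g i = ∑ i : u, (n' i : ZMod N) * g i := by
      rw [← Finset.sum_subset (Finset.subset_univ u), ← Finset.sum_coe_sort]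
      · simp_rw [hval]
      · intro k _ hk
        simp [hext, hk]
    have hprod : ∏ k ∈ u, absPow p (ext n' k) = ∏ i : u, absPow p (n' i) := by
      rw [← Finset.prod_coe_sort]
      simp_rw [hval]
    rw [hsum, hprod]
    split_ifs with h₁ h₂ h₂
    · exact le_rfl
    · exact absurd h₁.2 h₂
    · exact zero_le
    · exact le_rfl
  · intro n hn
    have hn' : ∀ k, k ∈ u ↔ n k ≠ 0 := by
      by_contra h
      exact hn (if_neg fun h' => h h'.1)
    refine ⟨fun i => n i, funext fun k => ?_⟩
    by_cases hk : k ∈ u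
    · simp [hext, hk]
    · have := (hn' k).not.1 hk
      simp only [hext, hk, dif_neg, not_false_eq_true]
      exact (not_not.1 this).symm

/-- The nonzero dual frequencies are sorted by their support, so that each is estimated with the
mixed derivative in exactly the directions where it oscillates. -/
theorem HasMixedDerivs.lintegral_sq_error_le {s : ℕ} {F : (Fin s → ℝ) → ℝ}
    {D : Finset (Fin s) → (Fin s → ℝ) → ℝ} (hF : HasMixedDerivs F D) (N : ℕ) [NeZero N]
    (g : Fin s → ℕ) :
    ∫⁻ Δ in shiftCube s, ENNReal.ofReal (((∫ y in cube s, F y) - latticeRule N g Δ F) ^ 2) ≤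
      ∑ u : Finset (Fin s), if u.Nonempty then ENNReal.ofReal (1 / (2 * Real.pi ^ 2)) ^ u.card *
        latticeSum 2 (fun i : u => (g i : ZMod N)) * derivEnergy D u else 0 := by
  have hF2 : MemLp F 2 (volume.restrict (cube s)) := hF.zero ▸ hF.memLp ∅
  refine (RedCBC.lintegral_sq_error_le hF2 N g).trans ?_
  set κ := ENNReal.ofReal (1 / (2 * Real.pi ^ 2)) with hκ
  set X : Finset (Fin s) → (Fin s → ℤ) → ℝ≥0∞ := fun u n =>
    if (∀ k, k ∈ u ↔ n k ≠ 0) ∧ ∑ i, (n i : ZMod N) * (g i : ZMod N) = 0 then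
      ∏ k ∈ u, absPow 2 (n k) else 0 with hX
  have hterm : ∀ n : Fin s → ℤ, (if n ≠ 0 ∧ ∑ i, (n i : ZMod N) * (g i : ZMod N) = 0 then
        ‖∫ y in cube s, (F y : ℂ) * ∏ k, wave (n k) (y k)‖ₑ ^ 2 else 0) ≤
      ∑ u : Finset (Fin s), if u.Nonempty then κ ^ u.card * derivEnergy D u * X u n else 0 :=
      fun n => by
    split_ifs with h
    swap
    · exact zero_le
    set u := Finset.univ.filter fun k => n k ≠ 0 with hu
    have hmem : ∀ k, k ∈ u ↔ n k ≠ 0 := fun k => by simp [hu]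
    have hne : u.Nonempty := by
      obtain ⟨k, hk⟩ := Function.ne_iff.1 h.1
      exact ⟨k, (hmem k).2 hk⟩
    refine le_trans ?_ (Finset.single_le_sum (fun _ _ => zero_le) (Finset.mem_univ u))
    rw [if_pos hne]
    simp only [hX]
    rw [if_pos ⟨hmem, h.2⟩]
    refine (hF.sq_enorm_integral_mul_wave_le hmem).trans (le_of_eq ?_)
    rw [derivEnergy]
    ring
  refine (ENNReal.tsum_le_tsum hterm).trans ?_
  rw [Summable.tsum_finsetSum fun _ _ => ENNReal.summable]
  refine Finset.sum_le_sum fun u _ => ?_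
  split_ifs
  · rw [ENNReal.tsum_mul_left, mul_right_comm]
    gcongr
    exact tsum_support_le_latticeSum 2 (fun i => (g i : ZMod N)) u
  · simp

theorem latticeSum_comp_equiv {N : ℕ} [NeZero N] {ι κ : Type*} [Fintype ι] [DecidableEq ι]
    [Fintype κ] [DecidableEq κ] (p : ℝ) (σ : ι ≃ κ) (g : κ → ZMod N) :
    latticeSum p (fun i => g (σ i)) = latticeSum p g := by
  rw [latticeSum, latticeSum, ← (Equiv.arrowCongr σ (Equiv.refl (ZMod N))).sum_comp]
  refine Finset.sum_congr rfl fun r _ => ?_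
  simp only [Equiv.arrowCongr_apply, Equiv.coe_refl, Function.comp, id]
  rw [← σ.sum_comp, ← σ.prod_comp]
  simp

/-- The coordinate `i` of a point has the index `i + 1`. -/
def indexEmb (s : ℕ) : Fin s ↪ ℕ := ⟨fun i => i + 1, fun i j h => Fin.ext (by simpa using h)⟩

theorem indexEmb_apply {s : ℕ} (i : Fin s) : indexEmb s i = (i : ℕ) + 1 := rfl

theorem latticeSum_genVec {b m s : ℕ} [NeZero b] (w z : ℕ → ℕ) (u : Finset (Fin s)) :
    latticeSum 2 (fun i : u => ((genVec b s w z i : ℕ) : ZMod (b ^ m))) =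
      dualSum b m w 2 z (u.map (indexEmb s)) := by
  let σ : u ≃ (u.map (indexEmb s) : Finset ℕ) :=
    Equiv.ofBijective (fun i => ⟨indexEmb s i, Finset.mem_map_of_mem _ i.2⟩)
      ⟨fun i j h => Subtype.ext ((indexEmb s).injective (Subtype.ext_iff.1 h)), fun j => by
        obtain ⟨i, hi, hij⟩ := Finset.mem_map.1 j.2
        exact ⟨⟨i, hi⟩, Subtype.ext hij⟩⟩
  rw [dualSum, ← latticeSum_comp_equiv 2 σ]
  rfl

theorem sum_powerset_Icc_eq {E : Type*} [AddCommMonoid E] (s : ℕ) (f : Finset ℕ → E) :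
    ∑ u ∈ (Finset.Icc 1 s).powerset, f u = ∑ u : Finset (Fin s), f (u.map (indexEmb s)) := by
  have hIcc : Finset.Icc 1 s = Finset.univ.map (indexEmb s) := by
    ext j
    simp only [Finset.mem_Icc, Finset.mem_map, Finset.mem_univ, true_and, indexEmb_apply]
    constructor
    · rintro ⟨h₁, h₂⟩
      exact ⟨⟨j - 1, by omega⟩, by simp; omega⟩
    · rintro ⟨i, rfl⟩
      have := i.2
      omega
  rw [hIcc]
  symm
  refine Finset.sum_nbij (fun u => u.map (indexEmb s)) (fun u _ => ?_) (fun u _ v _ h => ?_)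
    (fun t ht => ?_) fun _ _ => rfl
  · exact Finset.mem_powerset.2 (Finset.map_subset_map.2 (Finset.subset_univ u))
  · exact Finset.map_injective _ h
  · obtain ⟨u, -, rfl⟩ := Finset.subset_map_iff.1 (Finset.mem_powerset.1 ht)
    exact ⟨u, Finset.mem_coe.2 (Finset.mem_univ u), rfl⟩

theorem setWeight_map {s : ℕ} (Γ γ : ℕ → ℝ) (u : Finset (Fin s)) :
    setWeight Γ (fun j => γ j / (2 * Real.pi ^ 2)) (u.map (indexEmb s)) =
      ENNReal.ofReal (podWeight Γ γ u * (1 / (2 * Real.pi ^ 2)) ^ u.card) := by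
  rw [setWeight, podWeight, Finset.card_map, Finset.prod_map]
  simp_rw [indexEmb_apply, div_eq_mul_one_div (γ _)]
  rw [Finset.prod_mul_distrib, Finset.prod_const, mul_assoc]

theorem podWeight_nonneg {s : ℕ} {Γ γ : ℕ → ℝ} (hΓ : ∀ ℓ, 0 < Γ ℓ) (hγ : ∀ j, 0 ≤ γ j)
    (u : Finset (Fin s)) : 0 ≤ podWeight Γ γ u :=
  mul_nonneg (hΓ _).le (Finset.prod_nonneg fun _ _ => hγ _)

/-- A negative value would truncate the sum of |h|^(-p) to 0, although the term h = 1 equals 1. -/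
theorem riemannZeta_re_nonneg {p : ℝ} (hp : 1 < p) : 0 ≤ 2 * (riemannZeta (p : ℂ)).re := by
  by_contra! h
  have h₁ := tsum_absPow hp
  rw [ENNReal.ofReal_of_nonpos h.le] at h₁
  have h₂ := ENNReal.le_tsum (f := fun h : ℤ => absPow p h) 1
  rw [h₁] at h₂
  simp [absPow] at h₂

/-- Running the construction with γ_j/(2π²) makes its criterion coincide with the bound for the mean
square error. In the λ-th power the factors (2π²)^(-λ) and 2ζ(2λ) merge into ϱ(λ). -/
theorem rpow_sum_dualSum_le_ofReal {b m s : ℕ} [NeZero b] (hb : b.Prime) {w : ℕ → ℕ}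
    (hw : MonotoneOn w (Set.Ici 1)) {Γ γ : ℕ → ℝ} (hΓ₀ : Γ 0 = 1) (hΓ : ∀ ℓ, 0 < Γ ℓ)
    (hγ : ∀ j, 0 ≤ γ j) {z : ℕ → ℕ}
    (hz : IsFastRedCBC b m s w (korobovOmega 2) Γ (fun j => γ j / (2 * Real.pi ^ 2)) z)
    {lam : ℝ} (h₀ : 1 / 2 < lam) (h₁ : lam ≤ 1) :
    (∑ u : Finset (Fin s), if u.Nonempty then
        ENNReal.ofReal (podWeight Γ γ u * (1 / (2 * Real.pi ^ 2)) ^ u.card) *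
          dualSum b m w 2 z (u.map (indexEmb s)) else 0) ^ (1 / 2 : ℝ) ≤
      ENNReal.ofReal (errorFactor b m s w (podWeight Γ γ) lam) := by
  have hlam : 0 < lam := by linarith
  have hb0 : (0 : ℝ) < b := Nat.cast_pos.2 hb.pos
  have hζ := riemannZeta_re_nonneg (p := 2 * lam) (by linarith)
  have hκ : (0 : ℝ) ≤ 1 / (2 * Real.pi ^ 2) := by positivity
  have hrho : 0 ≤ rho lam := mul_nonneg hζ (by positivity)
  have hmain := rpow_sum_nonempty_le (s := s) hb hw hΓ₀ hΓ
    (fun j => div_nonneg (hγ j) (by positivity)) hz h₀ h₁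
  simp only [sum_powerset_Icc_eq, setWeight_map, Finset.map_nonempty, Finset.card_map] at hmain
  set A : ℝ := ∑ u ∈ Finset.univ.filter (fun u : Finset (Fin s) => u.Nonempty),
      podWeight Γ γ u ^ lam * rho lam ^ u.card
        * (b : ℝ) ^ min m (u.sup fun i => w ((i : ℕ) + 1)) with hA
  have hterm0 : ∀ u : Finset (Fin s), 0 ≤ podWeight Γ γ u ^ lam * rho lam ^ u.card
        * (b : ℝ) ^ min m (u.sup fun i => w ((i : ℕ) + 1)) := fun u =>
    mul_nonneg (mul_nonneg (Real.rpow_nonneg (podWeight_nonneg hΓ hγ u) _) (pow_nonneg hrho _))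
      (by positivity)
  have hA0 : 0 ≤ A := Finset.sum_nonneg fun u _ => hterm0 u
  have hsum : (∑ u : Finset (Fin s), if u.Nonempty then
      ENNReal.ofReal (podWeight Γ γ u * (1 / (2 * Real.pi ^ 2)) ^ u.card) ^ lam *
        (((b ^ min m ((u.map (indexEmb s)).sup w) : ℕ) : ℝ≥0∞) * (2 * ((b ^ m : ℕ) : ℝ≥0∞)⁻¹) *
          (∑' h : ℤ, absPow (2 * lam) h) ^ u.card) else 0) =
      ENNReal.ofReal (A * (2 / (b : ℝ) ^ m)) := by
    rw [hA, Finset.sum_mul, ENNReal.ofReal_sum_of_nonneg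
      (fun u _ => mul_nonneg (hterm0 u) (by positivity)), Finset.sum_filter]
    refine Finset.sum_congr rfl fun u _ => ?_
    split_ifs
    swap
    · rfl
    have hwt := podWeight_nonneg hΓ hγ u
    have hsup : (u.map (indexEmb s)).sup w = u.sup fun i => w ((i : ℕ) + 1) := by
      rw [Finset.sup_map]
      rfl
    have hnat : ∀ n : ℕ, ((b ^ n : ℕ) : ℝ≥0∞) = ENNReal.ofReal ((b : ℝ) ^ n) := fun n => by
      rw [← Nat.cast_pow, ENNReal.ofReal_natCast]
    have htwo : (2 : ℝ≥0∞) = ENNReal.ofReal 2 := by simp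
    rw [hsup, hnat, hnat, ← ENNReal.ofReal_inv_of_pos (by positivity), htwo,
      tsum_absPow (by linarith), ENNReal.ofReal_rpow_of_nonneg (by positivity) hlam.le,
      ← ENNReal.ofReal_pow hζ, ← ENNReal.ofReal_mul (by positivity),
      ← ENNReal.ofReal_mul (by positivity), ← ENNReal.ofReal_mul (by positivity),
      ← ENNReal.ofReal_mul (by positivity)]
    congr 1
    have hpow : ((1 / (2 * Real.pi ^ 2)) ^ u.card : ℝ) ^ lam =
        ((2 * Real.pi ^ 2) ^ (-lam)) ^ u.card := by
      rw [← Real.rpow_natCast, ← Real.rpow_mul hκ, mul_comm (u.card : ℝ), Real.rpow_mul hκ, Real.rpow_natCast,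
        one_div, Real.inv_rpow (by positivity), Real.rpow_neg (by positivity)]
    rw [Real.mul_rpow hwt (by positivity), hpow, rho, mul_pow (2 * _)]
    ring
  rw [hsum] at hmain
  have hfac : errorFactor b m s w (podWeight Γ γ) lam =
      (A * (2 / (b : ℝ) ^ m)) ^ (1 / (2 * lam)) := by
    rw [errorFactor, Real.mul_rpow hA0 (by positivity)]
  rw [hfac, ← ENNReal.ofReal_rpow_of_nonneg (by positivity) (by positivity)]
  -- Taking the power 1/(2λ) of a bound on the λ-th power yields the square root.
  refine le_trans (le_of_eq ?_) (ENNReal.rpow_le_rpow hmain (z := 1 / (2 * lam)) (by positivity))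
  rw [← ENNReal.rpow_mul]
  congr 1
  field_simp

theorem rmsError_le {b m s : ℕ} (hb : b.Prime) {w : ℕ → ℕ}
    (hw : MonotoneOn w (Set.Ici 1)) {Γ γ : ℕ → ℝ} (hΓ₀ : Γ 0 = 1) (hΓ : ∀ ℓ, 0 < Γ ℓ)
    (hγ : ∀ j, 0 ≤ γ j) {z : ℕ → ℕ}
    (hz : IsFastRedCBC b m s w (korobovOmega 2) Γ (fun j => γ j / (2 * Real.pi ^ 2)) z)
    {lam : ℝ} (h₀ : 1 / 2 < lam) (h₁ : lam ≤ 1) {F : (Fin s → ℝ) → ℝ}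
    {D : Finset (Fin s) → (Fin s → ℝ) → ℝ} (hF : HasMixedDerivs F D)
    (hfin : sobolevNorm (podWeight Γ γ) D < ⊤) :
    rmsError (b ^ m) (genVec b s w z) F ≤
      ENNReal.ofReal (errorFactor b m s w (podWeight Γ γ) lam)
        * sobolevNorm (podWeight Γ γ) D := by
  have : NeZero b := ⟨hb.ne_zero⟩
  have hsob : sobolevNorm (podWeight Γ γ) D =
      (∑ u : Finset (Fin s), (ENNReal.ofReal (podWeight Γ γ u))⁻¹ * derivEnergy D u) ^
        (1 / 2 : ℝ) := rfl
  rw [hsob] at hfin ⊢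
  set S := ∑ u : Finset (Fin s), (ENNReal.ofReal (podWeight Γ γ u))⁻¹ * derivEnergy D u with hS
  have hSfin : S < ⊤ := by
    by_contra h
    rw [not_lt_top_iff.1 h] at hfin
    simp at hfin
  have hle : ∀ u, (ENNReal.ofReal (podWeight Γ γ u))⁻¹ * derivEnergy D u ≤ S := fun u =>
    Finset.single_le_sum (f := fun u => (ENNReal.ofReal (podWeight Γ γ u))⁻¹ * derivEnergy D u)
      (fun _ _ => zero_le) (Finset.mem_univ u)
  refine le_trans ?_ (mul_le_mul_left (rpow_sum_dualSum_le_ofReal hb hw hΓ₀ hΓ hγ hz h₀ h₁) _)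
  rw [← ENNReal.mul_rpow_of_nonneg _ _ (by norm_num), rmsError]
  refine ENNReal.rpow_le_rpow ((hF.lintegral_sq_error_le (b ^ m) (genVec b s w z)).trans ?_)
    (by norm_num)
  rw [Finset.sum_mul]
  refine Finset.sum_le_sum fun u _ => ?_
  split_ifs
  swap
  · simp
  rw [latticeSum_genVec, ENNReal.ofReal_mul (podWeight_nonneg hΓ hγ u),
    ENNReal.ofReal_pow (by positivity)]
  -- Each weighted energy is a single term of the squared norm. If γ_u = 0, finiteness of the norm
  -- forces the energy to vanish, so such sets contribute nothing.
  have hE : derivEnergy D u ≤ ENNReal.ofReal (podWeight Γ γ u) * S := by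
    rcases eq_or_ne (ENNReal.ofReal (podWeight Γ γ u)) 0 with h | h
    · have hu := (hle u).trans_lt hSfin
      rw [h, ENNReal.inv_zero] at hu
      have : derivEnergy D u = 0 := by
        by_contra h0
        rw [ENNReal.top_mul h0] at hu
        exact lt_irrefl _ hu
      rw [this]
      exact zero_le
    · calc derivEnergy D u = ENNReal.ofReal (podWeight Γ γ u) *
          ((ENNReal.ofReal (podWeight Γ γ u))⁻¹ * derivEnergy D u) := by
            rw [← mul_assoc, ENNReal.mul_inv_cancel h ENNReal.ofReal_ne_top, one_mul]
        _ ≤ _ := mul_le_mul_right (hle u) _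
  refine (mul_le_mul_right hE _).trans (le_of_eq ?_)
  ring

end RedCBC

theorem theorem4 (b : ℕ) (hb : b.Prime) :
    -- POD weights: cost and memory of the construction, with a constant that depends only on `b`
    (∃ C : ℕ, ∀ (m s : ℕ) (w : ℕ → ℕ), MonotoneOn w (Set.Ici 1) →
      ∃ P : Prog,
        P.cost ≤ C * ∑ j ∈ Finset.Icc 1 (lastIndex w m s), (m - w j + j) * b ^ (m - w j) ∧
        P.memory ≤ C * ∑ j ∈ Finset.Icc 1 (lastIndex w m s), b ^ (m - w j) ∧
        ∀ (α : ℝ) (Γ γ : ℕ → ℝ), 1 < α → Γ 0 = 1 → (∀ ℓ, 0 < Γ ℓ) → (∀ j, 0 ≤ γ j) →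
          IsFastRedCBC b m s w (korobovOmega α) Γ γ (P.output ⟨korobovOmega α, Γ, γ⟩)) ∧
    -- product weights
    (∃ C : ℕ, ∀ (m s : ℕ) (w : ℕ → ℕ), MonotoneOn w (Set.Ici 1) →
      ∃ P : Prog,
        P.cost ≤ C * ∑ j ∈ Finset.Icc 1 (lastIndex w m s), (m - w j) * b ^ (m - w j) ∧
        P.memory ≤ C * b ^ (m - w 1) ∧
        ∀ (α : ℝ) (γ : ℕ → ℝ), 1 < α → (∀ j, 0 ≤ γ j) →
          IsFastRedCBC b m s w (korobovOmega α) (fun _ => 1) γ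
            (P.output ⟨korobovOmega α, fun _ => 1, γ⟩)) ∧
    -- every result of the construction for the Sobolev space (`α = 2`, and `γ_j` divided by `2π²`)
    -- satisfies the error bound
    (∀ (m s : ℕ) (w : ℕ → ℕ) (Γ γ : ℕ → ℝ) (z : ℕ → ℕ), MonotoneOn w (Set.Ici 1) →
      Γ 0 = 1 → (∀ ℓ, 0 < Γ ℓ) → (∀ j, 0 ≤ γ j) →
      IsFastRedCBC b m s w (korobovOmega 2) Γ (fun j => γ j / (2 * Real.pi ^ 2)) z →
      ∀ lam : ℝ, 1 / 2 < lam → lam ≤ 1 →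
      ∀ (F : (Fin s → ℝ) → ℝ) (D : Finset (Fin s) → (Fin s → ℝ) → ℝ), HasMixedDerivs F D →
        sobolevNorm (podWeight Γ γ) D < ⊤ →
        rmsError (b ^ m) (genVec b s w z) F ≤
          ENNReal.ofReal (errorFactor b m s w (podWeight Γ γ) lam)
            * sobolevNorm (podWeight Γ γ) D) := by
  refine ⟨⟨48 * b ^ 2 + 24 * b + 63, fun m s w hw => ?_⟩,
    ⟨48 * b ^ 2 + 24 * b + 63, fun m s w hw => ?_⟩, ?_⟩
  · obtain ⟨P, hcost, hmem, hP⟩ := exists_prog_pod hb m s hw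
    exact ⟨P, hcost, hmem.trans (Nat.mul_le_mul_right _ (by omega)), fun α Γ γ _ _ _ _ => hP _⟩
  · obtain ⟨P, hcost, hmem, hP⟩ := exists_prog_product hb m s hw
    exact ⟨P, hcost, hmem.trans (Nat.mul_le_mul_right _ (by omega)), fun α γ _ _ => hP _ rfl⟩
  · intro m s w Γ γ z hw hΓ₀ hΓ hγ hz lam h₀ h₁ F D hF hfin
    exact rmsError_le hb hw hΓ₀ hΓ hγ hz h₀ h₁ hF hfin
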